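/- Let $N,m\ge 1$ be integers, let $\Omega\subset\mathbb R^N$ be a nonempty open bounded convex set, and let $\phi:\Omega\to(0,+\infty)$ be $\frac1m$-concave, i.e. $\phi^{1/m}$ is concave on $\Omega$. Let $\mu_\phi$ be the measure on $\mathbb R^N$ with density $\phi$ on $\Omega$ and $0$ outside $\Omega$, and write $|E|_\phi:=\mu_\phi(E)=\int_{E\cap\Omega}\phi$ for Lebesgue measurable $E$ and $L^1_\phi(\Omega):=L^1(\mu_\phi)$. Let $W^{1,1}_\phi(\Omega)$ be the space of functions $u\in L^1_\phi(\Omega)$ having a weak gradient $\nabla u$ on $\Omega$ with $|\nabla u|\in L^1_\phi(\Omega)$. Let $X_\phi$ be the set of all $\sigma\in L^\infty(\mu_\phi;\mathbb R^N)$ for which the distribution $\operatorname{div}(\sigma\mu_\phi)\in\mathcal D'(\mathbb R^N)$, defined by $\langle \operatorname{div}(\sigma\mu_\phi),\psi\rangle=-\int\sigma\cdot\nabla\psi\,d\mu_\phi$ for $\psi\in\mathcal D(\mathbb R^N)$, is of the form $g\,\mu_\phi$ with $g\in L^\infty(\mu_\phi)$. For $u\in L^1_\phi(\Omega)$ set $$|D_\phi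 u|(\Omega):=\sup\Big\{-\int u\,g\,d\mu_\phi\ :\ \sigma\in X_\phi,\ \operatorname{div}(\sigma\mu_\phi)=g\mu_\phi,\ |\sigma|\le 1\text{ a.e. on }\Omega\Big\}\in[0,+\infty],$$ let $BV_\phi(\Omega):=\{u\in L^1_\phi(\Omega): |D_\phi u|(\Omega)<+\infty\}$, and set $\mathrm{Per}_\phi(E,\Omega):=|D_\phi\chi_E|(\Omega)$ for $E$ Lebesgue measurable. Define $$\sigma_1(\Omega,\phi):=\inf_{\substack{u\in W^{1,1}_\phi(\Omega)\setminus\{0\}\\ \int_\Omega u\phi=0}}\frac{\int_\Omega|\nabla u|\phi}{\int_\Omega|u|\phi},\qquad \overline\sigma_1(\Omega,\phi):=\inf_{\substack{u\in BV_\phi(\Omega)\setminus\{0\}\\ \int_\Omega u\phi=0}}\frac{|D_\phi u|(\Omega)}{\int_\Omega|u|\phi},$$ $$\sigma_1^*(\Omega,\phi):=\inf_{\substack{E\subset\Omega\\ |E|_\phi>0,\ |\Omega\setminus E|_\phi>0}}\frac{|\Omega|_\phi\,\mathrm{Per}_\phi(E,\Omega)}{2|E|_\phi|\Omega\setminus E|_\phi},\qquad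 \widetilde\sigma_1(\Omega,\phi):=\inf_{\substack{A,B\subset\Omega,\ a,b>0,\ A\cap B=\emptyset\\ a|A|_\phi=b|B|_\phi>0}}\frac{a\,\mathrm{Per}_\phi(A,\Omega)+b\,\mathrm{Per}_\phi(B,\Omega)}{a|A|_\phi+b|B|_\phi},$$ where $E,A,B$ range over Lebesgue measurable sets. Then $$\sigma_1(\Omega,\phi)=\overline\sigma_1(\Omega,\phi)=\sigma_1^*(\Omega,\phi)=\widetilde\sigma_1(\Omega,\phi),$$ and the infima defining $\overline\sigma_1(\Omega,\phi)$, $\sigma_1^*(\Omega,\phi)$ and $\widetilde\sigma_1(\Omega,\phi)$ are attained. Moreover, if $u$ is optimal for $\overline\sigma_1(\Omega,\phi)$, then for almost every $t\in\mathbb R$ such that $|\{u>t\}|_\phi>0$ and $|\Omega\setminus\{u>t\}|_\phi>0$, the level set $\{u>t\}$ is optimal for $\sigma_1^*(\Omega,\phi)$. -/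

import Mathlib

open MeasureTheory Set
open scoped ENNReal NNReal ContDiff

noncomputable section

namespace WeightedFence

/-- The Euclidean space `ℝ^N`. -/
abbrev Eucl (N : ℕ) : Type := EuclideanSpace ℝ (Fin N)

/-- The weight `φ` is `(1/m)`-concave on `Ω`: `φ ^ (1/m)` is concave on `Ω`
(`ConcaveOn` contains the convexity of `Ω`). -/
def IsRootConcaveOn {N : ℕ} (m : ℕ) (Ω : Set (Eucl N)) (φ : Eucl N → ℝ) : Prop :=
  ConcaveOn ℝ Ω (fun x => φ x ^ (1 / (m : ℝ)))

/-- The measure `μ_φ = φ 𝓛^N`, with `φ` extended by zero outside `Ω`.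
In particular `|E|_φ = μ_φ E = ∫_{E ∩ Ω} φ`. -/
def wMeasure {N : ℕ} (Ω : Set (Eucl N)) (φ : Eucl N → ℝ) : Measure (Eucl N) :=
  (volume.restrict Ω).withDensity (fun x => ENNReal.ofReal (φ x))

/-- The weighted `L¹` norm `∫_Ω |u| φ` of a scalar function or of a vector field. -/
def wNorm {N : ℕ} {F : Type*} [NormedAddCommGroup F] (Ω : Set (Eucl N)) (φ : Eucl N → ℝ)
    (u : Eucl N → F) : ℝ≥0∞ :=
  ∫⁻ x, ‖u x‖ₑ ∂(wMeasure Ω φ)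

/-- `G` is the weak (distributional) gradient of `u` on `Ω`. -/
structure HasWeakGradient {N : ℕ} (Ω : Set (Eucl N)) (u : Eucl N → ℝ)
    (G : Eucl N → Eucl N) : Prop where
  locallyIntegrableOn : LocallyIntegrableOn u Ω volume
  locallyIntegrableOn_grad : LocallyIntegrableOn G Ω volume
  integral_eq : ∀ ψ : Eucl N → ℝ, ContDiff ℝ ∞ ψ → HasCompactSupport ψ → tsupport ψ ⊆ Ω →
    ∀ v : Eucl N, ∫ x in Ω, u x * fderiv ℝ ψ x v = - ∫ x in Ω, inner ℝ (G x) v * ψ x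

/-- `u` belongs to the weighted Sobolev space `W^{1,1}_φ(Ω)`, with weak gradient `G`. -/
structure MemSobolev {N : ℕ} (Ω : Set (Eucl N)) (φ : Eucl N → ℝ) (u : Eucl N → ℝ)
    (G : Eucl N → Eucl N) : Prop where
  integrable : Integrable u (wMeasure Ω φ)
  integrable_grad : Integrable G (wMeasure Ω φ)
  hasWeakGradient : HasWeakGradient Ω u G

/-- `σ` belongs to `X_φ`, with `div (σ μ_φ) = g μ_φ` in the sense of distributions on the whole
of `ℝ^N`: `σ` and `g` are in `L^∞(μ_φ)` and `-∫ σ · ∇ψ dμ_φ = ∫ g ψ dμ_φ` for all test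
functions `ψ ∈ 𝓓(ℝ^N)`. -/
structure MemX {N : ℕ} (Ω : Set (Eucl N)) (φ : Eucl N → ℝ) (σ : Eucl N → Eucl N)
    (g : Eucl N → ℝ) : Prop where
  memLp : MemLp σ ⊤ (wMeasure Ω φ)
  memLp_div : MemLp g ⊤ (wMeasure Ω φ)
  div_eq : ∀ ψ : Eucl N → ℝ, ContDiff ℝ ∞ ψ → HasCompactSupport ψ →
    - ∫ x, fderiv ℝ ψ x (σ x) ∂(wMeasure Ω φ) = ∫ x, g x * ψ x ∂(wMeasure Ω φ)

/-- The weighted total variation `|D_φ u|(Ω)`, the supremum of `-⟨u, div (σ μ_φ)⟩` over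
`σ ∈ X_φ` with `|σ| ≤ 1` a.e. on `Ω`. (The field `σ = 0` competes, so that truncating negative
values to `0` does not affect the supremum.) -/
def variation {N : ℕ} (Ω : Set (Eucl N)) (φ : Eucl N → ℝ) (u : Eucl N → ℝ) : ℝ≥0∞ :=
  ⨆ (σ : Eucl N → Eucl N) (g : Eucl N → ℝ) (_ : MemX Ω φ σ g)
    (_ : ∀ᵐ x ∂(volume.restrict Ω), ‖σ x‖ ≤ 1),
    ENNReal.ofReal (- ∫ x, u x * g x ∂(wMeasure Ω φ))

/-- `u ∈ BV_φ(Ω)`. -/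
def MemBV {N : ℕ} (Ω : Set (Eucl N)) (φ : Eucl N → ℝ) (u : Eucl N → ℝ) : Prop :=
  Integrable u (wMeasure Ω φ) ∧ variation Ω φ u < ⊤

/-- The weighted perimeter `Per_φ(E, Ω) = |D_φ χ_E|(Ω)`, infinite when `E` does not have finite
`φ`-perimeter. -/
def perimeter {N : ℕ} (Ω : Set (Eucl N)) (φ : Eucl N → ℝ) (E : Set (Eucl N)) : ℝ≥0∞ :=
  variation Ω φ (E.indicator (fun _ => (1 : ℝ)))

/-! ### The Sobolev constant -/

/-- `σ₁(Ω, φ)`: infimum of `∫_Ω |∇u| φ / ∫_Ω |u| φ` over the nonzero `u ∈ W^{1,1}_φ(Ω)` with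
`∫_Ω u φ = 0`. -/
def sigmaOne {N : ℕ} (Ω : Set (Eucl N)) (φ : Eucl N → ℝ) : ℝ≥0∞ :=
  ⨅ (u : Eucl N → ℝ) (G : Eucl N → Eucl N) (_ : MemSobolev Ω φ u G)
    (_ : ∫ x, u x ∂(wMeasure Ω φ) = 0) (_ : wNorm Ω φ u ≠ 0),
    wNorm Ω φ G / wNorm Ω φ u

/-! ### The relaxed constant -/

/-- Competitors for the relaxed problem: nonzero `u ∈ BV_φ(Ω)` with `∫_Ω u φ = 0`. -/
def BVAdmissible {N : ℕ} (Ω : Set (Eucl N)) (φ : Eucl N → ℝ) (u : Eucl N → ℝ) : Prop :=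
  MemBV Ω φ u ∧ ∫ x, u x ∂(wMeasure Ω φ) = 0 ∧ wNorm Ω φ u ≠ 0

/-- The relaxed constant `σ̄₁(Ω, φ)`. -/
def sigmaBar {N : ℕ} (Ω : Set (Eucl N)) (φ : Eucl N → ℝ) : ℝ≥0∞ :=
  ⨅ (u : Eucl N → ℝ) (_ : BVAdmissible Ω φ u), variation Ω φ u / wNorm Ω φ u

/-- `u` is optimal for `σ̄₁(Ω, φ)`. -/
def BVOptimal {N : ℕ} (Ω : Set (Eucl N)) (φ : Eucl N → ℝ) (u : Eucl N → ℝ) : Prop :=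
  BVAdmissible Ω φ u ∧ variation Ω φ u / wNorm Ω φ u = sigmaBar Ω φ

/-! ### The shortest fence problem -/

/-- Competitors for the fence problem: Lebesgue measurable `E ⊆ Ω` such that both `E` and its
complement in `Ω` have positive measure. -/
def FenceAdmissible {N : ℕ} (Ω : Set (Eucl N)) (φ : Eucl N → ℝ) (E : Set (Eucl N)) : Prop :=
  E ⊆ Ω ∧ NullMeasurableSet E volume ∧ wMeasure Ω φ E ≠ 0 ∧ wMeasure Ω φ (Ω \ E) ≠ 0

/-- The ratio `|Ω|_φ Per_φ(E, Ω) / (2 |E|_φ |Ω ∖ E|_φ)`. -/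
def fenceRatio {N : ℕ} (Ω : Set (Eucl N)) (φ : Eucl N → ℝ) (E : Set (Eucl N)) : ℝ≥0∞ :=
  wMeasure Ω φ Ω * perimeter Ω φ E / (2 * wMeasure Ω φ E * wMeasure Ω φ (Ω \ E))

/-- The shortest fence constant `σ₁*(Ω, φ)`. -/
def sigmaStar {N : ℕ} (Ω : Set (Eucl N)) (φ : Eucl N → ℝ) : ℝ≥0∞ :=
  ⨅ (E : Set (Eucl N)) (_ : FenceAdmissible Ω φ E), fenceRatio Ω φ E

/-- `E` is optimal for `σ₁*(Ω, φ)`. -/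
def FenceOptimal {N : ℕ} (Ω : Set (Eucl N)) (φ : Eucl N → ℝ) (E : Set (Eucl N)) : Prop :=
  FenceAdmissible Ω φ E ∧ fenceRatio Ω φ E = sigmaStar Ω φ

/-! ### The two-set problem -/

/-- Competitors for the two-set problem: disjoint Lebesgue measurable `A, B ⊆ Ω` and `a, b > 0`
with `a |A|_φ = b |B|_φ`, this common value being nonzero. -/
def PairAdmissible {N : ℕ} (Ω : Set (Eucl N)) (φ : Eucl N → ℝ) (A B : Set (Eucl N))
    (a b : ℝ≥0) : Prop :=
  A ⊆ Ω ∧ B ⊆ Ω ∧ NullMeasurableSet A volume ∧ NullMeasurableSet B volume ∧ A ∩ B = ∅ ∧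
    0 < a ∧ 0 < b ∧ (a : ℝ≥0∞) * wMeasure Ω φ A = b * wMeasure Ω φ B ∧ wMeasure Ω φ A ≠ 0

/-- The ratio `(a Per_φ(A, Ω) + b Per_φ(B, Ω)) / (a |A|_φ + b |B|_φ)`. -/
def pairRatio {N : ℕ} (Ω : Set (Eucl N)) (φ : Eucl N → ℝ) (A B : Set (Eucl N))
    (a b : ℝ≥0) : ℝ≥0∞ :=
  (a * perimeter Ω φ A + b * perimeter Ω φ B) / (a * wMeasure Ω φ A + b * wMeasure Ω φ B)

/-- The two-set constant `σ̃₁(Ω, φ)`. -/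
def sigmaTilde {N : ℕ} (Ω : Set (Eucl N)) (φ : Eucl N → ℝ) : ℝ≥0∞ :=
  ⨅ (A : Set (Eucl N)) (B : Set (Eucl N)) (a : ℝ≥0) (b : ℝ≥0)
    (_ : PairAdmissible Ω φ A B a b), pairRatio Ω φ A B a b

/-- `(A, B, a, b)` is optimal for `σ̃₁(Ω, φ)`. -/
def PairOptimal {N : ℕ} (Ω : Set (Eucl N)) (φ : Eucl N → ℝ) (A B : Set (Eucl N))
    (a b : ℝ≥0) : Prop :=
  PairAdmissible Ω φ A B a b ∧ pairRatio Ω φ A B a b = sigmaTilde Ω φ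

end WeightedFence

end

open WeightedFence

noncomputable section

namespace WeightedFence

open Filter Topology

/-! Three of the constants are compared by a cycle. The function `a χ_A - b χ_B` competes in the
relaxed problem, so `sigmaBar ≤ sigmaTilde`. A fence `E` and its complement, each weighted by the
measure of the other, form an admissible pair, so `sigmaTilde ≤ sigmaStar`. The cycle closes with
`sigmaStar ≤ sigmaBar`. The coarea inequality `coarea_le` bounds the variation of `u` below by the
integral of the perimeters of its superlevel sets. The definition of `sigmaStar` bounds each
perimeter below by a multiple of `|{u > t}| |{u ≤ t}|`. For `u` of zero mean, the integral of twice
these products is at least `|Ω|_φ` times the norm of `u` (`measure_mul_lintegral_le_levelSets`). If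
`u` is optimal, all these inequalities are equalities, hence pointwise ones for almost every `t`:
almost every nontrivial level set is an optimal fence.

The equality `sigmaOne = sigmaBar` compares gradients with variation in both directions. The
variation is a supremum over fields tested against functions of the whole space, so Hahn–Banach
shows that test functions with gradient norm at most `c` approximate in `L¹` every function of
variation at most `c` (`exists_testFunction_approx`). Conversely, the variation of a Sobolev
function is at most the norm of its gradient (`variation_le_of_memSobolev`), by smoothing and lower
semicontinuity.

Concavity of `φ ^ (1/m)` enters through `pow_mul_le`: moving towards a point of `Ω` lowers the
weight by at most the factor `(1 - s) ^ m`. Averaging the contractions of `Ω` towards its own points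
is therefore a smoothing that never leaves `Ω` and is bounded on the weighted `L¹` space with norm
tending to 1. It yields the Sobolev comparison and, with Arzelà–Ascoli, the `L¹` compactness
`exists_subseq_tendsto`, from which the direct method gives a minimizer for `sigmaBar`. Its level
sets supply minimizers for the other two geometric problems. -/

/-- A positive `(1/m)`-concave weight on a nonempty bounded open convex set. -/
structure ConcaveWeight {N : ℕ} (m : ℕ) (Ω : Set (Eucl N)) (φ : Eucl N → ℝ) : Prop where
  one_le : 1 ≤ m
  isOpen : IsOpen Ω
  isBounded : Bornology.IsBounded Ω
  nonempty : Ω.Nonempty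
  pos : ∀ x ∈ Ω, 0 < φ x
  rootConcave : IsRootConcaveOn m Ω φ

/-- The density of `wMeasure Ω φ` with respect to Lebesgue measure on the whole space. -/
def wDensity {N : ℕ} (Ω : Set (Eucl N)) (φ : Eucl N → ℝ) : Eucl N → ℝ≥0∞ :=
  Ω.indicator (fun x => ENNReal.ofReal (φ x))

variable {N m : ℕ} {Ω : Set (Eucl N)} {φ : Eucl N → ℝ}

/-! ### Concave weights: bounds, null sets and dilations. -/

namespace ConcaveWeight

lemma convex (h : ConcaveWeight m Ω φ) : Convex ℝ Ω := h.rootConcave.1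

lemma root_pow (h : ConcaveWeight m Ω φ) {x : Eucl N} (hx : x ∈ Ω) :
    (φ x ^ (1 / (m : ℝ))) ^ m = φ x := by
  have hm : m ≠ 0 := by have := h.one_le; omega
  rw [one_div]
  exact Real.rpow_inv_natCast_pow (h.pos x hx).le hm

lemma root_pos (h : ConcaveWeight m Ω φ) {x : Eucl N} (hx : x ∈ Ω) :
    0 < φ x ^ (1 / (m : ℝ)) := Real.rpow_pos_of_pos (h.pos x hx) _

lemma continuousOn (h : ConcaveWeight m Ω φ) : ContinuousOn φ Ω := by
  have h1 : ContinuousOn (fun x => φ x ^ (1 / (m : ℝ))) Ω :=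
    ConcaveOn.continuousOn h.isOpen h.rootConcave
  exact (h1.pow m).congr fun x hx => (h.root_pow hx).symm

lemma combo_mem (h : ConcaveWeight m Ω φ) {x z : Eucl N} (hx : x ∈ Ω) (hz : z ∈ Ω) {s : ℝ}
    (hs0 : 0 ≤ s) (hs1 : s ≤ 1) : (1 - s) • x + s • z ∈ Ω :=
  h.convex hx hz (by linarith) hs0 (by ring)

/-- Concavity of the root gives two nonnegative terms; dropping the one at `z` leaves a bound
uniform in `z`. -/
lemma pow_mul_le (h : ConcaveWeight m Ω φ) {x z : Eucl N} (hx : x ∈ Ω) (hz : z ∈ Ω) {s : ℝ}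
    (hs0 : 0 ≤ s) (hs1 : s ≤ 1) : (1 - s) ^ m * φ x ≤ φ ((1 - s) • x + s • z) := by
  rw [← h.root_pow hx, ← h.root_pow (h.combo_mem hx hz hs0 hs1), ← mul_pow]
  have h1 : 0 ≤ 1 - s := by linarith
  have h2 := h.rootConcave.2 hx hz h1 hs0 (by ring)
  simp only [smul_eq_mul] at h2
  have h3 := h.root_pos hz
  have h4 := h.root_pos hx
  refine pow_le_pow_left₀ (by positivity) ?_ m
  nlinarith [mul_nonneg hs0 h3.le]

/-- A large value at `x` would force a large value at a fixed centre `x₀ = s x + (1 - s) y`, with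
`s` independent of `x`: `pow_mul_le` gives `s ^ m φ(x) ≤ φ(x₀)`. -/
lemma exists_bound (h : ConcaveWeight m Ω φ) : ∃ M : ℝ, ∀ x ∈ Ω, φ x ≤ M := by
  obtain ⟨x₀, hx₀⟩ := h.nonempty
  obtain ⟨r, hr, hball⟩ := Metric.isOpen_iff.1 h.isOpen x₀ hx₀
  obtain ⟨R, hR⟩ := h.isBounded.subset_closedBall x₀
  have hR0 : 0 ≤ R := by simpa using Metric.mem_closedBall.1 (hR hx₀)
  -- `x₀` is a convex combination, with a fixed weight, of `x` and of a point of the ball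
  set s : ℝ := r / (R + r) / 2 with hs
  have hRr : 0 < R + r := by linarith
  have hs0 : 0 < s := by positivity
  have hs1 : s ≤ 1 / 2 := by
    rw [hs]; have : r / (R + r) ≤ 1 := by rw [div_le_one hRr]; linarith
    linarith
  refine ⟨φ x₀ / s ^ m, fun x hx => ?_⟩
  set y : Eucl N := (1 - s)⁻¹ • (x₀ - s • x) with hy
  have h1s : (1 - s) ≠ 0 := by linarith
  have hyx : y - x₀ = (s / (1 - s)) • (x₀ - x) := by
    rw [hy, div_eq_inv_mul, mul_smul, ← sub_eq_zero]
    have : x₀ = (1 - s)⁻¹ • ((1 - s) • x₀) := by rw [smul_smul, inv_mul_cancel₀ h1s, one_smul]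
    nth_rewrite 2 [this]
    rw [← smul_sub, ← smul_sub]
    convert smul_zero _ using 2
    module
  have hyΩ : y ∈ Ω := by
    apply hball
    rw [Metric.mem_ball, dist_eq_norm, hyx, norm_smul, Real.norm_eq_abs,
      abs_of_nonneg (div_nonneg hs0.le (by linarith))]
    have h2 : ‖x₀ - x‖ ≤ R := by
      rw [← dist_eq_norm, dist_comm]; exact hR hx
    have h3 : s / (1 - s) ≤ r / (R + r) := by
      rw [div_le_iff₀ (by linarith)]
      have : s * 2 = r / (R + r) := by rw [hs]; ring
      rw [← this]; nlinarith
    calc s / (1 - s) * ‖x₀ - x‖ ≤ r / (R + r) * R := by gcongr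
      _ < r := by
        rw [div_mul_eq_mul_div, div_lt_iff₀ hRr]; nlinarith
  have h4 := h.pow_mul_le hx hyΩ (s := 1 - s) (by linarith) (by linarith)
  have h5 : (1 - (1 - s)) • x + (1 - s) • y = x₀ := by
    rw [hy, smul_smul, mul_inv_cancel₀ h1s]; module
  rw [h5, sub_sub_cancel] at h4
  rw [le_div_iff₀ (by positivity), mul_comm]
  exact h4

lemma measurable_wDensity (h : ConcaveWeight m Ω φ) : Measurable (wDensity Ω φ) := by
  have h1 : ContinuousOn (fun x => ENNReal.ofReal (φ x)) Ω :=
    ENNReal.continuous_ofReal.comp_continuousOn h.continuousOn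
  classical
  rw [wDensity, ← piecewise_eq_indicator]
  exact h1.measurable_piecewise continuousOn_const h.isOpen.measurableSet

lemma wMeasure_eq (h : ConcaveWeight m Ω φ) :
    wMeasure Ω φ = volume.withDensity (wDensity Ω φ) := by
  rw [wMeasure, wDensity, withDensity_indicator h.isOpen.measurableSet]

lemma lintegral_eq (h : ConcaveWeight m Ω φ) {f : Eucl N → ℝ≥0∞} (hf : Measurable f) :
    ∫⁻ x, f x ∂wMeasure Ω φ = ∫⁻ x, wDensity Ω φ x * f x := by
  rw [h.wMeasure_eq, lintegral_withDensity_eq_lintegral_mul _ h.measurable_wDensity hf]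
  rfl

lemma isFiniteMeasure (h : ConcaveWeight m Ω φ) : IsFiniteMeasure (wMeasure Ω φ) := by
  obtain ⟨M, hM⟩ := h.exists_bound
  refine ⟨?_⟩
  rw [wMeasure, withDensity_apply _ MeasurableSet.univ, Measure.restrict_univ]
  calc ∫⁻ x in Ω, ENNReal.ofReal (φ x) ≤ ∫⁻ x in Ω, ENNReal.ofReal M :=
        setLIntegral_mono measurable_const fun x hx => ENNReal.ofReal_le_ofReal (hM x hx)
    _ < ⊤ := by
        rw [setLIntegral_const]
        exact ENNReal.mul_lt_top ENNReal.ofReal_lt_top h.isBounded.measure_lt_top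

/-- Positivity of the weight makes the weighted and the Lebesgue null sets of `Ω` the same. -/
lemma restrict_absolutelyContinuous (h : ConcaveWeight m Ω φ) :
    volume.restrict Ω ≪ wMeasure Ω φ := by
  refine withDensity_absolutelyContinuous' ?_ ?_
  · exact (h.continuousOn.aemeasurable h.isOpen.measurableSet).ennreal_ofReal
  · refine (ae_restrict_mem h.isOpen.measurableSet).mono fun x hx => ?_
    simpa using h.pos x hx

lemma ae_wMeasure_iff (h : ConcaveWeight m Ω φ) {p : Eucl N → Prop} :
    (∀ᵐ x ∂wMeasure Ω φ, p x) ↔ ∀ᵐ x ∂volume.restrict Ω, p x :=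
  ⟨fun hp => h.restrict_absolutelyContinuous.ae_le hp,
    fun hp => (withDensity_absolutelyContinuous _ _).ae_le hp⟩

lemma ae_mem (h : ConcaveWeight m Ω φ) : ∀ᵐ x ∂wMeasure Ω φ, x ∈ Ω :=
  h.ae_wMeasure_iff.2 (ae_restrict_mem h.isOpen.measurableSet)

lemma measure_univ_eq (h : ConcaveWeight m Ω φ) : wMeasure Ω φ univ = wMeasure Ω φ Ω :=
  (measure_congr (eventuallyEq_univ.2 h.ae_mem)).symm

lemma measure_pos (h : ConcaveWeight m Ω φ) {U : Set (Eucl N)} (hU : IsOpen U)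
    (hne : U.Nonempty) (hUΩ : U ⊆ Ω) : wMeasure Ω φ U ≠ 0 := by
  intro h0
  have h1 := h.restrict_absolutelyContinuous h0
  rw [Measure.restrict_apply hU.measurableSet, inter_eq_self_of_subset_left hUΩ] at h1
  exact (hU.measure_pos volume hne).ne' h1

/-- The continuous weight has a positive minimum on a compact subset, although it may vanish at the
boundary of `Ω`. Weighted integrability thus gives Lebesgue integrability away from the boundary. -/
lemma restrict_le_smul (h : ConcaveWeight m Ω φ) {K : Set (Eucl N)} (hK : IsCompact K)
    (hKΩ : K ⊆ Ω) : ∃ c : ℝ≥0, volume.restrict K ≤ (c : ℝ≥0∞) • wMeasure Ω φ := by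
  rcases K.eq_empty_or_nonempty with rfl | hne
  · exact ⟨0, by simp⟩
  obtain ⟨x₀, hx₀, hmin⟩ := hK.exists_isMinOn hne (h.continuousOn.mono hKΩ)
  have hpos := h.pos x₀ (hKΩ hx₀)
  refine ⟨(Real.toNNReal (φ x₀))⁻¹, ?_⟩
  have hcoe : (((Real.toNNReal (φ x₀))⁻¹ : ℝ≥0) : ℝ≥0∞) = (ENNReal.ofReal (φ x₀))⁻¹ := by
    rw [ENNReal.coe_inv (by simpa using hpos)]; rfl
  rw [hcoe]
  refine Measure.le_iff.2 fun S hS => ?_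
  have h0 : ENNReal.ofReal (φ x₀) ≠ 0 := by simpa using hpos
  rw [Measure.restrict_apply hS, Measure.smul_apply, smul_eq_mul, mul_comm, ← div_eq_mul_inv,
    ENNReal.le_div_iff_mul_le (Or.inl h0) (Or.inl ENNReal.ofReal_ne_top), mul_comm]
  rw [h.wMeasure_eq, withDensity_apply _ hS, ← setLIntegral_const]
  calc ∫⁻ _ in S ∩ K, ENNReal.ofReal (φ x₀) ≤ ∫⁻ x in S ∩ K, wDensity Ω φ x := by
        refine setLIntegral_mono h.measurable_wDensity fun x hx => ?_
        rw [wDensity, indicator_of_mem (hKΩ hx.2)]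
        exact ENNReal.ofReal_le_ofReal (hmin hx.2)
    _ ≤ ∫⁻ x in S, wDensity Ω φ x := lintegral_mono_set inter_subset_left

/-- The factor by which dilations towards a point of `Ω` distort the weighted measure. -/
def dilationFactor (m N : ℕ) (s : ℝ) : ℝ≥0∞ := ENNReal.ofReal (((1 - s) ^ (m + N))⁻¹)

/-- The factor has two sources: `(1 - s) ^ m` from the weight at the contracted point, and `(1 - s)
^ N` from the Jacobian of the contraction. -/
lemma lintegral_dilation_le (h : ConcaveWeight m Ω φ) {z : Eucl N} (hz : z ∈ Ω) {s : ℝ}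
    (hs0 : 0 ≤ s) (hs1 : s < 1) {f : Eucl N → ℝ≥0∞} (hf : Measurable f) :
    ∫⁻ x, f ((1 - s) • x + s • z) ∂wMeasure Ω φ ≤
      dilationFactor m N s * ∫⁻ x, f x ∂wMeasure Ω φ := by
  have h1s : 0 < 1 - s := by linarith
  have hA : Measurable fun x : Eucl N => (1 - s) • x + s • z := by fun_prop
  set H : Eucl N → ℝ≥0∞ := fun x => wDensity Ω φ x * f x with hH
  have hHm : Measurable H := h.measurable_wDensity.mul hf
  rw [h.lintegral_eq (f := fun x => f ((1 - s) • x + s • z)) (hf.comp hA), h.lintegral_eq hf]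
  have hpt : ∀ x, wDensity Ω φ x * f ((1 - s) • x + s • z) ≤
      ENNReal.ofReal (((1 - s) ^ m)⁻¹) * H ((1 - s) • x + s • z) := by
    intro x
    by_cases hx : x ∈ Ω
    · rw [hH]
      simp only
      rw [← mul_assoc]
      gcongr
      rw [wDensity, indicator_of_mem hx, indicator_of_mem (h.combo_mem hx hz hs0 hs1.le),
        ← ENNReal.ofReal_mul (by positivity)]
      refine ENNReal.ofReal_le_ofReal ?_
      rw [inv_mul_eq_div, le_div_iff₀ (by positivity), mul_comm]
      exact h.pow_mul_le hx hz hs0 hs1.le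
    · simp [wDensity, hx]
  have hcv : ∫⁻ x, H ((1 - s) • x + s • z) = ENNReal.ofReal (((1 - s) ^ N)⁻¹) * ∫⁻ x, H x := by
    have e1 : ∫⁻ x, H ((1 - s) • x + s • z) =
        ∫⁻ y, H (y + s • z) ∂(Measure.map (fun x : Eucl N => (1 - s) • x) volume) := by
      rw [lintegral_map (by fun_prop) (by fun_prop)]
    rw [e1, Measure.map_addHaar_smul _ h1s.ne', lintegral_smul_measure,
      lintegral_add_right_eq_self H]
    simp [abs_of_pos h1s]
  calc ∫⁻ x, wDensity Ω φ x * f ((1 - s) • x + s • z)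
      ≤ ∫⁻ x, ENNReal.ofReal (((1 - s) ^ m)⁻¹) * H ((1 - s) • x + s • z) := lintegral_mono hpt
    _ = dilationFactor m N s * ∫⁻ x, H x := by
      rw [lintegral_const_mul _ (by fun_prop), hcv, ← mul_assoc,
        ← ENNReal.ofReal_mul (by positivity), dilationFactor, pow_add, mul_inv]

end ConcaveWeight

/-! ### Elementary properties of the weighted variation -/

lemma variation_le_iff {u : Eucl N → ℝ} {c : ℝ≥0∞} :
    variation Ω φ u ≤ c ↔ ∀ σ g, MemX Ω φ σ g → (∀ᵐ x ∂(volume.restrict Ω), ‖σ x‖ ≤ 1) →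
      ENNReal.ofReal (- ∫ x, u x * g x ∂(wMeasure Ω φ)) ≤ c := by
  simp [variation, iSup_le_iff]

lemma le_variation {σ : Eucl N → Eucl N} {g : Eucl N → ℝ} (hσ : MemX Ω φ σ g)
    (hσ1 : ∀ᵐ x ∂(volume.restrict Ω), ‖σ x‖ ≤ 1) (u : Eucl N → ℝ) :
    ENNReal.ofReal (- ∫ x, u x * g x ∂(wMeasure Ω φ)) ≤ variation Ω φ u :=
  variation_le_iff.1 le_rfl σ g hσ hσ1

lemma MemX.neg {σ : Eucl N → Eucl N} {g : Eucl N → ℝ} (hσ : MemX Ω φ σ g) :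
    MemX Ω φ (fun x => -σ x) (fun x => -g x) where
  memLp := hσ.memLp.neg
  memLp_div := hσ.memLp_div.neg
  div_eq ψ h1 h2 := by
    have := hσ.div_eq ψ h1 h2
    simp only [map_neg, neg_mul, integral_neg]
    rw [this]

lemma MemX.integrable_mul {σ : Eucl N → Eucl N} {g : Eucl N → ℝ} (hσ : MemX Ω φ σ g)
    {u : Eucl N → ℝ} (hu : Integrable u (wMeasure Ω φ)) :
    Integrable (fun x => u x * g x) (wMeasure Ω φ) :=
  hu.mul_of_top_left hσ.memLp_div

lemma variation_congr {u v : Eucl N → ℝ} (h : u =ᵐ[wMeasure Ω φ] v) :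
    variation Ω φ u = variation Ω φ v := by
  have : ∀ g : Eucl N → ℝ, ∫ x, u x * g x ∂(wMeasure Ω φ) = ∫ x, v x * g x ∂(wMeasure Ω φ) :=
    fun g => integral_congr_ae (h.mono fun x hx => by simp only [hx])
  simp only [variation, this]

lemma variation_neg_le (u : Eucl N → ℝ) :
    variation Ω φ (fun x => -u x) ≤ variation Ω φ u := by
  refine variation_le_iff.2 fun σ g hσ hσ1 => ?_
  refine le_trans (le_of_eq ?_) (le_variation hσ.neg (by simpa using hσ1) u)
  simp

lemma variation_add_le {u v : Eucl N → ℝ} (hu : Integrable u (wMeasure Ω φ))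
    (hv : Integrable v (wMeasure Ω φ)) :
    variation Ω φ (fun x => u x + v x) ≤ variation Ω φ u + variation Ω φ v := by
  refine variation_le_iff.2 fun σ g hσ hσ1 => ?_
  simp only [add_mul]
  rw [integral_add (hσ.integrable_mul hu) (hσ.integrable_mul hv), neg_add]
  exact ENNReal.ofReal_add_le.trans (add_le_add (le_variation hσ hσ1 u) (le_variation hσ hσ1 v))

lemma variation_const_mul_le (c : ℝ≥0) (u : Eucl N → ℝ) :
    variation Ω φ (fun x => c * u x) ≤ c * variation Ω φ u := by
  refine variation_le_iff.2 fun σ g hσ hσ1 => ?_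
  simp only [mul_assoc, integral_const_mul]
  rw [← mul_neg, ENNReal.ofReal_mul (NNReal.coe_nonneg c)]
  gcongr
  · simp
  · exact le_variation hσ hσ1 u

/-- The variation is a supremum of functionals `u ↦ -∫ u g` with `g` bounded, each continuous in
`L¹`. -/
lemma variation_le_liminf {u : Eucl N → ℝ} {v : ℕ → Eucl N → ℝ}
    (hu : Integrable u (wMeasure Ω φ)) (hv : ∀ k, Integrable (v k) (wMeasure Ω φ))
    (hlim : Tendsto (fun k => ∫⁻ x, ‖v k x - u x‖ₑ ∂(wMeasure Ω φ)) atTop (𝓝 0)) :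
    variation Ω φ u ≤ liminf (fun k => variation Ω φ (v k)) atTop := by
  refine variation_le_iff.2 fun σ g hσ hσ1 => ?_
  have hC : eLpNormEssSup g (wMeasure Ω φ) ≠ ⊤ := by
    have := hσ.memLp_div.2
    rw [eLpNorm_exponent_top] at this
    exact this.ne
  have h1 : Tendsto (fun k => ∫ x, v k x * g x ∂(wMeasure Ω φ)) atTop
      (𝓝 (∫ x, u x * g x ∂(wMeasure Ω φ))) := by
    refine tendsto_integral_of_L1 _ (hσ.integrable_mul hu).1
      (Eventually.of_forall fun k => hσ.integrable_mul (hv k)) ?_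
    have h2 : Tendsto (fun k => (∫⁻ x, ‖v k x - u x‖ₑ ∂(wMeasure Ω φ)) *
        eLpNormEssSup g (wMeasure Ω φ)) atTop (𝓝 0) := by
      simpa using ENNReal.Tendsto.mul_const hlim (Or.inr hC)
    refine tendsto_of_tendsto_of_tendsto_of_le_of_le tendsto_const_nhds h2 (fun _ => zero_le)
      fun k => ?_
    have hm : AEMeasurable (fun x => ‖v k x - u x‖ₑ) (wMeasure Ω φ) := ((hv k).sub hu).1.enorm
    rw [← lintegral_mul_const'' _ hm]
    refine lintegral_mono_ae ((ae_le_eLpNormEssSup (f := g)).mono fun x hx => ?_)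
    rw [← sub_mul, enorm_mul]
    gcongr
  have h3 := (ENNReal.continuous_ofReal.tendsto _).comp h1.neg
  rw [← h3.liminf_eq]
  exact liminf_le_liminf (Eventually.of_forall fun k => le_variation hσ hσ1 (v k))

/-! ### The divergence equation for smooth functions. -/

namespace ConcaveWeight

lemma integrable_of_continuous (h : ConcaveWeight m Ω φ) {F : Type*} [NormedAddCommGroup F]
    [SecondCountableTopologyEither (Eucl N) F] {f : Eucl N → F} (hf : Continuous f) :
    Integrable f (wMeasure Ω φ) := by
  have := h.isFiniteMeasure
  obtain ⟨C, hC⟩ := h.isBounded.isCompact_closure.exists_bound_of_continuousOn hf.continuousOn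
  exact Integrable.of_bound hf.aestronglyMeasurable C
    (h.ae_mem.mono fun x hx => hC x (subset_closure hx))

/-- The divergence equation extends to test functions without compact support. -/
lemma div_eq_of_contDiff (h : ConcaveWeight m Ω φ) {σ : Eucl N → Eucl N} {g : Eucl N → ℝ}
    (hσ : MemX Ω φ σ g) {ψ : Eucl N → ℝ} (hψ : ContDiff ℝ ∞ ψ) :
    - ∫ x, fderiv ℝ ψ x (σ x) ∂(wMeasure Ω φ) = ∫ x, ψ x * g x ∂(wMeasure Ω φ) := by
  obtain ⟨R, hR0, hR⟩ := h.isBounded.subset_ball_lt 0 (0 : Eucl N)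
  let b : ContDiffBump (0 : Eucl N) := ⟨R, R + 1, hR0, by linarith⟩
  have hb : ContDiff ℝ ∞ (b : Eucl N → ℝ) := b.contDiff
  have h1 := hσ.div_eq (fun x => ψ x * b x) (hψ.mul hb) b.hasCompactSupport.mul_left
  have heq : ∀ x ∈ Ω, (fun x => ψ x * b x) =ᶠ[𝓝 x] ψ := by
    intro x hx
    filter_upwards [Metric.isOpen_ball.mem_nhds (hR hx)] with y hy
    rw [b.one_of_mem_closedBall (Metric.ball_subset_closedBall hy), mul_one]
  have e1 : ∫ x, fderiv ℝ (fun x => ψ x * b x) x (σ x) ∂(wMeasure Ω φ) =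
      ∫ x, fderiv ℝ ψ x (σ x) ∂(wMeasure Ω φ) :=
    integral_congr_ae (h.ae_mem.mono fun x hx => by
      simp only [(heq x hx).fderiv_eq])
  have e2 : ∫ x, g x * (ψ x * b x) ∂(wMeasure Ω φ) = ∫ x, ψ x * g x ∂(wMeasure Ω φ) :=
    integral_congr_ae (h.ae_mem.mono fun x hx => by
      have := (heq x hx).eq_of_nhds
      simp only at this ⊢
      rw [this, mul_comm])
  rw [← e1, ← e2]
  exact h1

/-- Since the equation holds on all of `ℝ^N`, the fields have no flux through the boundary: test
with `ψ = 1`. -/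
lemma integral_div_eq_zero (h : ConcaveWeight m Ω φ) {σ : Eucl N → Eucl N} {g : Eucl N → ℝ}
    (hσ : MemX Ω φ σ g) : ∫ x, g x ∂(wMeasure Ω φ) = 0 := by
  have := h.div_eq_of_contDiff hσ (ψ := fun _ => (1 : ℝ)) contDiff_const
  simpa using this.symm

lemma variation_add_const (h : ConcaveWeight m Ω φ) {u : Eucl N → ℝ}
    (hu : Integrable u (wMeasure Ω φ)) (c : ℝ) :
    variation Ω φ (fun x => u x + c) = variation Ω φ u := by
  have := h.isFiniteMeasure
  unfold variation
  congr! 5 with σ g hσ hσ1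
  simp only [add_mul]
  rw [integral_add (hσ.integrable_mul hu) (hσ.integrable_mul (integrable_const c)),
    integral_const_mul, h.integral_div_eq_zero hσ]
  simp

lemma variation_le_of_contDiff (h : ConcaveWeight m Ω φ) {ψ : Eucl N → ℝ}
    (hψ : ContDiff ℝ ∞ ψ) : variation Ω φ ψ ≤ wNorm Ω φ (fderiv ℝ ψ) := by
  refine variation_le_iff.2 fun σ g hσ hσ1 => ?_
  rw [← h.div_eq_of_contDiff hσ hψ, neg_neg]
  refine (Real.ofReal_le_enorm _).trans ((enorm_integral_le_lintegral_enorm _).trans ?_)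
  refine lintegral_mono_ae ((h.ae_wMeasure_iff.2 hσ1).mono fun x hx => ?_)
  have : ‖fderiv ℝ ψ x (σ x)‖ ≤ ‖fderiv ℝ ψ x‖ :=
    ((fderiv ℝ ψ x).le_opNorm _).trans (mul_le_of_le_one_right (norm_nonneg _) hx)
  exact enorm_le_iff_norm_le.2 this

lemma wNorm_fderiv_lt_top (h : ConcaveWeight m Ω φ) {ψ : Eucl N → ℝ}
    (hψ : ContDiff ℝ ∞ ψ) : wNorm Ω φ (fderiv ℝ ψ) < ⊤ :=
  (h.integrable_of_continuous (hψ.continuous_fderiv (by simp))).2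

/-- Almost everywhere `χ_{Ω ∖ E} = 1 - χ_E`, and variation ignores constants and signs. -/
lemma perimeter_diff_le (h : ConcaveWeight m Ω φ) {E : Set (Eucl N)}
    (hE : NullMeasurableSet E (wMeasure Ω φ)) :
    perimeter Ω φ (Ω \ E) ≤ perimeter Ω φ E := by
  have := h.isFiniteMeasure
  have hi : Integrable (E.indicator fun _ => (1 : ℝ)) (wMeasure Ω φ) :=
    (integrable_const (1 : ℝ)).indicator₀ hE
  have h1 : (Ω \ E).indicator (fun _ => (1 : ℝ)) =ᵐ[wMeasure Ω φ]
      fun x => -(E.indicator (fun _ => (1 : ℝ)) x) + 1 := by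
    filter_upwards [h.ae_mem] with x hx
    by_cases hxE : x ∈ E <;> simp [hx, hxE]
  rw [perimeter, variation_congr h1,
    h.variation_add_const (u := fun x => -(E.indicator (fun _ => (1 : ℝ)) x)) hi.neg]
  exact variation_neg_le _

end ConcaveWeight

/-! ### The dual of `L¹` of a finite measure -/

section Dual

variable {α E : Type*} [MeasurableSpace α] {μ : Measure α} [IsFiniteMeasure μ]
  [NormedAddCommGroup E] [InnerProductSpace ℝ E] [CompleteSpace E]

lemma integrable_of_Lp_two {E : Type*} [NormedAddCommGroup E] (f : Lp E 2 μ) : Integrable f μ :=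
  memLp_one_iff_integrable.1 ((Lp.memLp f).mono_exponent one_le_two)

/-- The inclusion of `L²` into `L¹` for a finite measure. -/
def lpTwoToLpOne (μ : Measure α) [IsFiniteMeasure μ] (E : Type*) [NormedAddCommGroup E]
    [InnerProductSpace ℝ E] [CompleteSpace E] : Lp E 2 μ →L[ℝ] Lp E 1 μ :=
  LinearMap.mkContinuous
    { toFun := fun f => (integrable_of_Lp_two f).toL1 f
      map_add' := fun f g => by
        rw [← Integrable.toL1_add]
        exact (Integrable.toL1_eq_toL1_iff _ _ _ _).2 (Lp.coeFn_add f g)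
      map_smul' := fun c f => by
        rw [RingHom.id_apply, ← Integrable.toL1_smul]
        exact (Integrable.toL1_eq_toL1_iff _ _ _ _).2 (Lp.coeFn_smul c f) }
    ((μ univ ^ (1 / (1 : ℝ≥0∞).toReal - 1 / (2 : ℝ≥0∞).toReal)).toReal) fun f => by
      have h1 := eLpNorm_le_eLpNorm_mul_rpow_measure_univ (p := 1) (q := 2) (μ := μ)
        one_le_two (Lp.memLp f).1
      simp only [LinearMap.coe_mk, AddHom.coe_mk]
      rw [Integrable.norm_toL1_eq_lintegral_enorm, ← eLpNorm_one_eq_lintegral_enorm, mul_comm,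
        Lp.norm_def, ← ENNReal.toReal_mul]
      refine ENNReal.toReal_mono (ENNReal.mul_ne_top (Lp.memLp f).2.ne ?_) h1
      exact ENNReal.rpow_ne_top_of_nonneg (by norm_num) (measure_ne_top μ univ)

lemma lpTwoToLpOne_toLp {f : α → E} (hf : MemLp f 2 μ) (hf1 : Integrable f μ) :
    lpTwoToLpOne μ E (hf.toLp f) = hf1.toL1 f :=
  (Integrable.toL1_eq_toL1_iff _ _ (integrable_of_Lp_two _) _).2 hf.coeFn_toLp

/-- Every continuous functional on `L¹` of a finite measure is given by an essentially bounded
function. -/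
theorem exists_bounded_representative (L : StrongDual ℝ (Lp E 1 μ)) {C : ℝ} (hC : 0 ≤ C)
    (hL : ∀ f, |L f| ≤ C * ‖f‖) :
    ∃ σ : α → E, AEStronglyMeasurable σ μ ∧ (∀ᵐ x ∂μ, ‖σ x‖ ≤ C) ∧
      ∀ (f : α → E) (hf : Integrable f μ), L (hf.toL1 f) = ∫ x, inner ℝ (σ x) (f x) ∂μ := by
  -- Riesz representation in `L²`, which embeds in `L¹` because the measure is finite.
  set s : Lp E 2 μ := (InnerProductSpace.toDual ℝ (Lp E 2 μ)).symm (L.comp (lpTwoToLpOne μ E))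
    with hs
  have hsm : StronglyMeasurable (s : α → E) := Lp.stronglyMeasurable s
  have hsi : Integrable s μ := integrable_of_Lp_two s
  have key : ∀ (f : α → E) (hf : MemLp f 2 μ) (hf1 : Integrable f μ),
      L (hf1.toL1 f) = ∫ x, inner ℝ (s x) (f x) ∂μ := by
    intro f hf hf1
    rw [← lpTwoToLpOne_toLp hf hf1, ← ContinuousLinearMap.comp_apply,
      ← InnerProductSpace.toDual_symm_apply (𝕜 := ℝ), ← hs, L2.inner_def]
    refine integral_congr_ae (hf.coeFn_toLp.mono fun x hx => ?_)
    simp only [hx]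
  -- Test on `s` cut to the set `A` where `‖s‖ > C`: the bound on `L` gives `∫_A ‖s‖ (‖s‖ - C) ≤ 0`,
  -- whose integrand is positive on `A`, so `A` is null.
  have hbound : ∀ᵐ x ∂μ, ‖s x‖ ≤ C := by
    set A : Set α := {x | C < ‖s x‖} with hA
    have hAm : MeasurableSet A := measurableSet_lt measurable_const hsm.norm.measurable
    have hf : MemLp (A.indicator s) 2 μ := (Lp.memLp s).indicator hAm
    have hf1 : Integrable (A.indicator s) μ := hsi.indicator hAm
    have h1 := key _ hf hf1
    have h2 := (le_abs_self _).trans (hL (hf1.toL1 _))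
    rw [h1, L1.norm_of_fun_eq_integral_norm, ← integral_const_mul] at h2
    have hi1 : Integrable (fun x => inner ℝ (s x) (A.indicator s x)) μ := by
      have := L2.integrable_inner (𝕜 := ℝ) s (hf.toLp _)
      refine this.congr (hf.coeFn_toLp.mono fun x hx => ?_)
      simp only [hx]
    have hi2 : Integrable (fun x => C * ‖A.indicator s x‖) μ := hf1.norm.const_mul C
    have hpt : ∀ x, inner ℝ (s x) (A.indicator s x) - C * ‖A.indicator s x‖ =
        A.indicator (fun x => ‖s x‖ * (‖s x‖ - C)) x := by
      intro x
      by_cases hx : x ∈ A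
      · simp only [indicator_of_mem hx, real_inner_self_eq_norm_sq]; ring
      · simp [indicator_of_notMem hx]
    have hnn : ∀ x, 0 ≤ A.indicator (fun x => ‖s x‖ * (‖s x‖ - C)) x := by
      intro x
      refine indicator_nonneg (fun y hy => ?_) x
      exact mul_nonneg (norm_nonneg _) (sub_nonneg.2 (le_of_lt hy))
    have hi3 := hi1.sub hi2
    have h3 : ∫ x, A.indicator (fun x => ‖s x‖ * (‖s x‖ - C)) x ∂μ = 0 := by
      refine le_antisymm ?_ (integral_nonneg hnn)
      simp only [← hpt]
      rw [integral_sub hi1 hi2]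
      linarith
    have hi4 : Integrable (A.indicator (fun x => ‖s x‖ * (‖s x‖ - C))) μ :=
      hi3.congr (Eventually.of_forall hpt)
    have h4 := (integral_eq_zero_iff_of_nonneg hnn hi4).1 h3
    filter_upwards [h4] with x hx
    by_contra! hlt
    rw [indicator_of_mem (show x ∈ A from hlt)] at hx
    have : 0 < ‖s x‖ * (‖s x‖ - C) := mul_pos (hC.trans_lt hlt) (sub_pos.2 hlt)
    exact this.ne' hx
  have hint : ∀ f : α → E, Integrable f μ → Integrable (fun x => inner ℝ (s x) (f x)) μ := by
    intro f hf
    refine (hf.norm.const_mul C).mono' (hsm.aestronglyMeasurable.inner hf.1) ?_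
    filter_upwards [hbound] with x hx
    exact (norm_inner_le_norm _ _).trans (by gcongr)
  refine ⟨s, hsm.aestronglyMeasurable, hbound, fun f hf => ?_⟩
  -- Both `L` and `R` are continuous on `L¹` and agree on indicator functions, so
  -- `Integrable.induction` extends the equality.
  let R : Lp E 1 μ →L[ℝ] ℝ := LinearMap.mkContinuous
    { toFun := fun f => ∫ x, inner ℝ (s x) (f x) ∂μ
      map_add' := fun f g => by
        rw [← integral_add (hint _ (L1.integrable_coeFn f)) (hint _ (L1.integrable_coeFn g))]
        refine integral_congr_ae ((Lp.coeFn_add f g).mono fun x hx => ?_)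
        simp only [hx, Pi.add_apply, inner_add_right]
      map_smul' := fun c f => by
        rw [RingHom.id_apply, smul_eq_mul, ← integral_const_mul]
        refine integral_congr_ae ((Lp.coeFn_smul c f).mono fun x hx => ?_)
        simp only [hx, Pi.smul_apply, inner_smul_right] } C fun f => by
      simp only [LinearMap.coe_mk, AddHom.coe_mk]
      rw [L1.norm_eq_integral_norm, ← integral_const_mul]
      refine norm_integral_le_of_norm_le ((L1.integrable_coeFn f).norm.const_mul C) ?_
      filter_upwards [hbound] with x hx
      exact (norm_inner_le_norm _ _).trans (by gcongr)
  have hR : ∀ (f : α → E) (hf : Integrable f μ),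
      R (hf.toL1 f) = ∫ x, inner ℝ (s x) (f x) ∂μ := fun f hf =>
    integral_congr_ae (hf.coeFn_toL1.mono fun x hx => by simp only [hx])
  have hcl : IsClosed {f : Lp E 1 μ | L f = R f} := isClosed_eq L.continuous R.continuous
  rw [← hR f hf]
  refine Integrable.induction (μ := μ)
    (fun f => ∀ hf : Integrable f μ, L (hf.toL1 f) = R (hf.toL1 f)) ?_ ?_ ?_ ?_ hf hf
  · intro c S hS hS' hf
    rw [hR]
    exact key _ (memLp_indicator_const 2 hS c (Or.inr hS'.ne)) hf
  · intro f g _ hf hg h1 h2 hfg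
    rw [Integrable.toL1_add f g hf hg, map_add, map_add, h1, h2]
  · convert hcl using 3 with f
    constructor
    · intro h1
      simpa using h1 (L1.integrable_coeFn f)
    · intro h1 hf
      simpa using h1
  · intro f g hfg hf h1 hg
    rw [← (Integrable.toL1_eq_toL1_iff f g hf hg).2 hfg]
    exact h1 hf

end Dual

/-! ### Approximation by test functions, through duality. -/

/-- The space of test functions on `ℝ^N`. -/
def testFunctions (N : ℕ) : Submodule ℝ (Eucl N → ℝ) where
  carrier := {ψ | ContDiff ℝ ∞ ψ ∧ HasCompactSupport ψ}
  add_mem' h1 h2 := ⟨h1.1.add h2.1, h1.2.add h2.2⟩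
  zero_mem' := ⟨contDiff_const, HasCompactSupport.zero⟩
  smul_mem' _ _ h := ⟨contDiff_const.smul h.1, h.2.smul_left⟩

lemma norm_gradient (ψ : Eucl N → ℝ) (x : Eucl N) : ‖gradient ψ x‖ = ‖fderiv ℝ ψ x‖ := by
  simp [gradient]

lemma inner_gradient (ψ : Eucl N → ℝ) (x v : Eucl N) :
    inner ℝ (gradient ψ x) v = fderiv ℝ ψ x v := by
  simp [gradient]

lemma wNorm_gradient (ψ : Eucl N → ℝ) : wNorm Ω φ (gradient ψ) = wNorm Ω φ (fderiv ℝ ψ) :=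
  lintegral_congr fun x => by
    rw [← ofReal_norm, ← ofReal_norm, norm_gradient]

lemma continuous_gradient {ψ : Eucl N → ℝ} (hψ : ContDiff ℝ ∞ ψ) : Continuous (gradient ψ) :=
  (LinearIsometryEquiv.continuous _).comp (hψ.continuous_fderiv (by simp))

lemma wNorm_fderiv_smul {ψ : Eucl N → ℝ} (hψ : ContDiff ℝ ∞ ψ) (c : ℝ) :
    wNorm Ω φ (fderiv ℝ (c • ψ)) = ‖c‖ₑ * wNorm Ω φ (fderiv ℝ ψ) := by
  unfold wNorm
  rw [← lintegral_const_mul' _ _ enorm_ne_top]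
  refine lintegral_congr fun x => ?_
  rw [fderiv_const_smul (hψ.differentiable (by simp) x), enorm_smul]

lemma wNorm_fderiv_add_le {ψ₁ ψ₂ : Eucl N → ℝ} (h1 : ContDiff ℝ ∞ ψ₁) (h2 : ContDiff ℝ ∞ ψ₂) :
    wNorm Ω φ (fderiv ℝ (ψ₁ + ψ₂)) ≤ wNorm Ω φ (fderiv ℝ ψ₁) + wNorm Ω φ (fderiv ℝ ψ₂) := by
  unfold wNorm
  rw [← lintegral_add_left (f := fun x => ‖fderiv ℝ ψ₁ x‖ₑ)
    (h1.continuous_fderiv (by simp)).enorm.measurable]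
  refine lintegral_mono fun x => ?_
  rw [fderiv_add (h1.differentiable (by simp) x) (h2.differentiable (by simp) x)]
  exact enorm_add_le (fderiv ℝ ψ₁ x) (fderiv ℝ ψ₂ x)

namespace ConcaveWeight

/-- A functional on `L¹` controlled on test functions by the norm of the gradient is the
divergence of a bounded field. -/
lemma exists_field_of_functional (h : ConcaveWeight m Ω φ)
    (L : StrongDual ℝ (Lp ℝ 1 (wMeasure Ω φ)))
    (hL : ∀ (ψ : Eucl N → ℝ) (hψ : ContDiff ℝ ∞ ψ), HasCompactSupport ψ →
      |L ((h.integrable_of_continuous hψ.continuous).toL1 ψ)| ≤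
        (wNorm Ω φ (fderiv ℝ ψ)).toReal) :
    ∃ σ g, MemX Ω φ σ g ∧ (∀ᵐ x ∂(volume.restrict Ω), ‖σ x‖ ≤ 1) ∧
      ∀ (u : Eucl N → ℝ) (hu : Integrable u (wMeasure Ω φ)),
        L (hu.toL1 u) = - ∫ x, u x * g x ∂(wMeasure Ω φ) := by
  have := h.isFiniteMeasure
  let D := testFunctions N
  have hgi : ∀ ψ : D, Integrable (gradient (ψ : Eucl N → ℝ)) (wMeasure Ω φ) := fun ψ =>
    h.integrable_of_continuous (continuous_gradient ψ.2.1)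
  let G : D →ₗ[ℝ] Lp (Eucl N) 1 (wMeasure Ω φ) :=
    { toFun := fun ψ => (hgi ψ).toL1 _
      map_add' := fun ψ₁ ψ₂ => by
        rw [← Integrable.toL1_add, Integrable.toL1_eq_toL1_iff]
        refine Eventually.of_forall fun x => ?_
        simp only [gradient, Submodule.coe_add, Pi.add_apply]
        rw [fderiv_add (ψ₁.2.1.differentiable (by simp) x) (ψ₂.2.1.differentiable (by simp) x),
          map_add]
      map_smul' := fun c ψ => by
        rw [RingHom.id_apply, ← Integrable.toL1_smul, Integrable.toL1_eq_toL1_iff]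
        refine Eventually.of_forall fun x => ?_
        simp only [gradient, Submodule.coe_smul]
        rw [fderiv_const_smul (ψ.2.1.differentiable (by simp) x), map_smul] }
  let I : D →ₗ[ℝ] Lp ℝ 1 (wMeasure Ω φ) :=
    { toFun := fun ψ => (h.integrable_of_continuous ψ.2.1.continuous).toL1 _
      map_add' := fun ψ₁ ψ₂ => by
        rw [← Integrable.toL1_add]; rfl
      map_smul' := fun c ψ => by
        rw [RingHom.id_apply, ← Integrable.toL1_smul]; rfl }
  have hnorm : ∀ ψ : D, ‖G ψ‖ = (wNorm Ω φ (fderiv ℝ (ψ : Eucl N → ℝ))).toReal := by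
    intro ψ
    rw [← wNorm_gradient]
    exact Integrable.norm_toL1_eq_lintegral_enorm _ (hgi ψ)
  have hLG : ∀ ψ : D, |L (I ψ)| ≤ ‖G ψ‖ := fun ψ => by
    rw [hnorm]; exact hL ψ ψ.2.1 ψ.2.2
  have : Module.Free ℝ (LinearMap.range G) := Module.Free.of_divisionRing ℝ _
  have : Module.Projective ℝ (LinearMap.range G) := Module.Projective.of_free
  -- A linear choice of primitive for each gradient. By `hLG`, `L` vanishes on test functions of
  -- zero weighted gradient, so the choice is immaterial and `L` descends to a functional of norm at
  -- most 1 on gradients.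
  obtain ⟨J, hJ⟩ := LinearMap.exists_rightInverse_of_surjective G.rangeRestrict
    (LinearMap.range_rangeRestrict G)
  have hJ' : ∀ y : LinearMap.range G, G (J y) = y := fun y =>
    congrArg Subtype.val (LinearMap.congr_fun hJ y)
  let f : StrongDual ℝ (LinearMap.range G) :=
    LinearMap.mkContinuous ((L : Lp ℝ 1 (wMeasure Ω φ) →ₗ[ℝ] ℝ) ∘ₗ I ∘ₗ J) 1 fun y => by
      have := hLG (J y)
      rw [hJ'] at this
      simpa using this
  obtain ⟨Λ, hΛ, hΛn⟩ := exists_extension_norm_eq (LinearMap.range G) f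
  have hfn : ‖f‖ ≤ 1 := LinearMap.mkContinuous_norm_le _ zero_le_one _
  have hΛG : ∀ ψ : D, Λ (G ψ) = L (I ψ) := by
    intro ψ
    have h1 := hΛ ⟨G ψ, ψ, rfl⟩
    have h2 : f ⟨G ψ, ψ, rfl⟩ = L (I (J ⟨G ψ, ψ, rfl⟩)) := rfl
    rw [h2] at h1
    have h3 := hLG (J ⟨G ψ, ψ, rfl⟩ - ψ)
    rw [map_sub G, hJ', sub_self, norm_zero, map_sub, map_sub] at h3
    have h4 := abs_nonpos_iff.1 h3
    simp only at h1
    linarith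
  -- The Hahn–Banach extension `Λ` is represented by the field `σ`; the representative `k` of `L`
  -- itself gives the divergence `-k`, so that `-∫ u g = L u`.
  obtain ⟨σ, hσm, hσ1, hσ⟩ := exists_bounded_representative Λ zero_le_one (fun y => by
    have := Λ.le_opNorm y
    rw [hΛn] at this
    exact this.trans (by gcongr))
  obtain ⟨k, hkm, hk1, hk⟩ := exists_bounded_representative L (norm_nonneg L) (fun y =>
    L.le_opNorm y)
  have hLu : ∀ (u : Eucl N → ℝ) (hu : Integrable u (wMeasure Ω φ)),
      L (hu.toL1 u) = ∫ x, u x * k x ∂(wMeasure Ω φ) := by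
    intro u hu
    rw [hk]
    exact integral_congr_ae (Eventually.of_forall fun x => by simp [mul_comm])
  refine ⟨σ, fun x => -k x, ⟨MemLp.of_bound hσm 1 hσ1,
    (MemLp.of_bound hkm ‖L‖ hk1).neg, fun ψ h1 h2 => ?_⟩, h.ae_wMeasure_iff.1 hσ1, ?_⟩
  · have e1 := hΛG ⟨ψ, h1, h2⟩
    have e2 : Λ (G ⟨ψ, h1, h2⟩) = ∫ x, fderiv ℝ ψ x (σ x) ∂(wMeasure Ω φ) := by
      refine (hσ _ (hgi ⟨ψ, h1, h2⟩)).trans (integral_congr_ae (Eventually.of_forall fun x => ?_))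
      simp only
      rw [real_inner_comm, inner_gradient]
    have e3 : L (I ⟨ψ, h1, h2⟩) = ∫ x, ψ x * k x ∂(wMeasure Ω φ) :=
      hLu _ (h.integrable_of_continuous h1.continuous)
    rw [← e2, e1, e3, ← integral_neg]
    exact integral_congr_ae (Eventually.of_forall fun x => by simp [mul_comm])
  · intro u hu
    rw [hLu, ← integral_neg]
    exact integral_congr_ae (Eventually.of_forall fun x => by simp)

/-- Functions of weighted variation at most `c` are limits in `L¹` of test functions whose gradient
has weighted norm at most `c`. -/
theorem exists_testFunction_approx (h : ConcaveWeight m Ω φ) {u : Eucl N → ℝ}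
    (hu : Integrable u (wMeasure Ω φ)) {c : ℝ} (hc : 0 < c)
    (hV : variation Ω φ u ≤ ENNReal.ofReal c) {δ : ℝ≥0∞} (hδ : δ ≠ 0) :
    ∃ ψ : Eucl N → ℝ, ContDiff ℝ ∞ ψ ∧ HasCompactSupport ψ ∧
      wNorm Ω φ (fderiv ℝ ψ) ≤ ENNReal.ofReal c ∧
      ∫⁻ x, ‖ψ x - u x‖ₑ ∂(wMeasure Ω φ) < δ := by
  have := h.isFiniteMeasure
  let T : Set (Lp ℝ 1 (wMeasure Ω φ)) := {f | ∃ (ψ : Eucl N → ℝ) (hψ : ContDiff ℝ ∞ ψ),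
    HasCompactSupport ψ ∧ wNorm Ω φ (fderiv ℝ ψ) ≤ ENNReal.ofReal c ∧
    f = (h.integrable_of_continuous hψ.continuous).toL1 ψ}
  have hT : Convex ℝ T := by
    rintro _ ⟨ψ₁, h1, s1, n1, rfl⟩ _ ⟨ψ₂, h2, s2, n2, rfl⟩ a b ha hb hab
    have c1 : ContDiff ℝ ∞ (a • ψ₁) := contDiff_const.smul h1
    have c2 : ContDiff ℝ ∞ (b • ψ₂) := contDiff_const.smul h2
    refine ⟨a • ψ₁ + b • ψ₂, c1.add c2, s1.smul_left.add s2.smul_left, ?_, ?_⟩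
    · refine (wNorm_fderiv_add_le c1 c2).trans ?_
      rw [wNorm_fderiv_smul h1, wNorm_fderiv_smul h2, Real.enorm_of_nonneg ha,
        Real.enorm_of_nonneg hb]
      calc _ ≤ ENNReal.ofReal a * ENNReal.ofReal c + ENNReal.ofReal b * ENNReal.ofReal c := by
            gcongr
        _ = ENNReal.ofReal c := by
            rw [← add_mul, ← ENNReal.ofReal_add ha hb, hab, ENNReal.ofReal_one, one_mul]
    · rw [← Integrable.toL1_smul', ← Integrable.toL1_smul', ← Integrable.toL1_add]
  have hmem : hu.toL1 u ∈ closure T := by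
    -- A separating `L` satisfies `L < s` on `T` and `s < L u`. Rescaling test functions to gradient
    -- norm at most `c` gives `L ψ ≤ (s / c) ∫ |∇ψ|`, so `(c / s) L` comes from a field admissible
    -- in the variation. This field forces the variation of `u` above `c`.
    by_contra hnot
    obtain ⟨L, s, hLs, hsu⟩ := geometric_hahn_banach_closed_point hT.closure isClosed_closure hnot
    have hs0 : 0 < s := by
      have h0 : (0 : Lp ℝ 1 (wMeasure Ω φ)) ∈ T := by
        refine ⟨0, contDiff_const, HasCompactSupport.zero, ?_, ?_⟩
        · have h0 : ∀ x, ‖fderiv ℝ (0 : Eucl N → ℝ) x‖ₑ = 0 := fun x => by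
            rw [← ofReal_norm, fderiv_zero, Pi.zero_apply, norm_zero, ENNReal.ofReal_zero]
          simp only [wNorm, h0, lintegral_zero, zero_le]
        · exact (Integrable.toL1_zero _).symm
      simpa using hLs 0 (subset_closure h0)
    have hle : ∀ (ψ : Eucl N → ℝ) (hψ : ContDiff ℝ ∞ ψ), HasCompactSupport ψ →
        L ((h.integrable_of_continuous hψ.continuous).toL1 ψ) ≤
          s / c * (wNorm Ω φ (fderiv ℝ ψ)).toReal := by
      intro ψ hψ hψc
      set F := (wNorm Ω φ (fderiv ℝ ψ)).toReal with hF
      have hF0 : 0 ≤ F := ENNReal.toReal_nonneg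
      have hFe : wNorm Ω φ (fderiv ℝ ψ) = ENNReal.ofReal F :=
        (ENNReal.ofReal_toReal (h.wNorm_fderiv_lt_top hψ).ne).symm
      refine le_of_forall_pos_le_add fun δ hδ => ?_
      -- Normalizing by `F + η` rather than `F` covers a vanishing gradient; this `η` makes the
      -- resulting error exactly `δ`.
      set η : ℝ := δ * c / s with hη
      have hη0 : 0 < η := by positivity
      have hFη : 0 < F + η := by positivity
      have ht0 : 0 ≤ c / (F + η) := by positivity
      have c1 : ContDiff ℝ ∞ ((c / (F + η)) • ψ) := contDiff_const.smul hψ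
      have hin : (h.integrable_of_continuous c1.continuous).toL1 ((c / (F + η)) • ψ) ∈ T := by
        refine ⟨_, c1, hψc.smul_left, ?_, rfl⟩
        rw [wNorm_fderiv_smul hψ, Real.enorm_of_nonneg ht0, hFe, ← ENNReal.ofReal_mul ht0]
        refine ENNReal.ofReal_le_ofReal ?_
        rw [div_mul_eq_mul_div, div_le_iff₀ hFη]
        nlinarith
      have h1 := hLs _ (subset_closure hin)
      rw [Integrable.toL1_smul' ψ (h.integrable_of_continuous hψ.continuous), map_smul,
        smul_eq_mul, div_mul_eq_mul_div, div_lt_iff₀ hFη] at h1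
      have h2 : s / c * F + δ = s * (F + η) / c := by rw [hη]; field_simp
      rw [h2, le_div_iff₀ hc]
      linarith
    have hκ : 0 < c / s := by positivity
    obtain ⟨σ, g, hσ, hσ1, hrep⟩ := h.exists_field_of_functional ((c / s) • L) (by
      intro ψ hψ hψc
      have h1 := hle ψ hψ hψc
      have h2 := hle (-ψ) hψ.neg hψc.neg
      have h3 : fderiv ℝ (-ψ) = -fderiv ℝ ψ := by ext1 x; exact fderiv_neg
      have h4 : wNorm Ω φ (-fderiv ℝ ψ) = wNorm Ω φ (fderiv ℝ ψ) := by simp [wNorm]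
      rw [h3, h4, Integrable.toL1_neg ψ (h.integrable_of_continuous hψ.continuous), map_neg] at h2
      have h5 := abs_le'.2 ⟨h1, h2⟩
      rw [smul_apply, smul_eq_mul, abs_mul, abs_of_pos hκ]
      calc c / s * _ ≤ c / s * (s / c * (wNorm Ω φ (fderiv ℝ ψ)).toReal) := by gcongr
        _ = _ := by field_simp)
    have h1 := (le_variation hσ hσ1 u).trans hV
    rw [← hrep u hu, ENNReal.ofReal_le_ofReal_iff hc.le, smul_apply,
      smul_eq_mul, div_mul_eq_mul_div, div_le_iff₀ hs0] at h1
    nlinarith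
  obtain ⟨_, ⟨ψ, hψ, hψc, hn, rfl⟩, hd⟩ := EMetric.mem_closure_iff.1 hmem δ (pos_iff_ne_zero.2 hδ)
  refine ⟨ψ, hψ, hψc, hn, ?_⟩
  rw [edist_comm, Integrable.edist_toL1_toL1] at hd
  simpa [edist_eq_enorm_sub] using hd

end ConcaveWeight

/-! ### Smoothing towards the interior of a convex set -/

/-- A smooth probability density with compact support in `Ω`. -/
structure IsKernel {N : ℕ} (Ω : Set (Eucl N)) (ρ : Eucl N → ℝ) : Prop where
  contDiff : ContDiff ℝ ∞ ρ
  hasCompactSupport : HasCompactSupport ρ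
  tsupport_subset : tsupport ρ ⊆ Ω
  nonneg : ∀ z, 0 ≤ ρ z
  integral_eq_one : ∫ z, ρ z = 1

/-- The average of `u` over the points `(1 - ε) x + ε z`, where `z` has density `ρ`. -/
def smoothing {N : ℕ} (ρ : Eucl N → ℝ) (ε : ℝ) (u : Eucl N → ℝ) (x : Eucl N) : ℝ :=
  ∫ z, ρ z * u ((1 - ε) • x + ε • z)

/-- The rescaled and reflected kernel that represents `smoothing` as a convolution. -/
def scaledKernel {N : ℕ} (ρ : Eucl N → ℝ) (ε : ℝ) (y : Eucl N) : ℝ :=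
  |(ε ^ N)⁻¹| * ρ (-(ε⁻¹ • y))

/-- A compact subset of `Ω` that contains all the points entering `smoothing` on `Ω`. -/
def smoothingSet {N : ℕ} (Ω : Set (Eucl N)) (ρ : Eucl N → ℝ) (ε : ℝ) : Set (Eucl N) :=
  (fun p : Eucl N × Eucl N => (1 - ε) • p.1 + ε • p.2) '' (closure Ω ×ˢ tsupport ρ)

variable {ρ : Eucl N → ℝ} {ε : ℝ}

lemma IsKernel.lintegral_enorm (hρ : IsKernel Ω ρ) : ∫⁻ z, ‖ρ z‖ₑ = 1 := by
  have hi : Integrable ρ := hρ.contDiff.continuous.integrable_of_hasCompactSupport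
    hρ.hasCompactSupport
  have h1 := ofReal_integral_eq_lintegral_ofReal hi (Eventually.of_forall hρ.nonneg)
  rw [hρ.integral_eq_one, ENNReal.ofReal_one] at h1
  rw [h1]
  exact lintegral_congr fun z => Real.enorm_of_nonneg (hρ.nonneg z)

lemma IsKernel.integrable (hρ : IsKernel Ω ρ) : Integrable ρ :=
  hρ.contDiff.continuous.integrable_of_hasCompactSupport hρ.hasCompactSupport

lemma IsKernel.mem_of_ne_zero (hρ : IsKernel Ω ρ) {z : Eucl N} (hz : ρ z ≠ 0) : z ∈ Ω :=
  hρ.tsupport_subset (subset_tsupport ρ hz)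

lemma IsKernel.contDiff_scaledKernel (hρ : IsKernel Ω ρ) (ε : ℝ) :
    ContDiff ℝ ∞ (scaledKernel ρ ε) := by
  unfold scaledKernel
  have h1 := hρ.contDiff
  fun_prop

lemma IsKernel.hasCompactSupport_scaledKernel (hρ : IsKernel Ω ρ) (hε : 0 < ε) :
    HasCompactSupport (scaledKernel ρ ε) := by
  have h1 : HasCompactSupport fun y : Eucl N => ρ (-(ε⁻¹ • y)) :=
    hρ.hasCompactSupport.comp_homeomorph
      ((Homeomorph.smulOfNeZero ε⁻¹ (inv_ne_zero hε.ne')).trans (Homeomorph.neg (Eucl N)))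
  exact h1.mul_left

lemma scaledKernel_sub (ρ : Eucl N → ℝ) (ε : ℝ) (a t : Eucl N) :
    scaledKernel ρ ε (a - t) = |(ε ^ N)⁻¹| * ρ (ε⁻¹ • (t - a)) := by
  rw [scaledKernel, ← smul_neg, neg_sub]

/-- Substitute `t = (1 - ε) x + ε z`: in the new variable, `x` enters only through the smooth kernel
and can be differentiated there. -/
lemma smoothing_eq_integral (ρ : Eucl N → ℝ) (hε : 0 < ε) (u : Eucl N → ℝ) (x : Eucl N) :
    smoothing ρ ε u x = ∫ t, u t * scaledKernel ρ ε ((1 - ε) • x - t) := by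
  set a := (1 - ε) • x with ha
  let f : Eucl N → ℝ := fun y => ρ (ε⁻¹ • y) * u (a + y)
  have h1 : smoothing ρ ε u x = ∫ z, f (ε • z) := by
    refine integral_congr_ae (Eventually.of_forall fun z => ?_)
    simp only [f]
    rw [smul_smul, inv_mul_cancel₀ hε.ne', one_smul]
  rw [h1, Measure.integral_comp_smul, ← integral_sub_right_eq_self f a, smul_eq_mul,
    ← integral_const_mul]
  refine integral_congr_ae (Eventually.of_forall fun t => ?_)
  simp only [f, scaledKernel_sub, finrank_euclideanSpace, Fintype.card_fin, add_sub_cancel]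
  ring

lemma lintegral_kernel_eq (hρ : IsKernel Ω ρ) (hε : 0 < ε) {f : Eucl N → ℝ≥0∞}
    (hf : Measurable f) (x : Eucl N) :
    ∫⁻ z, ‖ρ z‖ₑ * f ((1 - ε) • x + ε • z) =
      ∫⁻ t, ‖scaledKernel ρ ε ((1 - ε) • x - t)‖ₑ * f t := by
  set a := (1 - ε) • x with ha
  have hρm : Measurable ρ := hρ.contDiff.continuous.measurable
  let F : Eucl N → ℝ≥0∞ := fun y => ‖ρ (ε⁻¹ • y)‖ₑ * f (a + y)
  have hF : Measurable F := by fun_prop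
  have h1 : ∫⁻ z, ‖ρ z‖ₑ * f (a + ε • z) =
      ∫⁻ y, F y ∂(Measure.map (fun z : Eucl N => ε • z) volume) := by
    rw [lintegral_map hF (by fun_prop)]
    refine lintegral_congr fun z => ?_
    simp only [F]
    rw [smul_smul, inv_mul_cancel₀ hε.ne', one_smul]
  rw [h1, Measure.map_addHaar_smul _ hε.ne', lintegral_smul_measure,
    ← lintegral_sub_right_eq_self F a, smul_eq_mul, ← lintegral_const_mul _ (by fun_prop)]
  refine lintegral_congr fun t => ?_
  simp only [F, scaledKernel_sub, finrank_euclideanSpace, Fintype.card_fin, add_sub_cancel]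
  rw [enorm_mul, Real.enorm_abs, mul_assoc, ← Real.enorm_eq_ofReal_abs]

/-- This permits truncation to a compact subset of `Ω`, where a weighted integrable function becomes
Lebesgue integrable, without changing the smoothing on `Ω`. -/
lemma smoothing_indicator (ρ : Eucl N → ℝ) (ε : ℝ) (u : Eucl N → ℝ) {x : Eucl N} (hx : x ∈ Ω) :
    smoothing ρ ε ((smoothingSet Ω ρ ε).indicator u) x = smoothing ρ ε u x := by
  refine integral_congr_ae (Eventually.of_forall fun z => ?_)
  simp only
  by_cases hz : ρ z = 0
  · simp [hz]
  · rw [indicator_of_mem]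
    exact ⟨(x, z), ⟨subset_closure hx, subset_tsupport ρ hz⟩, rfl⟩

/-- The regularity and the bounds of the smoothing of an integrable function. -/
lemma IsKernel.smoothing_regular (hρ : IsKernel Ω ρ) (hε : 0 < ε) :
    ∃ C : ℝ, ∀ v : Eucl N → ℝ, Integrable v → ContDiff ℝ ∞ (smoothing ρ ε v) ∧
      (∀ x, |smoothing ρ ε v x| ≤ C * ∫ t, |v t|) ∧
      ∀ x y, |smoothing ρ ε v x - smoothing ρ ε v y| ≤ C * (∫ t, |v t|) * ‖x - y‖ := by
  have hk := hρ.contDiff_scaledKernel ε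
  have hkc := hρ.hasCompactSupport_scaledKernel hε
  obtain ⟨C₁, hC₁⟩ := hkc.exists_bound_of_continuous hk.continuous
  obtain ⟨C₂, hC₂⟩ := ContDiff.lipschitzWith_of_hasCompactSupport hkc hk (by simp)
  refine ⟨max C₁ (C₂ * |1 - ε|), fun v hv => ⟨?_, ?_, ?_⟩⟩
  · have h1 : smoothing ρ ε v = (convolution v (scaledKernel ρ ε)
        (ContinuousLinearMap.mul ℝ ℝ) volume) ∘ fun x => (1 - ε) • x := by
      ext x
      exact smoothing_eq_integral ρ hε v x
    rw [h1]
    exact (hkc.contDiff_convolution_right _ hv.locallyIntegrable hk).comp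
      (contDiff_id.const_smul (1 - ε))
  · intro x
    rw [smoothing_eq_integral ρ hε, ← integral_const_mul]
    rw [← Real.norm_eq_abs]
    refine norm_integral_le_of_norm_le (hv.abs.const_mul _) (Eventually.of_forall fun t => ?_)
    rw [norm_mul, mul_comm]
    exact mul_le_mul_of_nonneg_right ((hC₁ _).trans (le_max_left _ _)) (norm_nonneg _)
  · intro x y
    have hint : ∀ a : Eucl N, Integrable fun t => v t * scaledKernel ρ ε (a - t) := fun a => by
      refine hv.mul_bdd (c := C₁) ?_ (Eventually.of_forall fun t => hC₁ _)
      exact (hk.continuous.comp (continuous_const.sub continuous_id)).aestronglyMeasurable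
    rw [smoothing_eq_integral ρ hε, smoothing_eq_integral ρ hε, ← integral_sub (hint _) (hint _),
      mul_right_comm, ← integral_const_mul]
    rw [← Real.norm_eq_abs]
    refine norm_integral_le_of_norm_le (hv.abs.const_mul _) (Eventually.of_forall fun t => ?_)
    rw [← mul_sub, norm_mul, mul_comm]
    refine mul_le_mul_of_nonneg_right ?_ (norm_nonneg _)
    have h1 := hC₂.dist_le_mul ((1 - ε) • x - t) ((1 - ε) • y - t)
    rw [dist_eq_norm, dist_eq_norm, sub_sub_sub_cancel_right, ← smul_sub, norm_smul,
      Real.norm_eq_abs (1 - ε), ← mul_assoc] at h1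
    exact h1.trans (mul_le_mul_of_nonneg_right (le_max_right _ _) (norm_nonneg _))

/-! ### Smoothing in the weighted `L¹` space. -/

namespace ConcaveWeight

lemma exists_isKernel (h : ConcaveWeight m Ω φ) : ∃ ρ, IsKernel Ω ρ := by
  obtain ⟨x₀, hx₀⟩ := h.nonempty
  obtain ⟨r, hr, hball⟩ := Metric.isOpen_iff.1 h.isOpen x₀ hx₀
  let b : ContDiffBump x₀ := ⟨r / 4, r / 2, by positivity, by linarith⟩
  refine ⟨b.normed volume, b.contDiff_normed, b.hasCompactSupport_normed, ?_, b.nonneg_normed,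
    b.integral_normed⟩
  rw [b.tsupport_normed_eq]
  exact (Metric.closedBall_subset_ball (by simp only [b]; linarith)).trans hball

lemma isCompact_smoothingSet (h : ConcaveWeight m Ω φ) (hρ : IsKernel Ω ρ) (ε : ℝ) :
    IsCompact (smoothingSet Ω ρ ε) :=
  (h.isBounded.isCompact_closure.prod hρ.hasCompactSupport).image (by fun_prop)

/-- A proper convex combination of a point of the closure and an interior point is interior. -/
lemma smoothingSet_subset (h : ConcaveWeight m Ω φ) (hρ : IsKernel Ω ρ) (hε : 0 < ε)
    (hε1 : ε < 1) : smoothingSet Ω ρ ε ⊆ Ω := by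
  rintro _ ⟨⟨x, z⟩, ⟨hx, hz⟩, rfl⟩
  have hz' : z ∈ interior Ω := by rw [h.isOpen.interior_eq]; exact hρ.tsupport_subset hz
  have := h.convex.combo_closure_interior_mem_interior hx hz' (a := 1 - ε) (b := ε)
    (by linarith) hε (by ring)
  rwa [h.isOpen.interior_eq] at this

/-- Truncation to a compact subset of `Ω` turns weighted integrability into integrability. -/
lemma integrable_indicator_of_isCompact (h : ConcaveWeight m Ω φ) {K : Set (Eucl N)}
    (hK : IsCompact K) (hKΩ : K ⊆ Ω) : ∃ c : ℝ≥0, ∀ u : Eucl N → ℝ,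
      Integrable u (wMeasure Ω φ) → Integrable (K.indicator u) ∧
        ∫ t, |K.indicator u t| ≤ c * ∫ t, |u t| ∂(wMeasure Ω φ) := by
  obtain ⟨c, hc⟩ := h.restrict_le_smul hK hKΩ
  refine ⟨c, fun u hu => ?_⟩
  have hcu : Integrable u ((c : ℝ≥0∞) • wMeasure Ω φ) := hu.smul_measure ENNReal.coe_ne_top
  refine ⟨(integrable_indicator_iff hK.measurableSet).2 (hcu.mono_measure hc), ?_⟩
  have e1 : ∫ t, |K.indicator u t| = ∫ t in K, |u t| := by
    rw [← integral_indicator hK.measurableSet]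
    refine integral_congr_ae (Eventually.of_forall fun t => ?_)
    by_cases ht : t ∈ K <;> simp [ht]
  rw [e1]
  have e2 := integral_mono_measure hc (Eventually.of_forall fun t => abs_nonneg (u t)) hcu.abs
  rw [integral_smul_measure] at e2
  simpa using e2

/-- Tonelli reduces the average to the dilation bound at each centre `z`, which is uniform in `z`;
`ρ` has mass 1. -/
lemma lintegral_kernel_le (h : ConcaveWeight m Ω φ) (hρ : IsKernel Ω ρ) (hε : 0 ≤ ε) (hε1 : ε < 1)
    {f : Eucl N → ℝ≥0∞} (hf : Measurable f) :
    ∫⁻ x, (∫⁻ z, ‖ρ z‖ₑ * f ((1 - ε) • x + ε • z)) ∂(wMeasure Ω φ) ≤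
      dilationFactor m N ε * ∫⁻ x, f x ∂(wMeasure Ω φ) := by
  have := h.isFiniteMeasure
  have hρm : Measurable ρ := hρ.contDiff.continuous.measurable
  rw [lintegral_lintegral_swap (by
    refine Measurable.aemeasurable ?_
    unfold Function.uncurry
    fun_prop)]
  calc ∫⁻ z, ∫⁻ x, ‖ρ z‖ₑ * f ((1 - ε) • x + ε • z) ∂(wMeasure Ω φ)
      ≤ ∫⁻ z, ‖ρ z‖ₑ * (dilationFactor m N ε * ∫⁻ x, f x ∂(wMeasure Ω φ)) := by
        refine lintegral_mono fun z => ?_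
        rw [lintegral_const_mul _ (by fun_prop)]
        by_cases hz : ρ z = 0
        · simp [hz]
        · gcongr
          exact h.lintegral_dilation_le (hρ.mem_of_ne_zero hz) hε hε1 hf
    _ = _ := by rw [lintegral_mul_const _ hρm.enorm, hρ.lintegral_enorm, one_mul]

lemma lintegral_smoothing_sub_le (h : ConcaveWeight m Ω φ) (hρ : IsKernel Ω ρ)
    {u : Eucl N → ℝ} (hu : Measurable u) {B : ℝ≥0∞}
    (hB : ∀ z ∈ Ω, ∫⁻ x, ‖u ((1 - ε) • x + ε • z) - u x‖ₑ ∂(wMeasure Ω φ) ≤ B) :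
    ∫⁻ x, ‖smoothing ρ ε u x - u x‖ₑ ∂(wMeasure Ω φ) ≤ B := by
  have := h.isFiniteMeasure
  have hρm : Measurable ρ := hρ.contDiff.continuous.measurable
  have hpt : ∀ x, ‖smoothing ρ ε u x - u x‖ₑ ≤
      ∫⁻ z, ‖ρ z‖ₑ * ‖u ((1 - ε) • x + ε • z) - u x‖ₑ := by
    intro x
    simp only [← enorm_mul]
    by_cases hi : Integrable fun z => ρ z * (u ((1 - ε) • x + ε • z) - u x)
    · have h1 : smoothing ρ ε u x - u x = ∫ z, ρ z * (u ((1 - ε) • x + ε • z) - u x) := by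
        have hi2 : Integrable fun z => ρ z * u x := hρ.integrable.mul_const _
        have h2 : ∫ z, ρ z * u x = u x := by
          rw [integral_mul_const, hρ.integral_eq_one, one_mul]
        rw [sub_eq_iff_eq_add, ← h2, ← integral_add (by rw [h2]; exact hi) hi2, h2, smoothing]
        refine integral_congr_ae (Eventually.of_forall fun z => ?_)
        simp only
        ring
      rw [h1]
      exact enorm_integral_le_lintegral_enorm _
    -- Without integrability, `smoothing` takes the default value 0 of the integral, but the right
    -- side is then infinite.
    · have hm : AEStronglyMeasurable (fun z => ρ z * (u ((1 - ε) • x + ε • z) - u x)) volume := by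
        refine Measurable.aestronglyMeasurable ?_
        fun_prop
      have : ∫⁻ z, ‖ρ z * (u ((1 - ε) • x + ε • z) - u x)‖ₑ = ⊤ := by
        by_contra hne
        exact hi ⟨hm, lt_top_iff_ne_top.2 hne⟩
      rw [this]
      exact le_top
  calc ∫⁻ x, ‖smoothing ρ ε u x - u x‖ₑ ∂(wMeasure Ω φ)
      ≤ ∫⁻ x, (∫⁻ z, ‖ρ z‖ₑ * ‖u ((1 - ε) • x + ε • z) - u x‖ₑ) ∂(wMeasure Ω φ) :=
        lintegral_mono hpt
    _ = ∫⁻ z, ∫⁻ x, ‖ρ z‖ₑ * ‖u ((1 - ε) • x + ε • z) - u x‖ₑ ∂(wMeasure Ω φ) := by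
        refine lintegral_lintegral_swap (Measurable.aemeasurable ?_)
        unfold Function.uncurry
        fun_prop
    _ ≤ ∫⁻ z, ‖ρ z‖ₑ * B := by
        refine lintegral_mono fun z => ?_
        rw [lintegral_const_mul _ (by fun_prop)]
        by_cases hz : ρ z = 0
        · simp [hz]
        · gcongr
          exact hB z (hρ.mem_of_ne_zero hz)
    _ = B := by rw [lintegral_mul_const _ hρm.enorm, hρ.lintegral_enorm, one_mul]

end ConcaveWeight

lemma exists_pos_ofReal_mul_le {a δ : ℝ≥0∞} (ha : a ≠ ⊤) (hδ : δ ≠ 0) :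
    ∃ η : ℝ, 0 < η ∧ ENNReal.ofReal η * a ≤ δ := by
  have h1 : δ / (a + 1) ≠ 0 := ENNReal.div_ne_zero.2 ⟨hδ, by simp [ha]⟩
  obtain ⟨η, hη0, hη⟩ := ENNReal.lt_iff_exists_nnreal_btwn.1 (pos_iff_ne_zero.2 h1)
  refine ⟨η, by exact_mod_cast hη0, ?_⟩
  rw [ENNReal.ofReal_coe_nnreal]
  calc (η : ℝ≥0∞) * a ≤ δ / (a + 1) * (a + 1) := by gcongr; exact le_self_add
    _ ≤ δ := by rw [mul_comm]; exact ENNReal.mul_div_le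

/-! ### Smoothing of weighted Sobolev functions. -/

namespace ConcaveWeight

/-- The gradient of a smoothing is controlled by the average of the weak gradient. -/
lemma enorm_fderiv_smoothing_le (h : ConcaveWeight m Ω φ) (hρ : IsKernel Ω ρ) (hε : 0 < ε)
    (hε1 : ε < 1) {u : Eucl N → ℝ} {G : Eucl N → Eucl N} (hG : Measurable G)
    (hu : Integrable ((smoothingSet Ω ρ ε).indicator u))
    (hw : ∀ ψ : Eucl N → ℝ, ContDiff ℝ ∞ ψ → HasCompactSupport ψ → tsupport ψ ⊆ Ω →
      ∀ v : Eucl N, ∫ x in Ω, u x * fderiv ℝ ψ x v = - ∫ x in Ω, inner ℝ (G x) v * ψ x)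
    {x : Eucl N} (hx : x ∈ Ω) :
    ‖fderiv ℝ (smoothing ρ ε ((smoothingSet Ω ρ ε).indicator u)) x‖ₑ ≤
      ∫⁻ z, ‖ρ z‖ₑ * ‖G ((1 - ε) • x + ε • z)‖ₑ := by
  set v := (smoothingSet Ω ρ ε).indicator u with hv
  set k := scaledKernel ρ ε with hkdef
  have hk : ContDiff ℝ ∞ k := hρ.contDiff_scaledKernel ε
  have hkc : HasCompactSupport k := hρ.hasCompactSupport_scaledKernel hε
  set a := (1 - ε) • x with ha
  set ψ : Eucl N → ℝ := fun t => k (a - t) with hψdef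
  have hψ : ContDiff ℝ ∞ ψ := hk.comp (contDiff_const.sub contDiff_id)
  have hψK : tsupport ψ ⊆ smoothingSet Ω ρ ε := by
    have h1 : tsupport ψ ⊆ (fun t => ε⁻¹ • (t - a)) ⁻¹' tsupport ρ := by
      refine closure_minimal (fun t ht => ?_) ((isClosed_tsupport ρ).preimage (by fun_prop))
      refine subset_tsupport ρ fun h0 => ht ?_
      simp only [hψdef, hkdef, scaledKernel_sub, h0, mul_zero]
    intro t ht
    refine ⟨(x, ε⁻¹ • (t - a)), ⟨subset_closure hx, h1 ht⟩, ?_⟩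
    simp only
    rw [smul_smul, mul_inv_cancel₀ hε.ne', one_smul, ← ha, add_sub_cancel]
  have hKΩ := h.smoothingSet_subset hρ hε hε1
  have hψc : HasCompactSupport ψ :=
    HasCompactSupport.of_support_subset_isCompact (h.isCompact_smoothingSet hρ ε)
      ((subset_tsupport ψ).trans hψK)
  have hfψ : ∀ t w, fderiv ℝ ψ t w = -fderiv ℝ k (a - t) w := by
    intro t w
    have h1 : HasFDerivAt ψ ((fderiv ℝ k (a - t)).comp (-ContinuousLinearMap.id ℝ (Eucl N))) t :=
      (hk.differentiable (by simp) (a - t)).hasFDerivAt.comp t ((hasFDerivAt_id t).const_sub a)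
    rw [h1.fderiv]
    simp
  -- the derivative of the convolution
  have hder : ∀ w, fderiv ℝ (smoothing ρ ε v) x w =
      (1 - ε) * ∫ t, v t * fderiv ℝ k (a - t) w := by
    intro w
    have e1 : smoothing ρ ε v = (convolution v k (ContinuousLinearMap.mul ℝ ℝ) volume) ∘
        fun x => (1 - ε) • x := by
      ext y
      exact smoothing_eq_integral ρ hε v y
    have e2 := (hkc.hasFDerivAt_convolution_right (ContinuousLinearMap.mul ℝ ℝ)
      hu.locallyIntegrable (hk.of_le (by simp)) a).comp x
      ((hasFDerivAt_id x).const_smul (1 - ε))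
    have e3 : fderiv ℝ (smoothing ρ ε v) x =
        (convolution v (fderiv ℝ k) (ContinuousLinearMap.precompR (Eucl N)
          (ContinuousLinearMap.mul ℝ ℝ)) volume a).comp
          ((1 - ε) • ContinuousLinearMap.id ℝ (Eucl N)) := by
      rw [e1]; exact e2.fderiv
    rw [e3, ContinuousLinearMap.comp_apply]
    have e4 : ((1 - ε) • ContinuousLinearMap.id ℝ (Eucl N)) w = (1 - ε) • w := rfl
    rw [e4, map_smul, smul_eq_mul, convolution_precompR_apply _ hu.locallyIntegrable
      (hkc.fderiv ℝ) (hk.continuous_fderiv (by simp))]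
    rfl
  refine ContinuousLinearMap.opENorm_le_bound _ fun w => ?_
  -- The shifted kernel `ψ = k (a - ·)` is supported in `Ω`, so the weak gradient identity moves the
  -- derivative from the kernel to `u`.
  have hint : ∫ t, v t * fderiv ℝ k (a - t) w = ∫ t in Ω, inner ℝ (G t) w * ψ t := by
    have e1 := hw ψ hψ hψc (hψK.trans hKΩ) w
    have e2 : ∫ t, v t * fderiv ℝ k (a - t) w = -∫ t in Ω, u t * fderiv ℝ ψ t w := by
      rw [← integral_neg, ← integral_indicator h.isOpen.measurableSet]
      refine integral_congr_ae (Eventually.of_forall fun t => ?_)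
      simp only
      by_cases ht : t ∈ smoothingSet Ω ρ ε
      · rw [hv, indicator_of_mem ht, indicator_of_mem (hKΩ ht), hfψ]
        ring
      · have h0 : fderiv ℝ ψ t = 0 := by
          by_contra hne
          exact ht (hψK (support_fderiv_subset ℝ hne))
        rw [hv, indicator_of_notMem ht]
        simp [indicator, h0]
    rw [e2, e1, neg_neg]
  rw [hder, hint, enorm_mul, lintegral_kernel_eq hρ hε (f := fun y => ‖G y‖ₑ) hG.enorm]
  have h1 : ‖1 - ε‖ₑ ≤ 1 := by
    rw [Real.enorm_of_nonneg (by linarith)]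
    exact ENNReal.ofReal_le_one.2 (by linarith)
  calc ‖1 - ε‖ₑ * ‖∫ t in Ω, inner ℝ (G t) w * ψ t‖ₑ
      ≤ 1 * ∫⁻ t in Ω, ‖inner ℝ (G t) w * ψ t‖ₑ := by
        gcongr
        exact enorm_integral_le_lintegral_enorm _
    _ ≤ ∫⁻ t, ‖k (a - t)‖ₑ * ‖G t‖ₑ * ‖w‖ₑ := by
        rw [one_mul]
        refine (setLIntegral_le_lintegral _ _).trans (lintegral_mono fun t => ?_)
        rw [enorm_mul, mul_comm, mul_assoc]
        gcongr
        rw [← ofReal_norm, ← ofReal_norm, ← ofReal_norm, ← ENNReal.ofReal_mul (norm_nonneg _)]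
        exact ENNReal.ofReal_le_ofReal (norm_inner_le_norm _ _)
    _ = _ := by
        refine lintegral_mul_const _ (Measurable.mul ?_ hG.enorm)
        exact (hk.continuous.comp (continuous_const.sub continuous_id)).measurable.enorm

/-- Dilations towards points of `Ω` are `L¹`-continuous, uniformly in the point. -/
lemma exists_dilation_close (h : ConcaveWeight m Ω φ) {u : Eucl N → ℝ} (hum : Measurable u)
    (hu : Integrable u (wMeasure Ω φ)) {δ : ℝ≥0∞} (hδ : δ ≠ 0) :
    ∃ ε₀ : ℝ, 0 < ε₀ ∧ ∀ ε : ℝ, 0 < ε → ε < ε₀ → ε < 1 / 2 → ∀ z ∈ Ω,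
      ∫⁻ x, ‖u ((1 - ε) • x + ε • z) - u x‖ₑ ∂(wMeasure Ω φ) ≤ δ := by
  have := h.isFiniteMeasure
  set c : ℝ≥0∞ := dilationFactor m N (1 / 2) with hc
  have hctop : c ≠ ⊤ := ENNReal.ofReal_ne_top
  have hmono : ∀ ε, 0 < ε → ε < 1 / 2 → dilationFactor m N ε ≤ c := by
    intro ε h0 h1
    refine ENNReal.ofReal_le_ofReal (inv_anti₀ (by positivity) ?_)
    exact pow_le_pow_left₀ (by norm_num) (by linarith) _
  -- The error of the continuous approximation is counted once directly and once, with factor `c`,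
  -- after dilation: the sum is at most `δ / 2`.
  set δ₁ : ℝ≥0∞ := δ / 2 / (c + 1) with hδ₁
  have hδ₁0 : δ₁ ≠ 0 := by
    refine ENNReal.div_ne_zero.2 ⟨ENNReal.div_ne_zero.2 ⟨hδ, by simp⟩, ?_⟩
    simp [hctop]
  obtain ⟨w, hwc, hw, hwcont, hwi⟩ := hu.exists_hasCompactSupport_lintegral_sub_le hδ₁0
  -- uniform continuity of `w`
  obtain ⟨R, hR0, hR⟩ := h.isBounded.subset_ball_lt 0 (0 : Eucl N)
  have hμ : wMeasure Ω φ univ ≠ ⊤ := measure_ne_top _ _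
  obtain ⟨η, hη0, hη⟩ := exists_pos_ofReal_mul_le hμ (ENNReal.half_pos hδ).ne'
  obtain ⟨r, hr0, hr⟩ := Metric.uniformContinuous_iff.1
    (hwc.uniformContinuous_of_continuous hwcont) η hη0
  -- The dilation moves a point by `ε ‖z - x‖ ≤ 2 R ε`, which must stay below the modulus `r`.
  refine ⟨r / (2 * R), by positivity, fun ε hε0 hε hε2 z hz => ?_⟩
  have hA : Measurable fun x : Eucl N => (1 - ε) • x + ε • z := by fun_prop
  have hwm := hwcont.measurable
  have hpt : ∀ x, ‖u ((1 - ε) • x + ε • z) - u x‖ₑ ≤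
      (‖u ((1 - ε) • x + ε • z) - w ((1 - ε) • x + ε • z)‖ₑ + ‖u x - w x‖ₑ) +
        ‖w ((1 - ε) • x + ε • z) - w x‖ₑ := by
    intro x
    have e1 : u ((1 - ε) • x + ε • z) - u x =
        (u ((1 - ε) • x + ε • z) - w ((1 - ε) • x + ε • z)) - (u x - w x) +
          (w ((1 - ε) • x + ε • z) - w x) := by ring
    rw [e1]
    refine (enorm_add_le _ _).trans ?_
    gcongr
    exact enorm_sub_le
  have hbd : ∫⁻ x, ‖w ((1 - ε) • x + ε • z) - w x‖ₑ ∂(wMeasure Ω φ) ≤ δ / 2 := by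
    refine le_trans ?_ hη
    rw [← lintegral_const]
    refine lintegral_mono_ae (h.ae_mem.mono fun x hx => ?_)
    rw [Real.enorm_eq_ofReal_abs]
    refine ENNReal.ofReal_le_ofReal ?_
    have e1 : dist ((1 - ε) • x + ε • z) x < r := by
      have e2 : (1 - ε) • x + ε • z - x = ε • (z - x) := by module
      have hx' : ‖x‖ < R := by simpa using hR hx
      have hz' : ‖z‖ < R := by simpa using hR hz
      rw [dist_eq_norm, e2, norm_smul, Real.norm_of_nonneg hε0.le]
      have : ‖z - x‖ ≤ 2 * R := (norm_sub_le _ _).trans (by linarith)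
      rw [lt_div_iff₀ (by positivity)] at hε
      calc ε * ‖z - x‖ ≤ ε * (2 * R) := by gcongr
        _ < r := hε
    exact (hr e1).le
  calc ∫⁻ x, ‖u ((1 - ε) • x + ε • z) - u x‖ₑ ∂(wMeasure Ω φ)
      ≤ ∫⁻ x, ((‖u ((1 - ε) • x + ε • z) - w ((1 - ε) • x + ε • z)‖ₑ + ‖u x - w x‖ₑ) +
        ‖w ((1 - ε) • x + ε • z) - w x‖ₑ) ∂(wMeasure Ω φ) := lintegral_mono hpt
    _ = (∫⁻ x, ‖u ((1 - ε) • x + ε • z) - w ((1 - ε) • x + ε • z)‖ₑ ∂(wMeasure Ω φ) +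
          ∫⁻ x, ‖u x - w x‖ₑ ∂(wMeasure Ω φ)) +
        ∫⁻ x, ‖w ((1 - ε) • x + ε • z) - w x‖ₑ ∂(wMeasure Ω φ) := by
        rw [lintegral_add_left (by fun_prop), lintegral_add_left (by fun_prop)]
    _ ≤ (c * δ₁ + δ₁) + δ / 2 := by
        gcongr
        refine (h.lintegral_dilation_le hz hε0.le (by linarith)
          (f := fun y => ‖u y - w y‖ₑ) (by fun_prop)).trans ?_
        gcongr
        exact hmono ε hε0 hε2
    _ ≤ δ / 2 + δ / 2 := by
        gcongr
        calc c * δ₁ + δ₁ = δ / 2 / (c + 1) * (c + 1) := by rw [← hδ₁]; ring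
          _ ≤ δ / 2 := by rw [mul_comm]; exact ENNReal.mul_div_le
    _ = δ := ENNReal.add_halves δ

/-- The variation of a weighted Sobolev function is at most the norm of its weak gradient. -/
theorem variation_le_of_memSobolev (h : ConcaveWeight m Ω φ) {u : Eucl N → ℝ}
    {G : Eucl N → Eucl N} (hu : MemSobolev Ω φ u G) : variation Ω φ u ≤ wNorm Ω φ G := by
  have := h.isFiniteMeasure
  obtain ⟨ρ, hρ⟩ := h.exists_isKernel
  obtain ⟨u', hu'm, hu'⟩ := hu.integrable.1.aemeasurable
  obtain ⟨G', hG'm, hG'⟩ := hu.integrable_grad.1.aemeasurable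
  have hu'i : Integrable u' (wMeasure Ω φ) := hu.integrable.congr hu'
  have hn : wNorm Ω φ G = wNorm Ω φ G' :=
    lintegral_congr_ae (hG'.mono fun x hx => by simp only [hx])
  have hw : ∀ ψ : Eucl N → ℝ, ContDiff ℝ ∞ ψ → HasCompactSupport ψ → tsupport ψ ⊆ Ω →
      ∀ v : Eucl N, ∫ x in Ω, u' x * fderiv ℝ ψ x v = - ∫ x in Ω, inner ℝ (G' x) v * ψ x := by
    intro ψ h1 h2 h3 v
    have e1 : ∫ x in Ω, u' x * fderiv ℝ ψ x v = ∫ x in Ω, u x * fderiv ℝ ψ x v :=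
      integral_congr_ae ((h.ae_wMeasure_iff.1 hu').mono fun x hx => by simp only [hx])
    have e2 : ∫ x in Ω, inner ℝ (G' x) v * ψ x = ∫ x in Ω, inner ℝ (G x) v * ψ x :=
      integral_congr_ae ((h.ae_wMeasure_iff.1 hG').mono fun x hx => by simp only [hx])
    rw [e1, e2]
    exact hu.hasWeakGradient.integral_eq ψ h1 h2 h3 v
  rw [variation_congr hu', hn]
  let ε : ℕ → ℝ := fun n => 1 / ((n : ℝ) + 3)
  have hε0 : ∀ n, 0 < ε n := fun n => by positivity
  have hε2 : ∀ n, ε n < 1 / 2 := fun n => by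
    refine one_div_lt_one_div_of_lt (by norm_num) ?_
    have : (0 : ℝ) ≤ n := n.cast_nonneg
    linarith
  have hεlim : Tendsto ε atTop (𝓝 0) := by
    have h1 : Tendsto (fun n : ℕ => (n : ℝ) + 3) atTop atTop :=
      tendsto_atTop_add_const_right _ _ tendsto_natCast_atTop_atTop
    exact (tendsto_const_nhds (x := (1 : ℝ))).div_atTop h1
  let K : ℕ → Set (Eucl N) := fun n => smoothingSet Ω ρ (ε n)
  have hKi : ∀ n, Integrable ((K n).indicator u') := fun n => by
    obtain ⟨c, hc⟩ := h.integrable_indicator_of_isCompact (h.isCompact_smoothingSet hρ (ε n))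
      (h.smoothingSet_subset hρ (hε0 n) (by linarith [hε2 n]))
    exact (hc u' hu'i).1
  let v : ℕ → Eucl N → ℝ := fun n => smoothing ρ (ε n) ((K n).indicator u')
  have hv : ∀ n, ContDiff ℝ ∞ (v n) := fun n => by
    obtain ⟨C, hC⟩ := hρ.smoothing_regular (hε0 n)
    exact (hC _ (hKi n)).1
  -- Each `v n` is smooth on the whole space, so the divergence equation applies to it. The factor
  -- tends to 1, and lower semicontinuity passes the bound to `u'`.
  have hVn : ∀ n, variation Ω φ (v n) ≤ dilationFactor m N (ε n) * wNorm Ω φ G' := by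
    intro n
    refine (h.variation_le_of_contDiff (hv n)).trans ?_
    refine le_trans ?_ (h.lintegral_kernel_le hρ (hε0 n).le (by linarith [hε2 n]) hG'm.enorm)
    refine lintegral_mono_ae (h.ae_mem.mono fun x hx => ?_)
    exact h.enorm_fderiv_smoothing_le hρ (hε0 n) (by linarith [hε2 n]) hG'm (hKi n) hw hx
  have hlim : Tendsto (fun n => ∫⁻ x, ‖v n x - u' x‖ₑ ∂(wMeasure Ω φ)) atTop (𝓝 0) := by
    refine ENNReal.tendsto_nhds_zero.2 fun δ hδ => ?_
    obtain ⟨ε₀, hε₀, hclose⟩ := h.exists_dilation_close hu'm hu'i hδ.ne'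
    filter_upwards [hεlim.eventually (gt_mem_nhds hε₀)] with n hn
    have e1 : ∫⁻ x, ‖v n x - u' x‖ₑ ∂(wMeasure Ω φ) =
        ∫⁻ x, ‖smoothing ρ (ε n) u' x - u' x‖ₑ ∂(wMeasure Ω φ) :=
      lintegral_congr_ae (h.ae_mem.mono fun x hx => by
        simp only [v, K, smoothing_indicator ρ (ε n) u' hx])
    rw [e1]
    exact h.lintegral_smoothing_sub_le hρ hu'm (hclose (ε n) (hε0 n) hn (hε2 n))
  refine (variation_le_liminf hu'i (fun n => h.integrable_of_continuous (hv n).continuous)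
    hlim).trans ?_
  refine (liminf_le_liminf (Eventually.of_forall hVn)).trans ?_
  have hfac : Tendsto (fun n => dilationFactor m N (ε n)) atTop (𝓝 1) := by
    have h1 : Tendsto (fun n => ((1 - ε n) ^ (m + N))⁻¹) atTop (𝓝 (((1 - 0) ^ (m + N))⁻¹)) :=
      ((tendsto_const_nhds.sub hεlim).pow _).inv₀ (by simp)
    have h2 := (ENNReal.continuous_ofReal.tendsto _).comp h1
    simpa [Function.comp_def, dilationFactor] using h2
  have hprod := ENNReal.Tendsto.mul_const (b := wNorm Ω φ G') hfac (Or.inl one_ne_zero)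
  rw [one_mul] at hprod
  exact hprod.liminf_eq.le

end ConcaveWeight

/-! ### Compactness -/

/-- A finite uniform net for an equibounded and equi-Lipschitz family on a compact space. -/
lemma exists_finite_uniform_net {X ι : Type*} [PseudoMetricSpace X] [CompactSpace X] {S : Set ι}
    {f : ι → X → ℝ} {M : ℝ} {L : ℝ≥0} (hb : ∀ i ∈ S, ∀ x, |f i x| ≤ M)
    (hl : ∀ i ∈ S, ∀ x y, |f i x - f i y| ≤ L * dist x y) {η : ℝ} (hη : 0 < η) :
    ∃ t ⊆ S, t.Finite ∧ ∀ i ∈ S, ∃ j ∈ t, ∀ x, |f i x - f j x| ≤ η := by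
  rcases S.eq_empty_or_nonempty with rfl | ⟨i₀, -⟩
  · exact ⟨∅, subset_rfl, finite_empty, by simp⟩
  have : Nonempty ι := ⟨i₀⟩
  have hcont : ∀ i ∈ S, Continuous (f i) := fun i hi =>
    (LipschitzWith.of_dist_le_mul (K := L) fun x y => hl i hi x y).continuous
  let A : Set (BoundedContinuousFunction X ℝ) := {F | ∃ i ∈ S, ∀ x, F x = f i x}
  have hA : IsCompact (closure A) := by
    refine BoundedContinuousFunction.arzela_ascoli (Icc (-M) M) isCompact_Icc A ?_ ?_
    · rintro F x ⟨i, hi, hF⟩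
      rw [hF]
      exact abs_le.1 (hb i hi x)
    · refine Metric.equicontinuous_of_continuity_modulus (fun d => L * d) ?_ _ ?_
      · have : Tendsto (fun d : ℝ => (L : ℝ) * d) (𝓝 0) (𝓝 (L * 0)) := tendsto_id.const_mul _
        simpa using this
      · rintro x y ⟨F, i, hi, hF⟩
        simp only [hF]
        exact hl i hi x y
  obtain ⟨t, htA, htf, ht⟩ := Metric.finite_approx_of_totallyBounded
    (hA.totallyBounded.subset subset_closure) η hη
  choose! idx hidx hidx' using fun F (hF : F ∈ A) => hF
  refine ⟨idx '' t, ?_, htf.image idx, fun i hi => ?_⟩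
  · rintro _ ⟨F, hF, rfl⟩
    exact hidx F (htA hF)
  · have hmem : BoundedContinuousFunction.mkOfCompact ⟨f i, hcont i hi⟩ ∈ A :=
      ⟨i, hi, fun x => rfl⟩
    obtain ⟨F, hF, hd⟩ := mem_iUnion₂.1 (ht hmem)
    refine ⟨idx F, mem_image_of_mem idx hF, fun x => ?_⟩
    have h1 := (BoundedContinuousFunction.dist_coe_le_dist x).trans (le_of_lt hd)
    rw [hidx' F (htA hF) x] at h1
    exact h1

/-! ### Precompactness of bounded sets. -/

namespace ConcaveWeight

/-- Integrate the derivative along the segment from `x` to its image; every intermediate point is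
itself a dilate of `x` with ratio at most `1/2`, so the dilation bound controls each slice. -/
lemma lintegral_dilation_sub_le (h : ConcaveWeight m Ω φ) {R : ℝ} (hR : Ω ⊆ Metric.ball 0 R)
    {ψ : Eucl N → ℝ} (hψ : ContDiff ℝ ∞ ψ) (hε : 0 < ε) (hε2 : ε < 1 / 2) {z : Eucl N}
    (hz : z ∈ Ω) :
    ∫⁻ x, ‖ψ ((1 - ε) • x + ε • z) - ψ x‖ₑ ∂(wMeasure Ω φ) ≤
      ENNReal.ofReal ε * (ENNReal.ofReal (2 * R) *
        (dilationFactor m N (1 / 2) * wNorm Ω φ (fderiv ℝ ψ))) := by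
  have := h.isFiniteMeasure
  have hfc : Continuous (fderiv ℝ ψ) := hψ.continuous_fderiv (by simp)
  have hfm : Measurable fun y => ‖fderiv ℝ ψ y‖ₑ := hfc.enorm.measurable
  have hpt : ∀ x ∈ Ω, ‖ψ ((1 - ε) • x + ε • z) - ψ x‖ₑ ≤ ENNReal.ofReal (ε * (2 * R)) *
      ∫⁻ t in Ioc (0 : ℝ) 1, ‖fderiv ℝ ψ ((1 - ε * t) • x + (ε * t) • z)‖ₑ := by
    intro x hx
    have hder : ∀ t : ℝ, HasDerivAt (fun t : ℝ => ψ ((1 - ε * t) • x + (ε * t) • z))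
        (fderiv ℝ ψ ((1 - ε * t) • x + (ε * t) • z) (ε • (z - x))) t := by
      intro t
      have h1 : HasDerivAt (fun t : ℝ => ε * t) ε t := by
        simpa using (hasDerivAt_id t).const_mul ε
      have h2 : HasDerivAt (fun t : ℝ => (1 - ε * t) • x + (ε * t) • z) (ε • (z - x)) t := by
        have := ((h1.const_sub 1).smul_const x).add (h1.smul_const z)
        have e : ε • (z - x) = (-ε) • x + ε • z := by module
        rw [e]
        exact this
      exact (hψ.differentiable (by simp) _).hasFDerivAt.comp_hasDerivAt t h2
    have hcont : Continuous fun t : ℝ =>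
        fderiv ℝ ψ ((1 - ε * t) • x + (ε * t) • z) (ε • (z - x)) :=
      (hfc.comp (by fun_prop)).clm_apply continuous_const
    have h1 := intervalIntegral.integral_eq_sub_of_hasDerivAt (a := 0) (b := 1)
      (fun t _ => hder t) (hcont.intervalIntegrable _ _)
    simp only [mul_one, mul_zero, sub_zero, one_smul, zero_smul, add_zero] at h1
    rw [← h1, intervalIntegral.integral_of_le zero_le_one]
    refine (enorm_integral_le_lintegral_enorm _).trans ?_
    rw [← lintegral_const_mul _ (by fun_prop)]
    refine lintegral_mono fun t => ?_
    refine (ContinuousLinearMap.le_opENorm _ _).trans ?_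
    rw [mul_comm]
    gcongr
    rw [← ofReal_norm, norm_smul, Real.norm_of_nonneg hε.le]
    have hx' : ‖x‖ < R := by simpa using hR hx
    have hz' : ‖z‖ < R := by simpa using hR hz
    have : ‖z - x‖ ≤ 2 * R := (norm_sub_le _ _).trans (by linarith)
    gcongr
  calc ∫⁻ x, ‖ψ ((1 - ε) • x + ε • z) - ψ x‖ₑ ∂(wMeasure Ω φ)
      ≤ ∫⁻ x, ENNReal.ofReal (ε * (2 * R)) * (∫⁻ t in Ioc (0 : ℝ) 1,
          ‖fderiv ℝ ψ ((1 - ε * t) • x + (ε * t) • z)‖ₑ) ∂(wMeasure Ω φ) :=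
        lintegral_mono_ae (h.ae_mem.mono hpt)
    _ = ENNReal.ofReal (ε * (2 * R)) * ∫⁻ x, (∫⁻ t in Ioc (0 : ℝ) 1,
          ‖fderiv ℝ ψ ((1 - ε * t) • x + (ε * t) • z)‖ₑ) ∂(wMeasure Ω φ) :=
        lintegral_const_mul' _ _ ENNReal.ofReal_ne_top
    _ = ENNReal.ofReal (ε * (2 * R)) * ∫⁻ t in Ioc (0 : ℝ) 1, (∫⁻ x,
          ‖fderiv ℝ ψ ((1 - ε * t) • x + (ε * t) • z)‖ₑ ∂(wMeasure Ω φ)) := by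
        congr 1
        refine lintegral_lintegral_swap (Measurable.aemeasurable ?_)
        unfold Function.uncurry
        fun_prop
    _ ≤ ENNReal.ofReal (ε * (2 * R)) * ∫⁻ _ in Ioc (0 : ℝ) 1,
          (dilationFactor m N (1 / 2) * wNorm Ω φ (fderiv ℝ ψ)) := by
        refine mul_le_mul_right ?_ _
        refine setLIntegral_mono measurable_const fun t ht => ?_
        have ht0 : 0 ≤ ε * t := mul_nonneg hε.le ht.1.le
        have ht1 : ε * t ≤ 1 / 2 := by nlinarith [ht.1, ht.2]
        refine (h.lintegral_dilation_le hz ht0 (by linarith) hfm).trans ?_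
        gcongr ?_ * ?_
        · refine ENNReal.ofReal_le_ofReal (inv_anti₀ (by positivity) ?_)
          exact pow_le_pow_left₀ (by norm_num) (by linarith) _
        · exact le_rfl
    _ = _ := by
        rw [setLIntegral_const, Real.volume_Ioc, sub_zero, ENNReal.ofReal_one, mul_one,
          ENNReal.ofReal_mul hε.le, mul_assoc]

/-- The classes in `L¹` of smooth functions with bounded weighted norm and bounded gradient. -/
def smoothBall (h : ConcaveWeight m Ω φ) (M : ℝ≥0∞) : Set (Lp ℝ 1 (wMeasure Ω φ)) :=
  {f | ∃ (ψ : Eucl N → ℝ) (hψ : ContDiff ℝ ∞ ψ), wNorm Ω φ ψ ≤ M ∧ wNorm Ω φ (fderiv ℝ ψ) ≤ M ∧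
    f = (h.integrable_of_continuous hψ.continuous).toL1 ψ}

/-- A Kolmogorov-type argument. A small `ε` moves every function of the ball by at most `δ / 4`
under smoothing. For that fixed `ε` the smoothings are equibounded and equi-Lipschitz on the closure
of `Ω`, so Arzelà–Ascoli gives a finite uniform net; two smoothing errors and one net error stay
below `δ`. -/
lemma totallyBounded_smoothBall (h : ConcaveWeight m Ω φ) {M : ℝ≥0∞} (hM : M ≠ ⊤) :
    TotallyBounded (h.smoothBall M) := by
  have := h.isFiniteMeasure
  obtain ⟨ρ, hρ⟩ := h.exists_isKernel
  obtain ⟨R, hR0, hR⟩ := h.isBounded.subset_ball_lt 0 (0 : Eucl N)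
  refine Metric.totallyBounded_iff.2 fun δ hδ => ?_
  have hδ4 : ENNReal.ofReal (δ / 4) ≠ 0 := by simpa using hδ
  -- the smoothing parameter
  obtain ⟨ε₀, hε₀, hε₀'⟩ := exists_pos_ofReal_mul_le
    (a := ENNReal.ofReal (2 * R) * (dilationFactor m N (1 / 2) * M))
    (ENNReal.mul_ne_top ENNReal.ofReal_ne_top (ENNReal.mul_ne_top ENNReal.ofReal_ne_top hM)) hδ4
  set ε : ℝ := min ε₀ (1 / 4) with hεdef
  have hε : 0 < ε := lt_min hε₀ (by norm_num)
  have hε2 : ε < 1 / 2 := (min_le_right _ _).trans_lt (by norm_num)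
  have hKc := h.isCompact_smoothingSet hρ ε
  have hKΩ := h.smoothingSet_subset hρ hε (by linarith)
  set K := smoothingSet Ω ρ ε with hK
  have hsmooth : ∀ ψ : Eucl N → ℝ, ContDiff ℝ ∞ ψ → wNorm Ω φ (fderiv ℝ ψ) ≤ M →
      ∫⁻ x, ‖smoothing ρ ε (K.indicator ψ) x - ψ x‖ₑ ∂(wMeasure Ω φ) ≤
        ENNReal.ofReal (δ / 4) := by
    intro ψ hψ hn
    have e1 : ∫⁻ x, ‖smoothing ρ ε (K.indicator ψ) x - ψ x‖ₑ ∂(wMeasure Ω φ) =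
        ∫⁻ x, ‖smoothing ρ ε ψ x - ψ x‖ₑ ∂(wMeasure Ω φ) :=
      lintegral_congr_ae (h.ae_mem.mono fun x hx => by
        simp only [hK, smoothing_indicator ρ ε ψ hx])
    rw [e1]
    refine h.lintegral_smoothing_sub_le hρ hψ.continuous.measurable fun z hz => ?_
    refine (h.lintegral_dilation_sub_le hR hψ hε hε2 hz).trans (le_trans ?_ hε₀')
    gcongr
    exact min_le_left _ _
  -- the finite net
  obtain ⟨c, hc⟩ := h.integrable_indicator_of_isCompact hKc hKΩ
  obtain ⟨C, hC⟩ := hρ.smoothing_regular hε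
  obtain ⟨η, hη, hη'⟩ := exists_pos_ofReal_mul_le (measure_ne_top (wMeasure Ω φ) univ) hδ4
  let S : Set (Eucl N → ℝ) := {ψ | ContDiff ℝ ∞ ψ ∧ wNorm Ω φ ψ ≤ M ∧ wNorm Ω φ (fderiv ℝ ψ) ≤ M}
  set B : ℝ := |C| * (c * M.toReal) with hB
  have hB0 : 0 ≤ B := by positivity
  have hSint : ∀ ψ ∈ S, C * ∫ t, |K.indicator ψ t| ≤ B := by
    rintro ψ ⟨hψ, hn, -⟩
    have hi := h.integrable_of_continuous hψ.continuous
    have h1 := (hc ψ hi).2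
    have h2 : ∫ t, |ψ t| ∂(wMeasure Ω φ) ≤ M.toReal := by
      have := integral_norm_eq_lintegral_enorm hi.1
      simp only [Real.norm_eq_abs] at this
      rw [this]
      exact ENNReal.toReal_mono hM hn
    calc C * ∫ t, |K.indicator ψ t| ≤ |C| * ∫ t, |K.indicator ψ t| :=
          mul_le_mul_of_nonneg_right (le_abs_self C) (integral_nonneg fun t => abs_nonneg _)
      _ ≤ B := by rw [hB]; gcongr; exact h1.trans (by gcongr)
  have hSK : ∀ ψ ∈ S, Integrable (K.indicator ψ) := fun ψ hψ =>
    (hc ψ (h.integrable_of_continuous hψ.1.continuous)).1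
  have : CompactSpace (closure Ω) := isCompact_iff_compactSpace.1 h.isBounded.isCompact_closure
  obtain ⟨t, htS, htf, ht⟩ := exists_finite_uniform_net (X := closure Ω) (S := S)
    (f := fun ψ x => smoothing ρ ε (K.indicator ψ) x) (M := B) (L := B.toNNReal)
    (fun ψ hψ x => ((hC _ (hSK ψ hψ)).2.1 x).trans (hSint ψ hψ))
    (fun ψ hψ x y => by
      refine ((hC _ (hSK ψ hψ)).2.2 x y).trans ?_
      rw [Real.coe_toNNReal _ hB0, Subtype.dist_eq, dist_eq_norm]
      gcongr
      exact hSint ψ hψ) hη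
  classical
  -- The value 0 off the smooth functions is never reached, as the net consists of elements of `S`.
  let cls : (Eucl N → ℝ) → Lp ℝ 1 (wMeasure Ω φ) := fun ψ =>
    if hψ : ContDiff ℝ ∞ ψ then (h.integrable_of_continuous hψ.continuous).toL1 ψ else 0
  refine ⟨cls '' t, htf.image cls, ?_⟩
  rintro _ ⟨ψ, hψ, hn1, hn2, rfl⟩
  obtain ⟨χ, hχt, hχ⟩ := ht ψ ⟨hψ, hn1, hn2⟩
  obtain ⟨hχc, hχ1, hχ2⟩ := htS hχt
  refine mem_iUnion₂.2 ⟨cls χ, mem_image_of_mem cls hχt, ?_⟩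
  have hcls : cls χ = (h.integrable_of_continuous hχc.continuous).toL1 χ := dif_pos hχc
  rw [hcls, Metric.mem_ball, ← edist_lt_ofReal, Integrable.edist_toL1_toL1]
  set s₁ := smoothing ρ ε (K.indicator ψ) with hs₁
  set s₂ := smoothing ρ ε (K.indicator χ) with hs₂
  have m1 : Measurable s₁ := (hC _ (hSK ψ ⟨hψ, hn1, hn2⟩)).1.continuous.measurable
  have m2 : Measurable s₂ := (hC _ (hSK χ ⟨hχc, hχ1, hχ2⟩)).1.continuous.measurable
  have m3 : Measurable ψ := hψ.continuous.measurable
  have m4 : Measurable χ := hχc.continuous.measurable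
  calc ∫⁻ x, edist (ψ x) (χ x) ∂(wMeasure Ω φ)
      ≤ ∫⁻ x, ((‖s₁ x - ψ x‖ₑ + ‖s₂ x - χ x‖ₑ) + ‖s₁ x - s₂ x‖ₑ) ∂(wMeasure Ω φ) := by
        refine lintegral_mono fun x => ?_
        rw [edist_eq_enorm_sub]
        have e1 : ψ x - χ x = -(s₁ x - ψ x) + (s₂ x - χ x) + (s₁ x - s₂ x) := by ring
        rw [e1]
        refine (enorm_add_le _ _).trans (add_le_add_left ((enorm_add_le _ _).trans ?_) _)
        rw [enorm_neg]
    _ = (∫⁻ x, ‖s₁ x - ψ x‖ₑ ∂(wMeasure Ω φ) + ∫⁻ x, ‖s₂ x - χ x‖ₑ ∂(wMeasure Ω φ)) +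
          ∫⁻ x, ‖s₁ x - s₂ x‖ₑ ∂(wMeasure Ω φ) := by
        rw [lintegral_add_left (by fun_prop), lintegral_add_left (by fun_prop)]
    _ ≤ (ENNReal.ofReal (δ / 4) + ENNReal.ofReal (δ / 4)) + ENNReal.ofReal (δ / 4) := by
        gcongr
        · exact hsmooth ψ hψ hn2
        · exact hsmooth χ hχc hχ2
        · refine le_trans ?_ hη'
          rw [← lintegral_const]
          refine lintegral_mono_ae (h.ae_mem.mono fun x hx => ?_)
          rw [Real.enorm_eq_ofReal_abs]
          exact ENNReal.ofReal_le_ofReal (hχ ⟨x, subset_closure hx⟩)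
    _ < ENNReal.ofReal δ := by
        rw [← ENNReal.ofReal_add (by positivity) (by positivity),
          ← ENNReal.ofReal_add (by positivity) (by positivity),
          ENNReal.ofReal_lt_ofReal_iff hδ]
        linarith

/-- Functions with bounded weighted norm and variation are relatively compact in `L¹`. -/
theorem exists_subseq_tendsto (h : ConcaveWeight m Ω φ) {u : ℕ → Eucl N → ℝ} {M : ℝ≥0∞}
    (hM : M ≠ ⊤) (hu : ∀ n, Integrable (u n) (wMeasure Ω φ)) (hn : ∀ n, wNorm Ω φ (u n) ≤ M)
    (hV : ∀ n, variation Ω φ (u n) ≤ M) :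
    ∃ v : Eucl N → ℝ, Integrable v (wMeasure Ω φ) ∧ ∃ θ : ℕ → ℕ, StrictMono θ ∧
      Tendsto (fun n => ∫⁻ x, ‖u (θ n) x - v x‖ₑ ∂(wMeasure Ω φ)) atTop (𝓝 0) := by
  have := h.isFiniteMeasure
  -- The extra unit absorbs the approximation error in the norm and makes the gradient bound
  -- positive even when `M = 0`.
  have hM1 : M + 1 ≠ ⊤ := by simp [hM]
  have hcomp : IsCompact (closure (h.smoothBall (M + 1))) :=
    (h.totallyBounded_smoothBall hM1).closure.isCompact_of_isClosed isClosed_closure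
  have hmem : ∀ n, (hu n).toL1 (u n) ∈ closure (h.smoothBall (M + 1)) := by
    intro n
    refine EMetric.mem_closure_iff.2 fun δ hδ => ?_
    have hc : (0 : ℝ) < (M + 1).toReal := ENNReal.toReal_pos (by simp) hM1
    have hce : ENNReal.ofReal (M + 1).toReal = M + 1 := ENNReal.ofReal_toReal hM1
    obtain ⟨ψ, hψ, -, hψn, hψd⟩ := h.exists_testFunction_approx (hu n) hc
      (by rw [hce]; exact (hV n).trans le_self_add) (δ := min δ 1)
      (lt_min hδ zero_lt_one).ne'
    refine ⟨_, ⟨ψ, hψ, ?_, by rwa [hce] at hψn, rfl⟩, ?_⟩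
    · calc wNorm Ω φ ψ ≤ ∫⁻ x, (‖ψ x - u n x‖ₑ + ‖u n x‖ₑ) ∂(wMeasure Ω φ) := by
            refine lintegral_mono fun x => ?_
            have : ψ x = (ψ x - u n x) + u n x := by ring
            nth_rewrite 1 [this]
            exact enorm_add_le _ _
        _ = ∫⁻ x, ‖ψ x - u n x‖ₑ ∂(wMeasure Ω φ) + wNorm Ω φ (u n) :=
            lintegral_add_right' _ (hu n).1.enorm
        _ ≤ 1 + M := add_le_add (hψd.le.trans (min_le_right _ _)) (hn n)
        _ = M + 1 := add_comm _ _
    · rw [edist_comm, Integrable.edist_toL1_toL1]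
      simp only [edist_eq_enorm_sub]
      exact hψd.trans_le (min_le_left _ _)
  obtain ⟨f, -, θ, hθ, hlim⟩ := hcomp.tendsto_subseq hmem
  refine ⟨f, L1.integrable_coeFn f, θ, hθ, ?_⟩
  rw [tendsto_iff_edist_tendsto_0] at hlim
  refine hlim.congr fun n => ?_
  have h2 := Integrable.edist_toL1_toL1 (u (θ n)) f (hu (θ n)) (L1.integrable_coeFn f)
  rw [Integrable.toL1_coeFn] at h2
  simpa [edist_eq_enorm_sub] using h2

end ConcaveWeight

/-! ### Coarea inequality -/

/-- A smooth step at `t` whose slope is close to the optimal one. -/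
lemma exists_smooth_step (t : ℝ) {r : ℝ} (hr : 0 < r) (hr1 : r < 1) :
    ∃ η : ℝ → ℝ, ContDiff ℝ ∞ η ∧ (∀ s, |η s| ≤ 1) ∧ (∀ s ≤ t - r, η s = 0) ∧
      (∀ s, t + r ≤ s → η s = 1) ∧
      ∀ s, ‖deriv η s‖ₑ ≤ (Metric.closedBall t r).indicator
        (fun _ => ENNReal.ofReal (2 * r * (1 - r))⁻¹) s := by
  -- The density of a bump equal to 1 on radius `r (1 - r)` is at most the inverse length `1 / (2 r
  -- (1 - r))`; its primitive is the step.
  let b : ContDiffBump t := ⟨r * (1 - r), r, by nlinarith, by nlinarith⟩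
  set k : ℝ → ℝ := b.normed volume with hk
  have hkc : Continuous k := b.continuous_normed
  have hki : Integrable k := b.integrable_normed
  have hk0 : ∀ s, 0 ≤ k s := b.nonneg_normed
  have hk1 : ∫ s, k s = 1 := b.integral_normed
  have hsupp : ∀ s, s ∉ Metric.ball t r → k s = 0 := by
    intro s hs
    have h1 : Function.support k = Metric.ball t r := b.support_normed_eq
    rw [← h1] at hs
    exact Function.notMem_support.1 hs
  let η : ℝ → ℝ := fun s => ∫ y in (t - r)..s, k y
  have hder : ∀ s, HasDerivAt η (k s) s := fun s =>
    intervalIntegral.integral_hasDerivAt_right (hkc.intervalIntegrable _ _)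
      (hkc.stronglyMeasurableAtFilter _ _) hkc.continuousAt
  have hderiv : deriv η = k := funext fun s => (hder s).deriv
  have hzero : ∀ s ≤ t - r, η s = 0 := by
    intro s hs
    have : ∀ y ∈ uIcc (t - r) s, k y = 0 := fun y hy => by
      refine hsupp y fun hy' => ?_
      rw [uIcc_of_ge hs] at hy
      rw [Real.ball_eq_Ioo] at hy'
      exact absurd hy'.1 (not_lt.2 hy.2)
    simp only [η]
    rw [intervalIntegral.integral_congr (g := fun _ => (0 : ℝ)) this]
    simp
  have hone : ∀ s, t + r ≤ s → η s = 1 := by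
    intro s hs
    simp only [η]
    rw [intervalIntegral.integral_of_le (by linarith), ← hk1]
    refine setIntegral_eq_integral_of_forall_compl_eq_zero fun y hy => hsupp y fun hy' => hy ?_
    rw [Real.ball_eq_Ioo] at hy'
    exact ⟨hy'.1, by linarith [hy'.2]⟩
  have hmono : Monotone η := monotone_of_deriv_nonneg (fun s => (hder s).differentiableAt)
    (fun s => by rw [hderiv]; exact hk0 s)
  refine ⟨η, ?_, ?_, hzero, hone, ?_⟩
  · refine contDiff_infty_iff_deriv.2 ⟨fun s => (hder s).differentiableAt, ?_⟩
    rw [hderiv]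
    exact b.contDiff_normed
  · intro s
    have h1 : 0 ≤ η s := by
      have := hmono (min_le_left s (t - r))
      rwa [hzero _ (min_le_right _ _)] at this
    have h2 : η s ≤ 1 := by
      have := hmono (le_max_left s (t + r))
      rwa [hone _ (le_max_right _ _)] at this
    rw [abs_of_nonneg h1]
    exact h2
  · intro s
    rw [hderiv]
    by_cases hs : s ∈ Metric.closedBall t r
    · rw [indicator_of_mem hs, Real.enorm_of_nonneg (hk0 s)]
      refine ENNReal.ofReal_le_ofReal ?_
      have h1 := b.normed_le_div_measure_closedBall_rIn volume s
      have h2 : volume.real (Metric.closedBall t b.rIn) = 2 * r * (1 - r) := by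
        rw [Real.volume_real_closedBall (by simp only [b]; nlinarith)]
        simp only [b]; ring
      rw [h2, one_div] at h1
      exact h1
    · rw [indicator_of_notMem hs, hsupp s fun h => hs (Metric.ball_subset_closedBall h)]
      simp

/-- Layer cake formula for the difference of two functions. -/
lemma lintegral_enorm_indicator_sub (a b : ℝ) :
    ∫⁻ t, ‖(Iio a).indicator (fun _ => (1 : ℝ)) t - (Iio b).indicator (fun _ => (1 : ℝ)) t‖ₑ =
      ‖a - b‖ₑ := by
  wlog hab : b ≤ a generalizing a b
  · have h1 := this b a (le_of_not_ge hab)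
    rw [← enorm_neg, neg_sub, ← h1]
    refine lintegral_congr fun t => ?_
    rw [← enorm_neg, neg_sub]
  have h1 : ∀ t, ‖(Iio a).indicator (fun _ => (1 : ℝ)) t - (Iio b).indicator (fun _ => (1 : ℝ)) t‖ₑ
      = (Ico b a).indicator 1 t := by
    intro t
    by_cases h1 : t < b
    · have h2 : t < a := h1.trans_le hab
      simp [h1, h2]
    · by_cases h2 : t < a
      · simp [h1, h2, not_lt.1 h1]
      · simp [h1, h2]
  simp only [h1]
  rw [lintegral_indicator_one measurableSet_Ico, Real.volume_Ico,
    Real.enorm_of_nonneg (sub_nonneg.2 hab)]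

/-! ### Layer cake formulas. -/

section LayerCake

variable {α : Type*} [MeasurableSpace α] {μ : Measure α}

lemma measurable_indicator_levelSet {u : α → ℝ} (hu : Measurable u) :
    Measurable fun p : ℝ × α => (Iio (u p.2)).indicator (fun _ => (1 : ℝ)) p.1 := by
  have h1 : MeasurableSet {p : ℝ × α | p.1 < u p.2} :=
    measurableSet_lt measurable_fst (hu.comp measurable_snd)
  exact (measurable_const (a := (1 : ℝ))).indicator h1

/-- `L¹` convergence of functions thereby controls `L¹` convergence of their level sets, on average
in `t`. -/
lemma lintegral_levelSet_sub [SFinite μ] {u v : α → ℝ} (hu : Measurable u) (hv : Measurable v) :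
    ∫⁻ t, (∫⁻ x, ‖{x | t < v x}.indicator (fun _ => (1 : ℝ)) x -
      {x | t < u x}.indicator (fun _ => (1 : ℝ)) x‖ₑ ∂μ) = ∫⁻ x, ‖v x - u x‖ₑ ∂μ := by
  have h1 := lintegral_lintegral_swap (μ := (volume : Measure ℝ)) (ν := μ)
    (f := fun t x => ‖(Iio (v x)).indicator (fun _ => (1 : ℝ)) t -
      (Iio (u x)).indicator (fun _ => (1 : ℝ)) t‖ₑ)
    (((measurable_indicator_levelSet hv).sub (measurable_indicator_levelSet hu)).enorm.aemeasurable)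
  simp only [lintegral_enorm_indicator_sub] at h1
  exact h1

lemma ofReal_integral_le_lintegral_ofReal {f : α → ℝ} (hf : Integrable f μ) :
    ENNReal.ofReal (∫ x, f x ∂μ) ≤ ∫⁻ x, ENNReal.ofReal (f x) ∂μ := by
  rw [integral_eq_lintegral_pos_part_sub_lintegral_neg_part hf]
  refine (ENNReal.ofReal_le_ofReal (sub_le_self _ ENNReal.toReal_nonneg)).trans ?_
  exact ENNReal.ofReal_toReal_le

lemma two_mul_lintegral_ofReal_of_integral_eq_zero {u : α → ℝ} (hu : Integrable u μ)
    (h0 : ∫ x, u x ∂μ = 0) : 2 * ∫⁻ x, ENNReal.ofReal (u x) ∂μ = ∫⁻ x, ‖u x‖ₑ ∂μ := by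
  have hfin : ∀ v : α → ℝ, Integrable v μ → ∫⁻ x, ENNReal.ofReal (v x) ∂μ ≠ ⊤ := fun v hv =>
    ((lintegral_mono fun x => Real.ofReal_le_enorm (v x)).trans_lt hv.2).ne
  have h1 : ∫⁻ x, ENNReal.ofReal (u x) ∂μ = ∫⁻ x, ENNReal.ofReal (-u x) ∂μ := by
    rw [integral_eq_lintegral_pos_part_sub_lintegral_neg_part hu, sub_eq_zero] at h0
    exact (ENNReal.toReal_eq_toReal_iff' (hfin u hu) (hfin _ hu.neg)).1 h0
  have h2 : ∀ x, ‖u x‖ₑ = ENNReal.ofReal (u x) + ENNReal.ofReal (-u x) := by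
    intro x
    rcases le_total 0 (u x) with hx | hx
    · rw [Real.enorm_of_nonneg hx, ENNReal.ofReal_of_nonpos (neg_nonpos.2 hx), add_zero]
    · rw [ENNReal.ofReal_of_nonpos hx, zero_add, ← enorm_neg,
        Real.enorm_of_nonneg (neg_nonneg.2 hx)]
  simp only [h2]
  rw [lintegral_add_left' hu.1.aemeasurable.ennreal_ofReal, ← h1, two_mul]

/-- For a function with zero mean, the products of the measures of a superlevel set and of its
complement control the norm. -/
lemma measure_mul_lintegral_le_levelSets [IsFiniteMeasure μ] {u : α → ℝ} (hum : Measurable u)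
    (hu : Integrable u μ) (h0 : ∫ x, u x ∂μ = 0) :
    μ univ * ∫⁻ x, ‖u x‖ₑ ∂μ ≤ ∫⁻ t, 2 * (μ {x | t < u x} * μ {x | t < u x}ᶜ) := by
  -- Slicing `S` at fixed `t` gives the product of the measures; slicing at fixed `(x, y)` gives the
  -- positive part of `u x - u y`.
  let S : Set (ℝ × α × α) := {p | u p.2.2 ≤ p.1 ∧ p.1 < u p.2.1}
  have hS : MeasurableSet S :=
    (measurableSet_le (f := fun p : ℝ × α × α => u p.2.2) (g := fun p => p.1) (by fun_prop)
      (by fun_prop)).inter (measurableSet_lt (f := fun p : ℝ × α × α => p.1)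
        (g := fun p => u p.2.1) (by fun_prop) (by fun_prop))
  have e1 : (volume : Measure ℝ).prod (μ.prod μ) S =
      ∫⁻ t, μ {x | t < u x} * μ {x | t < u x}ᶜ := by
    rw [Measure.prod_apply hS]
    refine lintegral_congr fun t => ?_
    rw [← Measure.prod_prod]
    congr 1
    ext q
    simp [S, and_comm]
  have e2 : (volume : Measure ℝ).prod (μ.prod μ) S =
      ∫⁻ x, (∫⁻ y, ENNReal.ofReal (u x - u y) ∂μ) ∂μ := by
    rw [Measure.prod_apply_symm hS,
      lintegral_prod _ (measurable_measure_prodMk_right hS).aemeasurable]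
    refine lintegral_congr fun x => lintegral_congr fun y => ?_
    rw [← Real.volume_Ico]
    rfl
  have hm : Measurable fun t => μ {x | t < u x} * μ {x | t < u x}ᶜ := by
    have : MeasurableSet {p : ℝ × α | p.1 < u p.2} :=
      measurableSet_lt measurable_fst (hum.comp measurable_snd)
    exact (measurable_measure_prodMk_left this).mul (measurable_measure_prodMk_left this.compl)
  rw [lintegral_const_mul _ hm, ← e1, e2, ← two_mul_lintegral_ofReal_of_integral_eq_zero hu h0,
    mul_left_comm, ← lintegral_const_mul _ hum.ennreal_ofReal]
  gcongr with x
  -- Jensen for the positive part: by the zero mean, averaging `u x - u y` over `y` leaves `u x`.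
  have h1 := ofReal_integral_le_lintegral_ofReal (μ := μ) (f := fun y => u x - u y)
    ((integrable_const _).sub hu)
  rw [integral_sub (integrable_const _) hu, h0, sub_zero, integral_const, smul_eq_mul,
    ENNReal.ofReal_mul measureReal_nonneg, ofReal_measureReal] at h1
  exact h1

end LayerCake

/-! ### Coarea for the weighted perimeter. -/

namespace ConcaveWeight

/-- The coarea inequality for smooth functions. -/
lemma coarea_le_of_contDiff (h : ConcaveWeight m Ω φ) {ψ : Eucl N → ℝ} (hψ : ContDiff ℝ ∞ ψ) :
    ∃ p : ℝ → ℝ≥0∞, Measurable p ∧ (∀ᵐ t, perimeter Ω φ {x | t < ψ x} ≤ p t) ∧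
      ∫⁻ t, p t ≤ wNorm Ω φ (fderiv ℝ ψ) := by
  have := h.isFiniteMeasure
  have hψm : Measurable ψ := hψ.continuous.measurable
  have hfm : Measurable fun x => ‖fderiv ℝ ψ x‖ₑ :=
    (hψ.continuous_fderiv (by simp)).enorm.measurable
  -- The distribution of gradient mass over the values of `ψ`. Its density is `p`, and Besicovitch
  -- differentiation recovers `p t` from the mass of small intervals around `t`.
  set lam : Measure ℝ := Measure.map ψ
    ((wMeasure Ω φ).withDensity fun x => ‖fderiv ℝ ψ x‖ₑ) with hlam
  have hlamuniv : lam univ = wNorm Ω φ (fderiv ℝ ψ) := by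
    rw [hlam, Measure.map_apply hψm MeasurableSet.univ, preimage_univ,
      withDensity_apply _ MeasurableSet.univ, Measure.restrict_univ]
    rfl
  have : IsFiniteMeasure lam := ⟨by rw [hlamuniv]; exact h.wNorm_fderiv_lt_top hψ⟩
  refine ⟨lam.rnDeriv volume, Measure.measurable_rnDeriv _ _, ?_, ?_⟩
  swap
  · rw [← hlamuniv]
    exact Measure.lintegral_rnDeriv_le
  -- Off these countably many `t`, the steps composed with `ψ` converge almost everywhere to the
  -- indicator of `{ψ > t}`.
  have hcount : {t : ℝ | 0 < wMeasure Ω φ {x | ψ x = t}}.Countable :=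
    Measure.countable_meas_level_set_pos hψm
  filter_upwards [Besicovitch.ae_tendsto_rnDeriv lam (volume : Measure ℝ),
    hcount.ae_notMem volume] with t ht htlev
  have htlev0 : wMeasure Ω φ {x | ψ x = t} = 0 := by
    by_contra hne
    exact htlev (pos_iff_ne_zero.2 hne)
  let r : ℕ → ℝ := fun n => 1 / ((n : ℝ) + 2)
  have hr0 : ∀ n, 0 < r n := fun n => by positivity
  have hr1 : ∀ n, r n < 1 := fun n => by
    rw [div_lt_one (by positivity)]
    have : (0 : ℝ) ≤ n := n.cast_nonneg
    linarith
  have hrlim : Tendsto r atTop (𝓝 0) := by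
    have h1 : Tendsto (fun n : ℕ => (n : ℝ) + 2) atTop atTop :=
      tendsto_atTop_add_const_right _ _ tendsto_natCast_atTop_atTop
    exact (tendsto_const_nhds (x := (1 : ℝ))).div_atTop h1
  choose η hηc hηb hη0 hη1 hηd using fun n => exists_smooth_step t (hr0 n) (hr1 n)
  have hcomp : ∀ n, ContDiff ℝ ∞ (η n ∘ ψ) := fun n => (hηc n).comp hψ
  -- the energy of the approximations
  have hVn : ∀ n, variation Ω φ (η n ∘ ψ) ≤
      lam (Metric.closedBall t (r n)) / volume (Metric.closedBall t (r n)) *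
        ENNReal.ofReal (1 - r n)⁻¹ := by
    intro n
    have h1r : 0 < 1 - r n := by linarith [hr1 n]
    set c : ℝ≥0∞ := ENNReal.ofReal (2 * r n * (1 - r n))⁻¹ with hc
    calc variation Ω φ (η n ∘ ψ) ≤ wNorm Ω φ (fderiv ℝ (η n ∘ ψ)) :=
          h.variation_le_of_contDiff (hcomp n)
      _ ≤ ∫⁻ x, ‖fderiv ℝ ψ x‖ₑ *
            (Metric.closedBall t (r n)).indicator (fun _ => c) (ψ x) ∂(wMeasure Ω φ) := by
          refine lintegral_mono fun x => ?_
          have e1 : fderiv ℝ (η n ∘ ψ) x = deriv (η n) (ψ x) • fderiv ℝ ψ x :=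
            (((hηc n).differentiable (by simp) (ψ x)).hasDerivAt.comp_hasFDerivAt x
              (hψ.differentiable (by simp) x).hasFDerivAt).fderiv
          rw [e1, enorm_smul, mul_comm]
          gcongr
          exact hηd n _
      _ = ∫⁻ s, (Metric.closedBall t (r n)).indicator (fun _ => c) s ∂lam := by
          have hi : Measurable ((Metric.closedBall t (r n)).indicator fun _ => c) :=
            measurable_const.indicator Metric.isClosed_closedBall.measurableSet
          rw [hlam, lintegral_map hi hψm]
          exact (lintegral_withDensity_eq_lintegral_mul _ hfm (hi.comp hψm)).symm
      _ = c * lam (Metric.closedBall t (r n)) := by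
          rw [lintegral_indicator Metric.isClosed_closedBall.measurableSet, setLIntegral_const]
      _ = _ := by
          rw [Real.volume_closedBall, hc, mul_inv, ENNReal.ofReal_mul (by
            have := hr0 n; positivity), ENNReal.ofReal_inv_of_pos (by linarith [hr0 n]),
            div_eq_mul_inv]
          ring
  have hlim : Tendsto (fun n => ∫⁻ x, ‖(η n ∘ ψ) x -
      {x | t < ψ x}.indicator (fun _ => (1 : ℝ)) x‖ₑ ∂(wMeasure Ω φ)) atTop (𝓝 0) := by
    have hmE : MeasurableSet {x | t < ψ x} := measurableSet_lt measurable_const hψm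
    have hind : Measurable ({x | t < ψ x}.indicator fun _ => (1 : ℝ)) :=
      measurable_const.indicator hmE
    have h1 := tendsto_lintegral_of_dominated_convergence (μ := wMeasure Ω φ)
      (F := fun n x => ‖(η n ∘ ψ) x - {x | t < ψ x}.indicator (fun _ => (1 : ℝ)) x‖ₑ)
      (f := fun _ => 0) (fun _ => 2)
      (fun n => ((hcomp n).continuous.measurable.sub hind).enorm) ?_ ?_ ?_
    · simpa using h1
    · intro n
      refine Eventually.of_forall fun x => ?_
      have h2 : ‖(η n ∘ ψ) x - {x | t < ψ x}.indicator (fun _ => (1 : ℝ)) x‖ ≤ 2 := by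
        refine (norm_sub_le _ _).trans ?_
        have h3 : ‖(η n ∘ ψ) x‖ ≤ 1 := hηb n _
        have h4 : ‖{x | t < ψ x}.indicator (fun _ => (1 : ℝ)) x‖ ≤ 1 :=
          (norm_indicator_le_norm_self _ _).trans (by simp)
        linarith
      simp only
      rw [← ofReal_norm]
      exact (ENNReal.ofReal_le_ofReal h2).trans (by simp)
    · rw [lintegral_const]
      exact ENNReal.mul_ne_top (by simp) (measure_ne_top _ _)
    · have hne : ∀ᵐ x ∂(wMeasure Ω φ), ψ x ≠ t := by
        rw [ae_iff]
        simpa using htlev0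
      filter_upwards [hne] with x hx
      refine tendsto_const_nhds.congr' ?_
      have hd : 0 < |ψ x - t| := abs_pos.2 (sub_ne_zero.2 hx)
      filter_upwards [hrlim.eventually (gt_mem_nhds hd)] with n hn
      rcases lt_or_gt_of_ne hx with hlt | hgt
      · rw [abs_of_neg (by linarith)] at hn
        have : ¬ t < ψ x := by linarith
        simp [hη0 n (ψ x) (by linarith), this]
      · rw [abs_of_pos (by linarith)] at hn
        simp [hη1 n (ψ x) (by linarith), hgt]
  refine (variation_le_liminf ?_ (fun n => h.integrable_of_continuous (hcomp n).continuous)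
    hlim).trans ?_
  · exact (integrable_const (1 : ℝ)).indicator (measurableSet_lt measurable_const hψm)
  refine (liminf_le_liminf (Eventually.of_forall hVn)).trans ?_
  have hr' : Tendsto r atTop (𝓝[>] 0) :=
    tendsto_nhdsWithin_iff.2 ⟨hrlim, Eventually.of_forall hr0⟩
  have l1 := ht.comp hr'
  have l2 : Tendsto (fun n => ENNReal.ofReal (1 - r n)⁻¹) atTop (𝓝 1) := by
    have e1 : Tendsto (fun n => (1 - r n)⁻¹) atTop (𝓝 ((1 - 0)⁻¹)) :=
      (tendsto_const_nhds.sub hrlim).inv₀ (by simp)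
    have e2 := (ENNReal.continuous_ofReal.tendsto _).comp e1
    simpa [Function.comp_def] using e2
  have l3 := ENNReal.Tendsto.mul l1 (Or.inr ENNReal.one_ne_top) l2 (Or.inl one_ne_zero)
  rw [mul_one] at l3
  exact l3.liminf_eq.le

/-- The coarea inequality for functions of bounded weighted variation. -/
theorem coarea_le (h : ConcaveWeight m Ω φ) {u : Eucl N → ℝ} (hum : Measurable u)
    (hu : Integrable u (wMeasure Ω φ)) (hV : variation Ω φ u ≠ ⊤) :
    ∃ p : ℝ → ℝ≥0∞, Measurable p ∧ (∀ᵐ t, perimeter Ω φ {x | t < u x} ≤ p t) ∧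
      ∫⁻ t, p t ≤ variation Ω φ u := by
  have := h.isFiniteMeasure
  -- The added `1 / (k + 1)` keeps the bound positive, as the approximation requires, when the
  -- variation vanishes.
  let c : ℕ → ℝ := fun k => (variation Ω φ u).toReal + 1 / ((k : ℝ) + 1)
  have hc0 : ∀ k, 0 < c k := fun k => by positivity
  have hVc : ∀ k, variation Ω φ u ≤ ENNReal.ofReal (c k) := fun k => by
    rw [ENNReal.le_ofReal_iff_toReal_le hV (hc0 k).le]
    have : (0 : ℝ) ≤ 1 / ((k : ℝ) + 1) := by positivity
    simp only [c]
    linarith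
  choose ψ hψ _ hψn hψd using fun k => h.exists_testFunction_approx hu (hc0 k) (hVc k)
    (δ := (2⁻¹ : ℝ≥0∞) ^ k) (by simp)
  choose p hpm hpe hpi using fun k => h.coarea_le_of_contDiff (hψ k)
  have hψm : ∀ k, Measurable (ψ k) := fun k => (hψ k).continuous.measurable
  let d : ℕ → ℝ → ℝ≥0∞ := fun k t => ∫⁻ x, ‖{x | t < ψ k x}.indicator (fun _ => (1 : ℝ)) x -
      {x | t < u x}.indicator (fun _ => (1 : ℝ)) x‖ₑ ∂(wMeasure Ω φ)
  have hdm : ∀ k, Measurable (d k) := fun k => by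
    have h1 : Measurable (Function.uncurry fun (t : ℝ) (x : Eucl N) =>
        ‖(Iio (ψ k x)).indicator (fun _ => (1 : ℝ)) t -
          (Iio (u x)).indicator (fun _ => (1 : ℝ)) t‖ₑ) :=
      ((measurable_indicator_levelSet (hψm k)).sub (measurable_indicator_levelSet hum)).enorm
    exact h1.lintegral_prod_right'
  -- Geometric errors make the distances between level sets summable for almost every `t`, so no
  -- subsequence is needed; Fatou then bounds the liminf of the densities.
  have hsum : ∫⁻ t, ∑' k, d k t ≠ ⊤ := by
    rw [lintegral_tsum fun k => (hdm k).aemeasurable]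
    have h1 : ∀ k, ∫⁻ t, d k t ≤ (2⁻¹ : ℝ≥0∞) ^ k := fun k => by
      simp only [d]
      rw [lintegral_levelSet_sub hum (hψm k)]
      exact (hψd k).le
    refine ne_top_of_le_ne_top ?_ (ENNReal.tsum_le_tsum h1)
    rw [ENNReal.tsum_geometric]
    simp
  have hae : ∀ᵐ t, Tendsto (fun k => d k t) atTop (𝓝 0) := by
    filter_upwards [ae_lt_top (Measurable.tsum hdm) hsum] with t ht
    exact ENNReal.tendsto_atTop_zero_of_tsum_ne_top ht.ne
  refine ⟨fun t => liminf (fun k => p k t) atTop, Measurable.liminf hpm, ?_, ?_⟩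
  · filter_upwards [hae, ae_all_iff.2 hpe] with t ht hpt
    refine (variation_le_liminf ?_ (fun k => ?_) ht).trans
      (liminf_le_liminf (Eventually.of_forall hpt))
    · exact (integrable_const (1 : ℝ)).indicator (measurableSet_lt measurable_const hum)
    · exact (integrable_const (1 : ℝ)).indicator (measurableSet_lt measurable_const (hψm k))
  · refine (lintegral_liminf_le hpm).trans ?_
    refine (liminf_le_liminf (Eventually.of_forall fun k => (hpi k).trans (hψn k))).trans ?_
    have l1 : Tendsto c atTop (𝓝 ((variation Ω φ u).toReal + 0)) :=
      tendsto_const_nhds.add tendsto_one_div_add_atTop_nhds_zero_nat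
    have l2 := (ENNReal.continuous_ofReal.tendsto _).comp l1
    rw [add_zero, ENNReal.ofReal_toReal hV] at l2
    exact l2.liminf_eq.le

end ConcaveWeight

/-! ### Comparison of the four constants -/

lemma wNorm_congr {F : Type*} [NormedAddCommGroup F] {u v : Eucl N → F}
    (h : u =ᵐ[wMeasure Ω φ] v) : wNorm Ω φ u = wNorm Ω φ v :=
  lintegral_congr_ae (h.mono fun x hx => by simp only [hx])

lemma BVAdmissible.congr {u v : Eucl N → ℝ} (hu : BVAdmissible Ω φ u)
    (h : u =ᵐ[wMeasure Ω φ] v) : BVAdmissible Ω φ v :=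
  ⟨⟨hu.1.1.congr h, by rw [← variation_congr h]; exact hu.1.2⟩,
    by rw [← integral_congr_ae h]; exact hu.2.1, by rw [← wNorm_congr h]; exact hu.2.2⟩

lemma perimeter_congr {E F : Set (Eucl N)} (h : E =ᵐ[wMeasure Ω φ] F) :
    perimeter Ω φ E = perimeter Ω φ F :=
  variation_congr (indicator_ae_eq_of_ae_eq_set h)

lemma tendsto_wNorm {u : Eucl N → ℝ} {v : ℕ → Eucl N → ℝ}
    (hu : Integrable u (wMeasure Ω φ)) (hv : ∀ k, Integrable (v k) (wMeasure Ω φ))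
    (hlim : Tendsto (fun k => ∫⁻ x, ‖v k x - u x‖ₑ ∂(wMeasure Ω φ)) atTop (𝓝 0)) :
    Tendsto (fun k => wNorm Ω φ (v k)) atTop (𝓝 (wNorm Ω φ u)) := by
  have hfin : wNorm Ω φ u ≠ ⊤ := hu.2.ne
  have l1 : Tendsto (fun k => wNorm Ω φ u - ∫⁻ x, ‖v k x - u x‖ₑ ∂(wMeasure Ω φ)) atTop
      (𝓝 (wNorm Ω φ u)) := by
    have := ENNReal.Tendsto.sub (tendsto_const_nhds (x := wNorm Ω φ u)) hlim (Or.inl hfin)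
    simpa using this
  have l2 : Tendsto (fun k => wNorm Ω φ u + ∫⁻ x, ‖v k x - u x‖ₑ ∂(wMeasure Ω φ)) atTop
      (𝓝 (wNorm Ω φ u)) := by
    have := (tendsto_const_nhds (x := wNorm Ω φ u)).add hlim
    simpa using this
  refine tendsto_of_tendsto_of_tendsto_of_le_of_le l1 l2 (fun k => ?_) (fun k => ?_)
  · refine tsub_le_iff_right.2 ?_
    unfold wNorm
    rw [← lintegral_add_left' (hv k).1.enorm]
    refine lintegral_mono fun x => ?_
    have : u x = v k x - (v k x - u x) := by ring
    nth_rewrite 1 [this]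
    exact enorm_sub_le
  · unfold wNorm
    rw [← lintegral_add_left' hu.1.enorm]
    refine lintegral_mono fun x => ?_
    have : v k x = u x + (v k x - u x) := by ring
    nth_rewrite 1 [this]
    exact enorm_add_le _ _

lemma sigmaOne_le {u : Eucl N → ℝ} {G : Eucl N → Eucl N} (hu : MemSobolev Ω φ u G)
    (h0 : ∫ x, u x ∂(wMeasure Ω φ) = 0) (hn : wNorm Ω φ u ≠ 0) :
    sigmaOne Ω φ ≤ wNorm Ω φ G / wNorm Ω φ u :=
  iInf_le_of_le u (iInf_le_of_le G (iInf_le_of_le hu (iInf_le_of_le h0 (iInf_le _ hn))))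

lemma sigmaTilde_le {A B : Set (Eucl N)} {a b : ℝ≥0} (hp : PairAdmissible Ω φ A B a b) :
    sigmaTilde Ω φ ≤ pairRatio Ω φ A B a b :=
  iInf_le_of_le A (iInf_le_of_le B (iInf_le_of_le a (iInf_le_of_le b (iInf_le _ hp))))

/-! ### The Sobolev and relaxed constants. -/

namespace ConcaveWeight

lemma memSobolev_sub_const (h : ConcaveWeight m Ω φ) {ψ : Eucl N → ℝ} (hψ : ContDiff ℝ ∞ ψ)
    (c : ℝ) : MemSobolev Ω φ (fun x => ψ x - c) (gradient ψ) := by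
  have hc : Continuous fun x => ψ x - c := hψ.continuous.sub continuous_const
  refine ⟨h.integrable_of_continuous hc, h.integrable_of_continuous (continuous_gradient hψ),
    hc.locallyIntegrable.locallyIntegrableOn _,
    (continuous_gradient hψ).locallyIntegrable.locallyIntegrableOn _, ?_⟩
  intro χ hχ hχc hχΩ v
  have hd : ∀ x, DifferentiableAt ℝ (fun x => ψ x - c) x := fun x =>
    (hψ.differentiable (by simp) x).sub_const c
  have hfc : Continuous (fderiv ℝ ψ) := hψ.continuous_fderiv (by simp)
  have hχfc : Continuous (fderiv ℝ χ) := hχ.continuous_fderiv (by simp)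
  have hχv : HasCompactSupport fun x => fderiv ℝ χ x v := hχc.fderiv_apply ℝ v
  have e1 : ∫ x in Ω, (ψ x - c) * fderiv ℝ χ x v = ∫ x, (ψ x - c) * fderiv ℝ χ x v :=
    setIntegral_eq_integral_of_forall_compl_eq_zero fun x hx => by
      have : fderiv ℝ χ x = 0 := by
        by_contra hne
        exact hx (hχΩ (support_fderiv_subset ℝ hne))
      simp [this]
  have e2 : ∫ x in Ω, inner ℝ (gradient ψ x) v * χ x = ∫ x, fderiv ℝ ψ x v * χ x := by
    simp only [inner_gradient]
    refine setIntegral_eq_integral_of_forall_compl_eq_zero fun x hx => ?_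
    have : χ x = 0 := by
      by_contra hne
      exact hx (hχΩ (subset_tsupport χ hne))
    simp [this]
  have hfd : ∀ x, fderiv ℝ (fun x => ψ x - c) x = fderiv ℝ ψ x := fun x => fderiv_sub_const c
  rw [e1, e2, integral_mul_fderiv_eq_neg_fderiv_mul_of_integrable]
  · simp only [hfd]
  · simp only [hfd]
    exact ((hfc.clm_apply continuous_const).mul hχ.continuous).integrable_of_hasCompactSupport
      hχc.mul_left
  · exact (hc.mul (hχfc.clm_apply continuous_const)).integrable_of_hasCompactSupport hχv.mul_left
  · exact (hc.mul hχ.continuous).integrable_of_hasCompactSupport hχc.mul_left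
  · exact fun x _ => hd x
  · exact fun x _ => hχ.differentiable (by simp) x

lemma sigmaBar_le_sigmaOne (h : ConcaveWeight m Ω φ) : sigmaBar Ω φ ≤ sigmaOne Ω φ := by
  refine le_iInf fun u => le_iInf fun G => le_iInf fun hu => le_iInf fun h0 => le_iInf fun hn => ?_
  have hV := h.variation_le_of_memSobolev hu
  have hadm : BVAdmissible Ω φ u := ⟨⟨hu.integrable, hV.trans_lt hu.integrable_grad.2⟩, h0, hn⟩
  exact (iInf₂_le u hadm).trans (by gcongr)

/-- Test functions approximating a competitor, corrected by their means, are Sobolev competitors;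
the means tend to 0 and the quotients pass to the limit. -/
lemma sigmaOne_le_sigmaBar (h : ConcaveWeight m Ω φ) : sigmaOne Ω φ ≤ sigmaBar Ω φ := by
  have := h.isFiniteMeasure
  refine le_iInf₂ fun u hu => ?_
  obtain ⟨⟨hui, hV⟩, h0, hn⟩ := hu
  have hμ0 : (wMeasure Ω φ).real univ ≠ 0 := by
    rw [Measure.real, ENNReal.toReal_ne_zero]
    refine ⟨?_, measure_ne_top _ _⟩
    rw [h.measure_univ_eq]
    exact h.measure_pos h.isOpen h.nonempty subset_rfl
  let c : ℕ → ℝ := fun k => (variation Ω φ u).toReal + 1 / ((k : ℝ) + 1)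
  have hc0 : ∀ k, 0 < c k := fun k => by positivity
  have hVc : ∀ k, variation Ω φ u ≤ ENNReal.ofReal (c k) := fun k => by
    rw [ENNReal.le_ofReal_iff_toReal_le hV.ne (hc0 k).le]
    have : (0 : ℝ) ≤ 1 / ((k : ℝ) + 1) := by positivity
    simp only [c]
    linarith
  choose ψ hψ _ hψn hψd using fun k => h.exists_testFunction_approx hui (hc0 k) (hVc k)
    (δ := (2⁻¹ : ℝ≥0∞) ^ k) (by simp)
  have hψi : ∀ k, Integrable (ψ k) (wMeasure Ω φ) := fun k =>
    h.integrable_of_continuous (hψ k).continuous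
  let a : ℕ → ℝ := fun k => (∫ x, ψ k x ∂(wMeasure Ω φ)) / (wMeasure Ω φ).real univ
  let w : ℕ → Eucl N → ℝ := fun k x => ψ k x - a k
  have hw : ∀ k, MemSobolev Ω φ (w k) (gradient (ψ k)) := fun k =>
    h.memSobolev_sub_const (hψ k) (a k)
  have hw0 : ∀ k, ∫ x, w k x ∂(wMeasure Ω φ) = 0 := fun k => by
    simp only [w]
    rw [integral_sub (hψi k) (integrable_const _), integral_const, smul_eq_mul]
    simp only [a]
    rw [mul_div_cancel₀ _ hμ0, sub_self]
  have hd0 : Tendsto (fun k => ∫⁻ x, ‖ψ k x - u x‖ₑ ∂(wMeasure Ω φ)) atTop (𝓝 0) :=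
    tendsto_of_tendsto_of_tendsto_of_le_of_le tendsto_const_nhds
      (ENNReal.tendsto_pow_atTop_nhds_zero_of_lt_one (by simp)) (fun _ => zero_le)
      (fun k => (hψd k).le)
  have ha : Tendsto a atTop (𝓝 0) := by
    have h1 := tendsto_integral_of_L1 u hui.1 (Eventually.of_forall hψi) hd0
    rw [h0] at h1
    have h2 := h1.div_const ((wMeasure Ω φ).real univ)
    simpa using h2
  have hdw : Tendsto (fun k => ∫⁻ x, ‖w k x - u x‖ₑ ∂(wMeasure Ω φ)) atTop (𝓝 0) := by
    have h1 : Tendsto (fun k => ∫⁻ x, ‖ψ k x - u x‖ₑ ∂(wMeasure Ω φ) +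
        ‖a k‖ₑ * wMeasure Ω φ univ) atTop (𝓝 0) := by
      have e1 : Tendsto (fun k => ‖a k‖ₑ) atTop (𝓝 0) := by
        have := ha.enorm
        simpa using this
      have e2 := hd0.add (ENNReal.Tendsto.mul_const e1
        (Or.inr (measure_ne_top (wMeasure Ω φ) univ)))
      simpa using e2
    refine tendsto_of_tendsto_of_tendsto_of_le_of_le tendsto_const_nhds h1 (fun _ => zero_le)
      fun k => ?_
    simp only
    rw [← lintegral_const, ← lintegral_add_right _ measurable_const]
    refine lintegral_mono fun x => ?_
    have : w k x - u x = (ψ k x - u x) - a k := by simp only [w]; ring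
    rw [this]
    exact enorm_sub_le
  have hnw := tendsto_wNorm hui (fun k => (hw k).integrable) hdw
  have hcl : Tendsto (fun k => ENNReal.ofReal (c k)) atTop (𝓝 (variation Ω φ u)) := by
    have l1 : Tendsto c atTop (𝓝 ((variation Ω φ u).toReal + 0)) :=
      tendsto_const_nhds.add tendsto_one_div_add_atTop_nhds_zero_nat
    have l2 := (ENNReal.continuous_ofReal.tendsto _).comp l1
    rw [add_zero, ENNReal.ofReal_toReal hV.ne] at l2
    exact l2
  have hdiv := ENNReal.Tendsto.div hcl (Or.inr hn) hnw (Or.inr hV.ne)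
  refine ge_of_tendsto hdiv ?_
  filter_upwards [hnw.eventually_ne hn] with k hk
  refine (sigmaOne_le (hw k) (hw0 k) hk).trans ?_
  rw [wNorm_gradient]
  exact ENNReal.div_le_div_right (hψn k) _

/-- A bump minus its mean is not null, since the bump takes the values 1 and 0 on open subsets of
`Ω`. The second set is nonempty because `N ≥ 1` provides a vector of norm `3 r / 4`. -/
lemma exists_BVAdmissible (h : ConcaveWeight m Ω φ) (hN : 1 ≤ N) : ∃ u, BVAdmissible Ω φ u := by
  have := h.isFiniteMeasure
  have : Nontrivial (Eucl N) := by
    have : Nonempty (Fin N) := ⟨⟨0, hN⟩⟩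
    infer_instance
  obtain ⟨x₀, hx₀⟩ := h.nonempty
  obtain ⟨r, hr, hball⟩ := Metric.isOpen_iff.1 h.isOpen x₀ hx₀
  obtain ⟨v, hv⟩ := exists_norm_eq (Eucl N) (show (0 : ℝ) ≤ 3 * r / 4 by positivity)
  let b : ContDiffBump x₀ := ⟨r / 4, r / 2, by positivity, by linarith⟩
  have hb : ContDiff ℝ ∞ (b : Eucl N → ℝ) := b.contDiff
  have hbi := h.integrable_of_continuous hb.continuous
  set a : ℝ := (∫ x, b x ∂(wMeasure Ω φ)) / (wMeasure Ω φ).real univ with ha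
  have hμ0 : (wMeasure Ω φ).real univ ≠ 0 := by
    rw [Measure.real, ENNReal.toReal_ne_zero]
    refine ⟨?_, measure_ne_top _ _⟩
    rw [h.measure_univ_eq]
    exact h.measure_pos h.isOpen h.nonempty subset_rfl
  have hi : Integrable (fun x => b x - a) (wMeasure Ω φ) := hbi.sub (integrable_const _)
  refine ⟨fun x => b x - a, ⟨hi, ?_⟩, ?_, fun hzero => ?_⟩
  · have h1 := h.variation_add_const hbi (-a)
    simp only [← sub_eq_add_neg] at h1
    rw [h1]
    exact (h.variation_le_of_contDiff hb).trans_lt (h.wNorm_fderiv_lt_top hb)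
  · rw [integral_sub hbi (integrable_const _), integral_const, smul_eq_mul, ha,
      mul_div_cancel₀ _ hμ0, sub_self]
  · have hae : ∀ᵐ x ∂(wMeasure Ω φ), b x = a := by
      have := (lintegral_eq_zero_iff' hi.1.enorm).1 hzero
      filter_upwards [this] with x hx
      have hx' : b x - a = 0 := by simpa using hx
      linarith
    have key : ∀ U : Set (Eucl N), IsOpen U → U.Nonempty → U ⊆ Ω → ∃ x ∈ U, b x = a := by
      intro U hU hne hUΩ
      by_contra! hcon
      refine h.measure_pos hU hne hUΩ (measure_mono_null (fun x hx => hcon x hx) hae)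
    obtain ⟨x, hx, hxa⟩ := key (Metric.ball x₀ (r / 4)) Metric.isOpen_ball
      ⟨x₀, Metric.mem_ball_self (by positivity)⟩
      ((Metric.ball_subset_ball (by linarith)).trans hball)
    obtain ⟨y, hy, hya⟩ := key (Metric.ball x₀ r ∩ (Metric.closedBall x₀ (r / 2))ᶜ)
      (Metric.isOpen_ball.inter Metric.isClosed_closedBall.isOpen_compl)
      ⟨x₀ + v, by simp [hv]; constructor <;> linarith⟩ (inter_subset_left.trans hball)
    rw [b.one_of_mem_closedBall (Metric.ball_subset_closedBall hx)] at hxa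
    rw [b.zero_of_le_dist (le_of_lt (by simpa using hy.2))] at hya
    linarith

/-- Direct method: a minimizing sequence scaled to norm 1 has an `L¹` limit of norm 1 and zero mean,
and the variation is lower semicontinuous. -/
lemma exists_BVOptimal (h : ConcaveWeight m Ω φ) (hN : 1 ≤ N) : ∃ u, BVOptimal Ω φ u := by
  have := h.isFiniteMeasure
  obtain ⟨u₀, hu₀⟩ := h.exists_BVAdmissible hN
  have hfin : sigmaBar Ω φ ≠ ⊤ :=
    ((iInf₂_le u₀ hu₀).trans_lt (ENNReal.div_lt_top hu₀.1.2.ne hu₀.2.2)).ne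
  have hex : ∀ n : ℕ, ∃ u, BVAdmissible Ω φ u ∧
      variation Ω φ u / wNorm Ω φ u < sigmaBar Ω φ + ((n : ℝ≥0∞) + 1)⁻¹ := by
    intro n
    have h1 : sigmaBar Ω φ < sigmaBar Ω φ + ((n : ℝ≥0∞) + 1)⁻¹ :=
      ENNReal.lt_add_right hfin (by simp)
    obtain ⟨u, hu⟩ := iInf_lt_iff.1 h1
    obtain ⟨hu1, hu2⟩ := iInf_lt_iff.1 hu
    exact ⟨u, hu1, hu2⟩
  choose u hu hur using hex
  let c : ℕ → ℝ≥0 := fun n => (wNorm Ω φ (u n))⁻¹.toNNReal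
  have hc : ∀ n, (c n : ℝ≥0∞) = (wNorm Ω φ (u n))⁻¹ := fun n =>
    ENNReal.coe_toNNReal (ENNReal.inv_ne_top.2 (hu n).2.2)
  let v : ℕ → Eucl N → ℝ := fun n x => c n * u n x
  have hvi : ∀ n, Integrable (v n) (wMeasure Ω φ) := fun n => (hu n).1.1.const_mul _
  have hvn : ∀ n, wNorm Ω φ (v n) = 1 := fun n => by
    simp only [wNorm, v, enorm_mul]
    rw [lintegral_const_mul' _ _ enorm_ne_top]
    have e1 : ‖((c n : ℝ≥0) : ℝ)‖ₑ = c n := by simp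
    rw [e1, hc]
    exact ENNReal.inv_mul_cancel (hu n).2.2 (hu n).1.1.2.ne
  have hvV : ∀ n, variation Ω φ (v n) ≤ sigmaBar Ω φ + ((n : ℝ≥0∞) + 1)⁻¹ := fun n => by
    refine (variation_const_mul_le (c n) (u n)).trans ?_
    rw [hc, mul_comm, ← div_eq_mul_inv]
    exact (hur n).le
  have hv0 : ∀ n, ∫ x, v n x ∂(wMeasure Ω φ) = 0 := fun n => by
    simp only [v]
    rw [integral_const_mul, (hu n).2.1, mul_zero]
  obtain ⟨w, hwi, θ, hθ, hlim⟩ := h.exists_subseq_tendsto (M := sigmaBar Ω φ + 1) (by simp [hfin])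
    hvi (fun n => by rw [hvn]; exact le_add_self) (fun n => (hvV n).trans (by
      gcongr
      exact ENNReal.inv_le_one.2 le_add_self))
  have hwn : wNorm Ω φ w = 1 := by
    have h1 := tendsto_wNorm hwi (fun n => hvi (θ n)) hlim
    simp only [hvn] at h1
    exact tendsto_nhds_unique h1 tendsto_const_nhds
  have hw0 : ∫ x, w x ∂(wMeasure Ω φ) = 0 := by
    have h1 := tendsto_integral_of_L1 w hwi.1 (Eventually.of_forall fun n => hvi (θ n)) hlim
    simp only [hv0] at h1
    exact tendsto_nhds_unique h1 tendsto_const_nhds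
  have hwV : variation Ω φ w ≤ sigmaBar Ω φ := by
    refine (variation_le_liminf hwi (fun n => hvi (θ n)) hlim).trans ?_
    refine (liminf_le_liminf (Eventually.of_forall fun n => hvV (θ n))).trans ?_
    have h1 : Tendsto (fun n : ℕ => ((n : ℝ≥0∞) + 1)⁻¹) atTop (𝓝 0) := by
      have := (tendsto_add_atTop_iff_nat 1).2 ENNReal.tendsto_inv_nat_nhds_zero
      simpa using this
    have h2 := (tendsto_const_nhds (x := sigmaBar Ω φ)).add (h1.comp hθ.tendsto_atTop)
    rw [add_zero] at h2
    exact h2.liminf_eq.le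
  have hadm : BVAdmissible Ω φ w :=
    ⟨⟨hwi, hwV.trans_lt (lt_top_iff_ne_top.2 hfin)⟩, hw0, by rw [hwn]; exact one_ne_zero⟩
  refine ⟨w, hadm, le_antisymm ?_ (iInf₂_le w hadm)⟩
  rw [hwn, div_one]
  exact hwV

/-! ### The geometric constants and optimal level sets. -/

lemma nullMeasurableSet_wMeasure {E : Set (Eucl N)} (hE : NullMeasurableSet E volume) :
    NullMeasurableSet E (wMeasure Ω φ) :=
  hE.mono_ac ((withDensity_absolutelyContinuous _ _).trans
    Measure.restrict_le_self.absolutelyContinuous)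

/-- The competitor is `a χ_A - b χ_B`: the balance condition gives zero mean, and disjointness makes
the norm additive. -/
lemma sigmaBar_le_sigmaTilde (h : ConcaveWeight m Ω φ) : sigmaBar Ω φ ≤ sigmaTilde Ω φ := by
  have := h.isFiniteMeasure
  refine le_iInf fun A => le_iInf fun B => le_iInf fun a => le_iInf fun b => le_iInf fun hp => ?_
  obtain ⟨hAΩ, hBΩ, hA, hB, hAB, ha, hb, hab, hA0⟩ := hp
  have hA' := nullMeasurableSet_wMeasure (Ω := Ω) (φ := φ) hA
  have hB' := nullMeasurableSet_wMeasure (Ω := Ω) (φ := φ) hB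
  set f : Eucl N → ℝ := fun x => a * A.indicator (fun _ => (1 : ℝ)) x with hf
  set g : Eucl N → ℝ := fun x => b * B.indicator (fun _ => (1 : ℝ)) x with hg
  have hfi : Integrable f (wMeasure Ω φ) := ((integrable_const (1 : ℝ)).indicator₀ hA').const_mul _
  have hgi : Integrable g (wMeasure Ω φ) := ((integrable_const (1 : ℝ)).indicator₀ hB').const_mul _
  have hui : Integrable (fun x => f x + -g x) (wMeasure Ω φ) := hfi.add hgi.neg
  have hV : variation Ω φ (fun x => f x + -g x) ≤ a * perimeter Ω φ A + b * perimeter Ω φ B :=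
    (variation_add_le hfi hgi.neg).trans (add_le_add (variation_const_mul_le a _)
      ((variation_neg_le g).trans (variation_const_mul_le b _)))
  have hn : wNorm Ω φ (fun x => f x + -g x) =
      a * wMeasure Ω φ A + b * wMeasure Ω φ B := by
    have e1 : ∀ x, ‖f x + -g x‖ₑ =
        A.indicator (fun _ => (a : ℝ≥0∞)) x + B.indicator (fun _ => (b : ℝ≥0∞)) x := by
      intro x
      simp only [hf, hg]
      by_cases hxA : x ∈ A
      · have hxB : x ∉ B := fun hxB => by
          have : x ∈ A ∩ B := ⟨hxA, hxB⟩
          simp [hAB] at this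
        simp [hxA, hxB]
      · by_cases hxB : x ∈ B <;> simp [hxA, hxB]
    unfold wNorm
    simp only [e1]
    rw [lintegral_add_left' (aemeasurable_const.indicator₀ hA'), lintegral_indicator₀ hA',
      lintegral_indicator₀ hB', setLIntegral_const, setLIntegral_const]
  by_cases htop : a * perimeter Ω φ A + b * perimeter Ω φ B = ⊤
  · rw [pairRatio, htop, ENNReal.top_div_of_ne_top]
    · exact le_top
    · exact ENNReal.add_ne_top.2 ⟨ENNReal.mul_ne_top ENNReal.coe_ne_top (measure_ne_top _ _),
        ENNReal.mul_ne_top ENNReal.coe_ne_top (measure_ne_top _ _)⟩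
  have hadm : BVAdmissible Ω φ (fun x => f x + -g x) := by
    refine ⟨⟨hui, hV.trans_lt (lt_top_iff_ne_top.2 htop)⟩, ?_, ?_⟩
    · have e1 : ∫ x, f x ∂(wMeasure Ω φ) = ((a : ℝ≥0∞) * wMeasure Ω φ A).toReal := by
        simp only [hf]
        rw [integral_const_mul, integral_indicator₀ hA', setIntegral_const, smul_eq_mul, mul_one,
          ENNReal.toReal_mul]
        rfl
      have e2 : ∫ x, g x ∂(wMeasure Ω φ) = ((b : ℝ≥0∞) * wMeasure Ω φ B).toReal := by
        simp only [hg]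
        rw [integral_const_mul, integral_indicator₀ hB', setIntegral_const, smul_eq_mul, mul_one,
          ENNReal.toReal_mul]
        rfl
      have e3 : ∫ x, (f x + -g x) ∂(wMeasure Ω φ) =
          ∫ x, f x ∂(wMeasure Ω φ) + ∫ x, -g x ∂(wMeasure Ω φ) := integral_add hfi hgi.neg
      rw [e3, integral_neg, e1, e2, hab, add_neg_cancel]
    · rw [hn]
      have : (a : ℝ≥0∞) * wMeasure Ω φ A ≠ 0 :=
        mul_ne_zero (by exact_mod_cast ha.ne') hA0
      exact fun h0 => this (add_eq_zero.1 h0).1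
  refine (iInf₂_le _ hadm).trans ?_
  rw [hn, pairRatio]
  gcongr

/-- A competitor of the fence problem and its complement compete in the two-set problem. -/
lemma exists_pair_of_fence (h : ConcaveWeight m Ω φ) {E : Set (Eucl N)}
    (hE : FenceAdmissible Ω φ E) :
    ∃ a b, PairAdmissible Ω φ E (Ω \ E) a b ∧ pairRatio Ω φ E (Ω \ E) a b ≤ fenceRatio Ω φ E := by
  have := h.isFiniteMeasure
  obtain ⟨hEΩ, hEm, hE0, hE1⟩ := hE
  have hEm' := nullMeasurableSet_wMeasure (Ω := Ω) (φ := φ) hEm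
  have ca : (((wMeasure Ω φ (Ω \ E)).toNNReal : ℝ≥0) : ℝ≥0∞) = wMeasure Ω φ (Ω \ E) :=
    ENNReal.coe_toNNReal (measure_ne_top _ _)
  have cb : (((wMeasure Ω φ E).toNNReal : ℝ≥0) : ℝ≥0∞) = wMeasure Ω φ E :=
    ENNReal.coe_toNNReal (measure_ne_top _ _)
  -- Crossed weights balance the pair, and the numerator then collapses through `|E| + |Ω ∖ E| =
  -- |Ω|`.
  refine ⟨(wMeasure Ω φ (Ω \ E)).toNNReal, (wMeasure Ω φ E).toNNReal,
    ⟨hEΩ, sdiff_subset, hEm, h.isOpen.measurableSet.nullMeasurableSet.diff hEm, by simp,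
      ENNReal.toNNReal_pos hE1 (measure_ne_top _ _), ENNReal.toNNReal_pos hE0 (measure_ne_top _ _),
      by rw [ca, cb, mul_comm], hE0⟩, ?_⟩
  have hsum : wMeasure Ω φ (Ω \ E) + wMeasure Ω φ E = wMeasure Ω φ Ω := by
    have := measure_inter_add_sdiff₀ Ω hEm'
    rwa [inter_eq_self_of_subset_right hEΩ, add_comm] at this
  rw [pairRatio, fenceRatio, ca, cb]
  have e1 : wMeasure Ω φ (Ω \ E) * wMeasure Ω φ E + wMeasure Ω φ E * wMeasure Ω φ (Ω \ E) =
      2 * wMeasure Ω φ E * wMeasure Ω φ (Ω \ E) := by ring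
  rw [e1, ← hsum, add_mul]
  gcongr
  exact h.perimeter_diff_le hEm'

lemma sigmaTilde_le_sigmaStar (h : ConcaveWeight m Ω φ) : sigmaTilde Ω φ ≤ sigmaStar Ω φ := by
  refine le_iInf₂ fun E hE => ?_
  obtain ⟨a, b, hp, hle⟩ := h.exists_pair_of_fence hE
  exact (sigmaTilde_le hp).trans hle

/-- Without denominators the inequality also holds for trivial sets, where the left side vanishes,
and can be integrated over all levels. -/
lemma sigmaStar_mul_le (h : ConcaveWeight m Ω φ) {E : Set (Eucl N)} (hE : MeasurableSet E) :
    sigmaStar Ω φ * (2 * (wMeasure Ω φ E * wMeasure Ω φ Eᶜ)) ≤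
      wMeasure Ω φ univ * perimeter Ω φ E := by
  have := h.isFiniteMeasure
  by_cases h0 : wMeasure Ω φ E = 0
  · simp [h0]
  by_cases h1 : wMeasure Ω φ Eᶜ = 0
  · simp [h1]
  have e1 : (E ∩ Ω : Set (Eucl N)) =ᵐ[wMeasure Ω φ] E := by
    filter_upwards [h.ae_mem] with x hx
    exact propext ⟨fun hx' => hx'.1, fun hx' => ⟨hx', hx⟩⟩
  have e2 : (Ω \ (E ∩ Ω) : Set (Eucl N)) =ᵐ[wMeasure Ω φ] (Eᶜ : Set (Eucl N)) := by
    filter_upwards [h.ae_mem] with x hx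
    exact propext ⟨fun hx' hxE => hx'.2 ⟨hxE, hx⟩, fun hx' => ⟨hx, fun hxE => hx' hxE.1⟩⟩
  have hadm : FenceAdmissible Ω φ (E ∩ Ω) :=
    ⟨inter_subset_right, (hE.inter h.isOpen.measurableSet).nullMeasurableSet,
      by rwa [measure_congr e1], by rwa [measure_congr e2]⟩
  have h2 : sigmaStar Ω φ ≤ fenceRatio Ω φ (E ∩ Ω) := iInf₂_le _ hadm
  rw [fenceRatio, measure_congr e1, measure_congr e2, perimeter_congr e1,
    ← h.measure_univ_eq] at h2
  rw [← mul_assoc 2]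
  exact ENNReal.mul_le_of_le_div h2

/-- Comparison of the variation with the fences given by the level sets, and the case of
equality. -/
lemma sigmaStar_mul_wNorm_le (h : ConcaveWeight m Ω φ) {u : Eucl N → ℝ} (hum : Measurable u)
    (hu : BVAdmissible Ω φ u) :
    sigmaStar Ω φ * wNorm Ω φ u ≤ variation Ω φ u ∧
      (variation Ω φ u ≤ sigmaStar Ω φ * wNorm Ω φ u → ∀ᵐ t : ℝ,
        wMeasure Ω φ univ * perimeter Ω φ {x | t < u x} ≤
          sigmaStar Ω φ * (2 * (wMeasure Ω φ {x | t < u x} * wMeasure Ω φ {x | t < u x}ᶜ))) := by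
  have := h.isFiniteMeasure
  obtain ⟨⟨hui, hV⟩, h0, hn⟩ := hu
  obtain ⟨p, hpm, hpe, hpi⟩ := h.coarea_le hum hui hV.ne
  have hμ0 : wMeasure Ω φ univ ≠ 0 := by
    rw [h.measure_univ_eq]
    exact h.measure_pos h.isOpen h.nonempty subset_rfl
  have hμt : wMeasure Ω φ univ ≠ ⊤ := measure_ne_top _ _
  set Q : ℝ → ℝ≥0∞ := fun t =>
    sigmaStar Ω φ * (2 * (wMeasure Ω φ {x | t < u x} * wMeasure Ω φ {x | t < u x}ᶜ)) with hQ
  have hQm : Measurable fun t =>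
      2 * (wMeasure Ω φ {x | t < u x} * wMeasure Ω φ {x | t < u x}ᶜ) := by
    have hS : MeasurableSet {p : ℝ × Eucl N | p.1 < u p.2} :=
      measurableSet_lt measurable_fst (hum.comp measurable_snd)
    exact ((measurable_measure_prodMk_left hS).mul
      (measurable_measure_prodMk_left hS.compl)).const_mul 2
  have hQle : ∀ t, Q t ≤ wMeasure Ω φ univ * perimeter Ω φ {x | t < u x} := fun t =>
    h.sigmaStar_mul_le (measurableSet_lt measurable_const hum)
  have hQp : Q ≤ᵐ[volume] fun t => wMeasure Ω φ univ * p t := by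
    filter_upwards [hpe] with t ht
    exact (hQle t).trans (by gcongr)
  have hpint : ∫⁻ t, wMeasure Ω φ univ * p t ≤ wMeasure Ω φ univ * variation Ω φ u := by
    rw [lintegral_const_mul _ hpm]
    gcongr
  have hQint : wMeasure Ω φ univ * (sigmaStar Ω φ * wNorm Ω φ u) ≤ ∫⁻ t, Q t := by
    rw [hQ, lintegral_const_mul _ hQm, mul_left_comm]
    gcongr
    exact measure_mul_lintegral_le_levelSets hum hui h0
  constructor
  · have h1 := hQint.trans ((lintegral_mono_ae hQp).trans hpint)
    exact (ENNReal.mul_le_mul_iff_right hμ0 hμt).1 h1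
  · intro hopt
    have hQfin : ∫⁻ t, Q t ≠ ⊤ := ne_top_of_le_ne_top (ENNReal.mul_ne_top hμt hV.ne)
      ((lintegral_mono_ae hQp).trans hpint)
    -- Between `Q` and `|Ω|_φ p` the integrals agree and are finite, so the functions agree almost
    -- everywhere; the perimeter term is squeezed between them.
    have heq := ae_eq_of_ae_le_of_lintegral_le hQp hQfin (hpm.const_mul _).aemeasurable
      (hpint.trans ((mul_le_mul_right hopt _).trans hQint))
    filter_upwards [heq, hpe] with t ht htp
    exact (mul_le_mul_right htp _).trans ht.ge

lemma sigmaStar_le_sigmaBar (h : ConcaveWeight m Ω φ) : sigmaStar Ω φ ≤ sigmaBar Ω φ := by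
  refine le_iInf₂ fun u hu => ?_
  obtain ⟨u', hu'm, hu'⟩ := hu.1.1.1.aemeasurable
  have h1 := (h.sigmaStar_mul_wNorm_le hu'm (hu.congr hu')).1
  rw [← variation_congr hu', ← wNorm_congr hu'] at h1
  exact (ENNReal.le_div_iff_mul_le (Or.inl hu.2.2) (Or.inl hu.1.1.2.ne)).2 h1

lemma sigmaBar_eq_sigmaStar (h : ConcaveWeight m Ω φ) : sigmaBar Ω φ = sigmaStar Ω φ :=
  le_antisymm (h.sigmaBar_le_sigmaTilde.trans h.sigmaTilde_le_sigmaStar) h.sigmaStar_le_sigmaBar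

/-- Almost every nontrivial superlevel set of an optimal function is an optimal fence. -/
theorem ae_fenceOptimal_levelSet (h : ConcaveWeight m Ω φ) {u : Eucl N → ℝ}
    (hu : BVOptimal Ω φ u) : ∀ᵐ t : ℝ,
      wMeasure Ω φ {x ∈ Ω | t < u x} ≠ 0 → wMeasure Ω φ (Ω \ {x ∈ Ω | t < u x}) ≠ 0 →
        FenceOptimal Ω φ {x ∈ Ω | t < u x} := by
  have := h.isFiniteMeasure
  obtain ⟨hadm, hopt⟩ := hu
  obtain ⟨u', hu'm, hu'⟩ := hadm.1.1.1.aemeasurable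
  have hle : variation Ω φ u' ≤ sigmaStar Ω φ * wNorm Ω φ u' := by
    rw [← variation_congr hu', ← wNorm_congr hu', ← h.sigmaBar_eq_sigmaStar, ← hopt,
      ENNReal.div_mul_cancel hadm.2.2 hadm.1.1.2.ne]
  filter_upwards [(h.sigmaStar_mul_wNorm_le hu'm (hadm.congr hu')).2 hle] with t ht h0 h1
  have e1 : ({x ∈ Ω | t < u x} : Set (Eucl N)) =ᵐ[wMeasure Ω φ] {x | t < u' x} := by
    filter_upwards [h.ae_mem, hu'] with x hx hxu
    refine propext ⟨fun hx' => ?_, fun hx' => ⟨hx, ?_⟩⟩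
    · have : t < u x := hx'.2
      rw [hxu] at this
      exact this
    · rw [hxu]
      exact hx'
  have e2 : (Ω \ {x ∈ Ω | t < u x} : Set (Eucl N)) =ᵐ[wMeasure Ω φ] ({x | t < u' x}ᶜ : Set _) := by
    filter_upwards [h.ae_mem, hu'] with x hx hxu
    refine propext ⟨fun hx' hxE => hx'.2 ⟨hx, ?_⟩, fun hx' => ⟨hx, fun hxE => hx' ?_⟩⟩
    · rw [hxu]
      exact hxE
    · have : t < u x := hxE.2
      rw [hxu] at this
      exact this
  have hnm : NullMeasurableSet {x ∈ Ω | t < u x} volume := by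
    have hm : MeasurableSet (Ω ∩ {x | t < u' x}) :=
      h.isOpen.measurableSet.inter (measurableSet_lt measurable_const hu'm)
    refine hm.nullMeasurableSet.congr ?_
    filter_upwards [(ae_restrict_iff' h.isOpen.measurableSet).1 (h.ae_wMeasure_iff.1 hu')] with x hx
    refine propext ⟨fun hx' => ⟨hx'.1, ?_⟩, fun hx' => ⟨hx'.1, ?_⟩⟩
    · rw [hx hx'.1]
      exact hx'.2
    · have : t < u x := hx'.2
      rw [hx hx'.1] at this
      exact this
  have hfa : FenceAdmissible Ω φ {x ∈ Ω | t < u x} := ⟨fun x hx => hx.1, hnm, h0, h1⟩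
  refine ⟨hfa, le_antisymm ?_ (iInf₂_le _ hfa)⟩
  rw [measure_congr e1] at h0
  rw [measure_congr e2] at h1
  rw [fenceRatio, measure_congr e1, measure_congr e2, perimeter_congr e1, ← h.measure_univ_eq]
  rw [← mul_assoc 2] at ht
  exact ENNReal.div_le_of_le_mul ht

/-- Zero mean and nonzero norm give `{u > 0}` and `{u ≤ 0}` positive measure. A whole interval of
levels `t > 0` is then nontrivial, and it contains one outside the exceptional null set. -/
lemma exists_fenceOptimal (h : ConcaveWeight m Ω φ) {u : Eucl N → ℝ} (hu : BVOptimal Ω φ u) :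
    ∃ E, FenceOptimal Ω φ E := by
  have hlev := h.ae_fenceOptimal_levelSet hu
  obtain ⟨⟨⟨hui, -⟩, hint, hn⟩, -⟩ := hu
  have hne : ¬ u =ᵐ[wMeasure Ω φ] 0 := fun h0 => hn (by
    rw [wNorm_congr h0]
    simp [wNorm])
  have hpos : wMeasure Ω φ {x | 0 < u x} ≠ 0 := by
    intro h0
    have h1 : 0 ≤ᵐ[wMeasure Ω φ] fun x => -u x := by
      rw [measure_eq_zero_iff_ae_notMem] at h0
      filter_upwards [h0] with x hx
      simpa using hx
    have h2 : ∫ x, -u x ∂(wMeasure Ω φ) = 0 := by rw [integral_neg, hint, neg_zero]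
    refine hne ?_
    filter_upwards [(integral_eq_zero_iff_of_nonneg_ae h1 hui.neg).1 h2] with x hx
    simpa using hx
  have hneg : wMeasure Ω φ {x | u x ≤ 0} ≠ 0 := by
    intro h0
    have h1 : 0 ≤ᵐ[wMeasure Ω φ] u := by
      rw [measure_eq_zero_iff_ae_notMem] at h0
      filter_upwards [h0] with x hx
      exact le_of_lt (not_le.1 hx)
    exact hne ((integral_eq_zero_iff_of_nonneg_ae h1 hui).1 hint)
  obtain ⟨n, hnpos⟩ : ∃ n : ℕ, wMeasure Ω φ {x | 1 / ((n : ℝ) + 1) < u x} ≠ 0 := by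
    by_contra! hcon
    refine hpos (measure_mono_null (fun x hx => ?_) (measure_iUnion_null hcon))
    obtain ⟨n, hn⟩ := exists_nat_one_div_lt (show 0 < u x from hx)
    exact mem_iUnion.2 ⟨n, hn⟩
  have hvol : volume (Ioo (0 : ℝ) (1 / ((n : ℝ) + 1))) ≠ 0 := by
    rw [Real.volume_Ioo, sub_zero]
    exact (ENNReal.ofReal_pos.2 (by positivity)).ne'
  have : (ae (volume.restrict (Ioo (0 : ℝ) (1 / ((n : ℝ) + 1))))).NeBot := ae_restrict_neBot.2 hvol
  obtain ⟨t, ht, htm⟩ := ((ae_restrict_of_ae (s := Ioo (0 : ℝ) (1 / ((n : ℝ) + 1))) hlev).and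
    (ae_restrict_mem measurableSet_Ioo)).exists
  refine ⟨_, ht ?_ ?_⟩
  · intro h0
    refine hnpos (measure_mono_null_ae ?_ h0)
    filter_upwards [h.ae_mem] with x hx hxu
    exact ⟨hx, htm.2.trans hxu⟩
  · intro h0
    refine hneg (measure_mono_null_ae ?_ h0)
    filter_upwards [h.ae_mem] with x hx hxu
    refine ⟨hx, fun hxt => ?_⟩
    have h1 : u x ≤ 0 := hxu
    linarith [hxt.2, htm.1]

end ConcaveWeight

end WeightedFence

end

open WeightedFence
theorem proposition2p2 (N : ℕ) (hN : 1 ≤ N) (m : ℕ) (hm : 1 ≤ m)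
    (Ω : Set (EuclideanSpace ℝ (Fin N))) (hΩ_open : IsOpen Ω)
    (hΩ_bdd : Bornology.IsBounded Ω) (hΩ_ne : Ω.Nonempty)
    (φ : EuclideanSpace ℝ (Fin N) → ℝ) (hφ_pos : ∀ x ∈ Ω, 0 < φ x)
    (hφ_conc : IsRootConcaveOn m Ω φ) :
    -- the four constants coincide
    (sigmaOne Ω φ = sigmaBar Ω φ ∧ sigmaBar Ω φ = sigmaStar Ω φ ∧
      sigmaStar Ω φ = sigmaTilde Ω φ) ∧
    -- the last three are minima
    (∃ u, BVOptimal Ω φ u) ∧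
    (∃ E, FenceOptimal Ω φ E) ∧
    (∃ A B a b, PairOptimal Ω φ A B a b) ∧
    -- for an optimal `u`, almost every (nontrivial) level set is an optimal fence
    (∀ u, BVOptimal Ω φ u → ∀ᵐ t : ℝ,
      wMeasure Ω φ {x ∈ Ω | t < u x} ≠ 0 → wMeasure Ω φ (Ω \ {x ∈ Ω | t < u x}) ≠ 0 →
        FenceOptimal Ω φ {x ∈ Ω | t < u x}) := by
  have h : ConcaveWeight m Ω φ := ⟨hm, hΩ_open, hΩ_bdd, hΩ_ne, hφ_pos, hφ_conc⟩
  have hst : sigmaStar Ω φ = sigmaTilde Ω φ :=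
    le_antisymm (h.sigmaStar_le_sigmaBar.trans h.sigmaBar_le_sigmaTilde) h.sigmaTilde_le_sigmaStar
  obtain ⟨u, hu⟩ := h.exists_BVOptimal hN
  obtain ⟨E, hE⟩ := h.exists_fenceOptimal hu
  obtain ⟨a, b, hp, hle⟩ := h.exists_pair_of_fence hE.1
  -- The pair formed by an optimal fence and its complement has ratio at most `sigmaStar`, which
  -- equals `sigmaTilde`, so it is optimal.
  refine ⟨⟨le_antisymm h.sigmaOne_le_sigmaBar h.sigmaBar_le_sigmaOne, h.sigmaBar_eq_sigmaStar,
    hst⟩, ⟨u, hu⟩, ⟨E, hE⟩, ⟨E, Ω \ E, a, b, hp, le_antisymm ?_ ?_⟩,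
    fun v hv => h.ae_fenceOptimal_levelSet hv⟩
  · rw [← hst, ← hE.2]
    exact hle
  · exact sigmaTilde_le hp
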